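/- For $s\in\mathbb C$ let $\gamma_+^s$ be the tempered distribution $x_+^{s-1}/\Gamma(s)$, defined for $\operatorname{Re}s>0$ as a locally integrable function and for all $s$ by $\gamma_+^{s}=\partial_x^k\gamma_+^{s+k}$, and for Schwartz functions $f$ on $\mathbb R$ put $$\langle \mathrm{li}_s,f\rangle=\mathrm{PV}\int_{-\infty}^{\infty}\frac{\langle\gamma_+^s,f(\cdot+t)\rangle}{e^{-t}-1}\,dt =\lim_{\epsilon\downarrow0}\int_{|t|>\epsilon}\frac{\langle\gamma_+^s,f(\cdot+t)\rangle}{e^{-t}-1}\,dt ,$$ that is, $\mathrm{li}_s=\gamma_+^s*\mathrm{PV}\frac1{e^{-x}-1}$. Let $(x\pm i0)^{a}=\lim_{\epsilon\downarrow0}(x\pm i\epsilon)^{a}$ (weak limit of tempered distributions, principal branch of the power). **Proposition.** For every $s\in\mathbb C$ the limits defining $\mathrm{li}_s$ exist and define a tempered distribution on $\mathbb R$, and $s\mapsto\mathrm{li}_s$ is entire, i.e. $s\mapsto\langle\mathrm{li}_s,f\rangle$ is entire for each Schwartz function $f$. If $\operatorname{Re}s\ge0$, then the series $\sum_{n\ge1}e^{nx}/n^s$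 converges for all $x<0$ to a smooth function on $(-\infty,0)$, and $\mathrm{li}_s$ agrees with this function on $(-\infty,0)$ (tested against Schwartz functions with support in $(-\infty,0)$). The tempered distributions $(x\pm i0)^a$ exist for all $a\in\mathbb C$, and $$\mathrm{li}_s\equiv-\frac{\Gamma(1-s)}{2}\left[e^{-i\pi s}(x+i0)^{s-1}+e^{i\pi s}(x-i0)^{s-1}\right]$$ modulo meromorphic families of smooth functions. Explicitly: there is a family $R_s$ of smooth functions on $\mathbb R$, holomorphic in $s\in\mathbb C\setminus\{1,2,3,\dots\}$ and meromorphic at $1,2,3,\dots$ as a $C^\infty(\mathbb R)$-valued function of $s$, such that for every $s\in\mathbb C\setminus\{1,2,3,\dots\}$ and every Schwartz function $f$, the function $R_sf$ is integrable and the difference of the two sides, paired with $f$, equals $\int_{\mathbb R}R_s(x)f(x)\,dx$. -/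

import Mathlib

open Filter Topology MeasureTheory Set
open scoped SchwartzMap ContDiff

namespace Polylog

noncomputable section

/-- The `n`-th term (shifted by one) `e^{(n+1)x} / (n+1)^s` of the series of `li_s(x)`. -/
def liTerm (s : ℂ) (x : ℝ) (n : ℕ) : ℂ :=
  Complex.exp (((n : ℂ) + 1) * (x : ℂ)) / ((n : ℂ) + 1) ^ s

/-- `li_s(x) = ∑_{n ≥ 1} e^{nx} / n^s`, used for `x < 0`. -/
def liSeries (s : ℂ) (x : ℝ) : ℂ :=
  ∑' n : ℕ, liTerm s x n

/-- The pairing of a test function `f` with the divided power `γ₊^s = x₊^{s-1} / Γ(s)`, `s ∈ ℂ`.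
For `Re s > 0` we have `k = 0`, and this is `(1 / Γ(s)) ∫₀^∞ x^{s-1} f(x) dx`. In general
`γ₊^s` is the `k`-th distributional derivative of `γ₊^{s+k}`, with `Re s + k > 0`. -/
def gammaPlus (s : ℂ) (f : ℝ → ℂ) : ℂ :=
  let k : ℕ := ⌊1 - s.re⌋₊
  (-1) ^ k / Complex.Gamma (s + k) *
    ∫ x in Ioi (0 : ℝ), (x : ℂ) ^ (s + k - 1) * iteratedDeriv k f x

/-- `T` is the convolution of `γ₊^s` with `li_0 = PV 1 / (e^{-t} - 1)`: for every Schwartz `f`,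
`⟨T, f⟩ = PV ∫ ⟨γ₊^s, f(· + t)⟩ / (e^{-t} - 1) dt`. -/
def IsGammaConvLiZero (s : ℂ) (T : 𝓢'(ℝ, ℂ)) : Prop :=
  ∀ f : 𝓢(ℝ, ℂ),
    Tendsto
      (fun ε : ℝ => ∫ t in {t : ℝ | ε < |t|},
        gammaPlus s (fun x : ℝ => f (x + t)) / (Complex.exp (-(t : ℂ)) - 1))
      (𝓝[>] 0) (𝓝 (T f))

/-- `T` is the tempered distribution `(x + σ i0)^a = lim_{ε ↓ 0} (x + σ i ε)^a` (weak limit,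
principal branch), used for `σ = 1` and `σ = -1`. -/
def IsBoundaryPower (σ : ℝ) (a : ℂ) (T : 𝓢'(ℝ, ℂ)) : Prop :=
  ∀ f : 𝓢(ℝ, ℂ),
    Tendsto
      (fun ε : ℝ => ∫ x : ℝ, ((x : ℂ) + (σ : ℂ) * (ε : ℂ) * Complex.I) ^ a * f x)
      (𝓝[>] 0) (𝓝 (T f))

/-- A family `T_s` of tempered distributions is entire: `s ↦ ⟨T_s, f⟩` is entire for each
Schwartz function `f` (the dual of Schwartz space carries the weak topology). -/
def IsEntireFamily (T : ℂ → 𝓢'(ℝ, ℂ)) : Prop :=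
  ∀ f : 𝓢(ℝ, ℂ), Differentiable ℂ (fun s : ℂ => T s f)

/-- `h` is holomorphic on `U` as a map to the Fréchet space `C^∞(ℝ)`: all `h_s` are smooth, and
each derivative `∂_x^j h_s(x)` is holomorphic in `s` and jointly continuous in `(s, x)`. -/
def IsHolomorphicSmoothFamilyOn (U : Set ℂ) (h : ℂ → ℝ → ℂ) : Prop :=
  (∀ s ∈ U, ContDiff ℝ ∞ (h s)) ∧
  ∀ j : ℕ,
    (∀ x : ℝ, DifferentiableOn ℂ (fun s : ℂ => iteratedDeriv j (h s) x) U) ∧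
    ContinuousOn (fun p : ℂ × ℝ => iteratedDeriv j (h p.1) p.2) (U ×ˢ univ)

/-- `h` is a meromorphic family of smooth functions, on all of `ℂ`, with poles in `P`: it is
holomorphic off `P`, and near each point `a` of `P` some `(s - a)^N h_s` is holomorphic, all with
respect to `C^∞(ℝ)`. -/
def IsMeromorphicSmoothFamily (P : Set ℂ) (h : ℂ → ℝ → ℂ) : Prop :=
  IsHolomorphicSmoothFamilyOn Pᶜ h ∧
  ∀ a ∈ P, ∃ (N : ℕ) (U : Set ℂ) (g : ℂ → ℝ → ℂ), IsOpen U ∧ a ∈ U ∧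
    IsHolomorphicSmoothFamilyOn U g ∧
    ∀ s ∈ U, s ≠ a → ∀ x : ℝ, (s - a) ^ N * h s x = g s x

/-- The positive integers, as a subset of `ℂ`: the poles of `Γ(1 - s)`. -/
def posInts : Set ℂ := {s : ℂ | ∃ n : ℕ, s = (n : ℂ) + 1}

end

end Polylog

/-! Existence. The kernel 1/(e^{-t} - 1) has a simple pole at 0, decays exponentially at -∞ and
tends to -1 at +∞. For Re s > 0 the function G(t) = ⟨γ₊^s, f(· + t)⟩ is C¹, grows at most
polynomially and is O((1+t)^{-2}) for t ≥ 0. Folding the line at 0 turns the principal value into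
the absolutely convergent integral `regPairing G`, bounded by a Schwartz seminorm of f and
holomorphic in s. Integration by parts gives ⟨li_s, f⟩ = -⟨li_{s+1}, f'⟩, which continues li_s to
all s (`liFun`, `liFun_eq`, `differentiable_liFun`).

Computation on the strip -1 < Re s < 0. The principal value kernel is the mean of the boundary
values of 1/(e^{-z} - 1) from above and below the real axis (`RegBound.tendsto_smoothKernel`). One
integration by parts replaces this function by its derivative `boseDeriv`, and Fubini moves the
convolution with γ₊^{s+1} from the test function to the kernel. It remains to evaluate Γ(s+1)⁻¹ ∫₀^∞
y^s boseDeriv(z - y) dy in two ways. Expanding in powers of e^{z-y}, for z = x < 0, gives ∑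
e^{nx}/n^s (`hasSum_liTerm`). Expanding in partial fractions 1/(z - y + 2πim)² and using a beta
integral gives Lipschitz's formula Γ(1-s) ∑_m (-z - 2πim)^{s-1} (`integral_cpow_mul_boseDeriv`).

Only the term m = 0 is singular near the real axis. Its two boundary values are e^{∓iπ(s-1)} (x ±
i0)^{s-1}, and their mean is the singular part of the proposition (`liFun_eq_boundaryPower`). On x <
0 the two boundary values agree, so li_s is the series there (`liFun_eq_integral_liSeries`).

Continuation of the remainder. The sum over m ≠ 0, `lipTail`, converges for Re s < 0 only. Its
x-derivative is (1-s) times its value at s-1, so it can be recovered by integrating in x from x =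
-1, provided that its value at -1 continues in s. By the two expansions this value is (∑
e^{-n}/n^s)/Γ(1-s) - 1, which is entire. Iterating gives the entire family `regPart`, and R_s =
Γ(1-s) · `regPart` s. All identities pass from the strip to their full range of s by the identity
theorem; ℂ minus the poles of Γ(1-s) is connected because these are countably many.

The boundary powers (x ± i0)^a are obtained for Re a < 0 by writing (x ± iε)^a as a Laplace
integral, so that the limit acts on a Fourier transform of f; multiplication by x raises the
exponent (`exists_boundaryPower_of_re_lt`). -/

namespace Polylog

/-! ### Holomorphic parameter integrals and bounds by Schwartz seminorms -/

/-- An integral that depends holomorphically on a parameter and is locally dominated is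
holomorphic. -/
theorem differentiableOn_integral_of_dominated {α : Type*} [MeasurableSpace α] {μ : Measure α}
    {U : Set ℂ} (hU : IsOpen U) {F : ℂ → α → ℂ}
    (hmeas : ∀ s ∈ U, AEStronglyMeasurable (F s) μ)
    (hdiff : ∀ᵐ a ∂μ, DifferentiableOn ℂ (fun s => F s a) U)
    (hbound : ∀ s₀ ∈ U, ∃ V ∈ 𝓝 s₀, ∃ g : α → ℝ, Integrable g μ ∧
      ∀ᵐ a ∂μ, ∀ s ∈ V, ‖F s a‖ ≤ g a) :
    DifferentiableOn ℂ (fun s => ∫ a, F s a ∂μ) U := by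
  intro s₀ hs₀
  obtain ⟨V, hV, g, hg, hFg⟩ := hbound s₀ hs₀
  obtain ⟨r, hr, hrV⟩ := Metric.mem_nhds_iff.1 (Filter.inter_mem hV (hU.mem_nhds hs₀))
  have hrhalf : 0 < r / 2 := by positivity
  have hderiv : ∀ᵐ a ∂μ, ∀ s ∈ Metric.ball s₀ (r / 2),
      HasDerivAt (fun s => F s a) (deriv (fun s => F s a) s) s := by
    filter_upwards [hdiff] with a ha s hs
    have hsU : s ∈ U := (hrV (Metric.ball_subset_ball (by linarith) hs)).2
    exact (ha.differentiableAt (hU.mem_nhds hsU)).hasDerivAt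
  have hsub : ∀ s ∈ Metric.ball s₀ (r / 2), Metric.closedBall s (r / 4) ⊆ Metric.ball s₀ r := by
    intro s hs z hz
    rw [Metric.mem_ball] at hs ⊢
    rw [Metric.mem_closedBall] at hz
    linarith [dist_triangle z s s₀]
  have hbd : ∀ᵐ a ∂μ, ∀ s ∈ Metric.ball s₀ (r / 2),
      ‖deriv (fun s => F s a) s‖ ≤ g a / (r / 4) := by
    filter_upwards [hdiff, hFg] with a ha hga s hs
    have hsub' := hsub s hs
    -- Cauchy's estimate on circles of radius r/4 bounds the derivative by the dominating function
    -- itself, so no separate bound on derivatives has to be assumed.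
    refine Complex.norm_deriv_le_of_forall_mem_sphere_norm_le (by positivity) ?_ ?_
    · refine DifferentiableOn.diffContOnCl ?_
      rw [closure_ball _ (by positivity)]
      exact ha.mono fun z hz => (hrV (hsub' hz)).2
    · intro z hz
      exact hga z (hrV (hsub' (Metric.sphere_subset_closedBall hz))).1
  have hmeas' : AEStronglyMeasurable (fun a => deriv (fun s => F s a) s₀) μ := by
    obtain ⟨u, -, hu, hu0⟩ := exists_seq_strictAnti_tendsto' hrhalf
    have hmem : ∀ n, s₀ + (u n : ℂ) ∈ U := fun n =>
      (hrV (by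
        rw [Metric.mem_ball, dist_eq_norm, add_sub_cancel_left, Complex.norm_real,
          Real.norm_of_nonneg (hu n).1.le]
        linarith [(hu n).2])).2
    -- The derivative is measurable as the almost everywhere limit of difference quotients along a
    -- sequence of real increments.
    refine aestronglyMeasurable_of_tendsto_ae atTop
      (f := fun (n : ℕ) a => ((u n : ℂ))⁻¹ • (F (s₀ + u n) a - F s₀ a)) (fun n => ?_) ?_
    · exact AEStronglyMeasurable.const_smul ((hmeas _ (hmem n)).sub (hmeas _ hs₀)) ((u n : ℂ))⁻¹
    · filter_upwards [hderiv] with a ha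
      have h := (ha s₀ (Metric.mem_ball_self hrhalf)).tendsto_slope_zero
      refine h.comp (tendsto_nhdsWithin_iff.2 ⟨?_, Eventually.of_forall fun n => ?_⟩)
      · exact_mod_cast (Complex.continuous_ofReal.tendsto 0).comp hu0
      · simpa using (hu n).1.ne'
  refine (hasDerivAt_integral_of_dominated_loc_of_deriv_le (Metric.ball_mem_nhds s₀ hrhalf)
    (F := F) (F' := fun s a => deriv (fun s => F s a) s) (bound := fun a => g a / (r / 4))
    ?_ ?_ hmeas' hbd (hg.div_const _) hderiv).2.differentiableAt.differentiableWithinAt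
  · filter_upwards [hU.mem_nhds hs₀] with s hs using hmeas s hs
  · refine hg.mono' (hmeas s₀ hs₀) ?_
    filter_upwards [hFg] with a ha using ha s₀ (mem_of_mem_nhds hV)

/-- A continuous seminorm on Schwartz functions that controls the decay of a function and of its
derivative. -/
noncomputable def decayNorm (N : ℕ) (f : 𝓢(ℝ, ℂ)) : ℝ :=
  2 ^ N * (Finset.Iic (N, 1)).sup (schwartzSeminormFamily ℂ ℝ ℂ) f

theorem decayNorm_nonneg (N : ℕ) (f : 𝓢(ℝ, ℂ)) : 0 ≤ decayNorm N f := by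
  unfold decayNorm; positivity

theorem pow_mul_norm_le_decayNorm {m N : ℕ} (h : m ≤ N) (f : 𝓢(ℝ, ℂ)) (x : ℝ) :
    (1 + |x|) ^ m * ‖f x‖ ≤ decayNorm N f := by
  have := SchwartzMap.one_add_le_sup_seminorm_apply (𝕜 := ℂ) (m := (N, 1)) h (Nat.zero_le 1) f x
  rw [norm_iteratedFDeriv_zero] at this
  exact this

theorem pow_mul_norm_deriv_le_decayNorm {m N : ℕ} (h : m ≤ N) (f : 𝓢(ℝ, ℂ)) (x : ℝ) :
    (1 + |x|) ^ m * ‖SchwartzMap.derivCLM ℂ ℂ f x‖ ≤ decayNorm N f := by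
  have := SchwartzMap.one_add_le_sup_seminorm_apply (𝕜 := ℂ) (m := (N, 1)) h le_rfl f x
  rw [norm_iteratedFDeriv_eq_norm_iteratedDeriv, iteratedDeriv_one] at this
  exact this

theorem norm_le_decayNorm_div {m N : ℕ} (h : m ≤ N) (f : 𝓢(ℝ, ℂ)) (x : ℝ) :
    ‖f x‖ ≤ decayNorm N f / (1 + |x|) ^ m := by
  rw [le_div_iff₀ (by positivity), mul_comm]
  exact pow_mul_norm_le_decayNorm h f x

theorem norm_deriv_le_decayNorm_div {m N : ℕ} (h : m ≤ N) (f : 𝓢(ℝ, ℂ)) (x : ℝ) :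
    ‖SchwartzMap.derivCLM ℂ ℂ f x‖ ≤ decayNorm N f / (1 + |x|) ^ m := by
  rw [le_div_iff₀ (by positivity), mul_comm]
  exact pow_mul_norm_deriv_le_decayNorm h f x

/-- A linear functional bounded by a Schwartz seminorm is a tempered distribution. -/
theorem exists_temperedDistribution (A : 𝓢(ℝ, ℂ) → ℂ) (hadd : ∀ f g, A (f + g) = A f + A g)
    (hsmul : ∀ (c : ℂ) f, A (c • f) = c * A f) (N : ℕ) (C : ℝ) (hC : 0 ≤ C)
    (hbound : ∀ f, ‖A f‖ ≤ C * decayNorm N f) : ∃ T : 𝓢'(ℝ, ℂ), ∀ f, T f = A f := by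
  refine ⟨ContinuousLinearMap.toPointwiseConvergenceCLM _ _ _ _
    (SchwartzMap.mkCLMtoNormedSpace (𝕜 := ℂ) (σ := RingHom.id ℂ) A hadd (by simpa using hsmul)
      ⟨Finset.Iic (N, 1), C * 2 ^ N, by positivity, fun f => ?_⟩), fun f => rfl⟩
  simpa [decayNorm, mul_assoc] using hbound f

theorem integrable_one_add_abs_pow_mul (n : ℕ) (f : 𝓢(ℝ, ℂ)) :
    Integrable (fun x : ℝ => (1 + |x|) ^ n * ‖f x‖) := by
  have h : Integrable (fun x : ℝ => decayNorm (n + 2) f * (1 + ‖x‖) ^ (-(2 : ℝ))) :=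
    (integrable_one_add_norm (by simp)).const_mul _
  refine h.mono' (by fun_prop) (Eventually.of_forall fun x => ?_)
  have hx : (0 : ℝ) < 1 + |x| := by positivity
  rw [Real.norm_of_nonneg (by positivity), Real.rpow_neg (by positivity), Real.norm_eq_abs,
    ← div_eq_mul_inv, le_div_iff₀ (by positivity)]
  calc _ = (1 + |x|) ^ (n + 2) * ‖f x‖ := by norm_cast; ring
    _ ≤ _ := pow_mul_norm_le_decayNorm le_rfl f x

/-! ### Mellin integrals of translated test functions -/

theorem integrableOn_rpow_div_one_add_pow {c : ℝ} {N : ℕ} (hc : 0 < c) (hcN : c < N) :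
    IntegrableOn (fun y : ℝ => y ^ (c - 1) / (1 + y) ^ N) (Ioi 0) := by
  have hm : Measurable (fun y : ℝ => y ^ (c - 1) / (1 + y) ^ N) := by fun_prop
  rw [← Ioc_union_Ioi_eq_Ioi zero_le_one]
  refine IntegrableOn.union ?_ ?_
  · have h := (intervalIntegral.intervalIntegrable_rpow' (a := 0) (b := 1)
      (show -1 < c - 1 by linarith)).1
    refine h.mono' hm.aestronglyMeasurable ?_
    refine ae_restrict_of_forall_mem measurableSet_Ioc fun y hy => ?_
    have hy0 : 0 < y := hy.1
    rw [Real.norm_of_nonneg (by positivity)]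
    exact div_le_self (by positivity) (one_le_pow₀ (by linarith))
  · have h := integrableOn_Ioi_rpow_of_lt (show c - 1 - N < -1 by linarith) zero_lt_one
    refine h.mono' hm.aestronglyMeasurable ?_
    refine ae_restrict_of_forall_mem measurableSet_Ioi fun y hy => ?_
    have hy0 : 0 < y := zero_lt_one.trans hy
    rw [Real.norm_of_nonneg (by positivity), Real.rpow_sub hy0 (c - 1), Real.rpow_natCast]
    gcongr
    linarith

/-- Of the two end exponents, the smaller one dominates for y ≤ 1 and the larger one for y ≥ 1. The
sum serves a whole vertical strip at once, as domination locally uniform in s requires. -/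
theorem rpow_sub_one_le_add {c d σ y : ℝ} (hc : c ≤ σ) (hd : σ ≤ d) (hy : 0 < y) :
    y ^ (σ - 1) ≤ y ^ (c - 1) + y ^ (d - 1) := by
  rcases le_total y 1 with h | h
  · have := Real.rpow_le_rpow_of_exponent_ge hy h (show c - 1 ≤ σ - 1 by linarith)
    have : 0 < y ^ (d - 1) := by positivity
    linarith
  · have := Real.rpow_le_rpow_of_exponent_le h (show σ - 1 ≤ d - 1 by linarith)
    have : 0 < y ^ (c - 1) := by positivity
    linarith

/-- The weight dominating `y ^ (s - 1) * φ (y + t)` for `c ≤ Re s ≤ d`. -/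
noncomputable def mellinWeight (c d : ℝ) (N : ℕ) (y : ℝ) : ℝ :=
  (y ^ (c - 1) + y ^ (d - 1)) / (1 + y) ^ N

theorem integrableOn_mellinWeight {c d : ℝ} {N : ℕ} (hc : 0 < c) (hcd : c ≤ d) (hd : d < N) :
    IntegrableOn (mellinWeight c d N) (Ioi 0) := by
  have := (integrableOn_rpow_div_one_add_pow hc (hcd.trans_lt hd)).add
    (integrableOn_rpow_div_one_add_pow (hc.trans_le hcd) hd)
  refine this.congr (Eventually.of_forall fun y => ?_)
  simp [mellinWeight, add_div]

/-- The unnormalised pairing of `x₊^{s-1}` with the translate `φ(· + t)`. -/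
noncomputable def halfMellin (s : ℂ) (φ : ℝ → ℂ) (t : ℝ) : ℂ :=
  ∫ y in Ioi (0 : ℝ), (y : ℂ) ^ (s - 1) * φ (y + t)

section
variable {c d D : ℝ} {N : ℕ} {s : ℂ} {φ φ' : ℝ → ℂ}

/-- Peetre's inequality 1 + y ≤ (1 + |y+t|)(1 + |t|) trades the decay of φ at y + t for decay in y,
at the cost of polynomial growth in t. -/
theorem norm_mellin_integrand_le (hcs : c ≤ s.re) (hsd : s.re ≤ d) (hD : 0 ≤ D)
    (hφ : ∀ x, ‖φ x‖ ≤ D / (1 + |x|) ^ (N + 2)) (t : ℝ) {y : ℝ} (hy : 0 < y) :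
    ‖(y : ℂ) ^ (s - 1) * φ (y + t)‖ ≤ D * (1 + |t|) ^ (N + 2) * mellinWeight c d N y := by
  rw [norm_mul, Complex.norm_cpow_eq_rpow_re_of_pos hy, Complex.sub_re, Complex.one_re]
  have h1 : 1 + y ≤ (1 + |y + t|) * (1 + |t|) := by
    have : y ≤ |y + t| + |t| := by
      have := abs_sub (y + t) t
      rw [add_sub_cancel_right, abs_of_pos hy] at this
      exact this
    nlinarith [abs_nonneg (y + t), abs_nonneg t]
  have h2 : ‖φ (y + t)‖ ≤ D * (1 + |t|) ^ (N + 2) / (1 + y) ^ N := by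
    refine (hφ _).trans ?_
    rw [div_le_div_iff₀ (by positivity) (by positivity), mul_assoc]
    gcongr
    calc (1 + y) ^ N ≤ (1 + y) ^ (N + 2) := pow_le_pow_right₀ (by linarith) (by omega)
      _ ≤ ((1 + |y + t|) * (1 + |t|)) ^ (N + 2) := by gcongr
      _ = _ := by rw [mul_pow, mul_comm]
  calc y ^ (s.re - 1) * ‖φ (y + t)‖
      ≤ (y ^ (c - 1) + y ^ (d - 1)) * (D * (1 + |t|) ^ (N + 2) / (1 + y) ^ N) := by
        gcongr; exact rpow_sub_one_le_add hcs hsd hy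
    _ = _ := by rw [mellinWeight]; ring

/-- For y, t ≥ 0 the quantity 1 + y + t dominates both 1 + y and 1 + t. Of the N + 2 powers of
decay, N make the y-integral converge and 2 are left for t. This integrability in t is needed at +∞,
where the kernel 1/(e^{-t} - 1) tends to -1. -/
theorem norm_mellin_integrand_le_of_nonneg (hcs : c ≤ s.re) (hsd : s.re ≤ d) (hD : 0 ≤ D)
    (hφ : ∀ x, ‖φ x‖ ≤ D / (1 + |x|) ^ (N + 2)) {t : ℝ} (ht : 0 ≤ t) {y : ℝ} (hy : 0 < y) :
    ‖(y : ℂ) ^ (s - 1) * φ (y + t)‖ ≤ D / (1 + t) ^ 2 * mellinWeight c d N y := by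
  rw [norm_mul, Complex.norm_cpow_eq_rpow_re_of_pos hy, Complex.sub_re, Complex.one_re]
  have h2 : ‖φ (y + t)‖ ≤ D / (1 + t) ^ 2 / (1 + y) ^ N := by
    refine (hφ _).trans ?_
    rw [abs_of_nonneg (by positivity), div_div, pow_add, mul_comm ((1 + t) ^ 2)]
    gcongr <;> linarith
  calc y ^ (s.re - 1) * ‖φ (y + t)‖
      ≤ (y ^ (c - 1) + y ^ (d - 1)) * (D / (1 + t) ^ 2 / (1 + y) ^ N) := by
        gcongr; exact rpow_sub_one_le_add hcs hsd hy
    _ = _ := by rw [mellinWeight]; ring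

theorem aestronglyMeasurable_cpow_mul (hφc : Continuous φ) (t : ℝ) :
    AEStronglyMeasurable (fun y : ℝ => (y : ℂ) ^ (s - 1) * φ (y + t))
      (volume.restrict (Ioi 0)) := by
  refine ContinuousOn.aestronglyMeasurable (fun y hy => ?_) measurableSet_Ioi
  refine ContinuousAt.continuousWithinAt (ContinuousAt.mul ?_ (by fun_prop))
  exact Complex.continuousAt_ofReal_cpow_const y _ (Or.inr (ne_of_gt hy))

theorem integrableOn_mellin_integrand (hs : 0 < s.re) (hsN : s.re < N) (hD : 0 ≤ D)
    (hφc : Continuous φ) (hφ : ∀ x, ‖φ x‖ ≤ D / (1 + |x|) ^ (N + 2)) (t : ℝ) :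
    IntegrableOn (fun y : ℝ => (y : ℂ) ^ (s - 1) * φ (y + t)) (Ioi 0) :=
  ((integrableOn_mellinWeight hs le_rfl hsN).const_mul (D * (1 + |t|) ^ (N + 2))).mono'
    (aestronglyMeasurable_cpow_mul hφc t)
    (ae_restrict_of_forall_mem measurableSet_Ioi fun _ hy =>
      norm_mellin_integrand_le le_rfl le_rfl hD hφ t hy)

theorem norm_halfMellin_le (hc : 0 < c) (hcs : c ≤ s.re) (hsd : s.re ≤ d) (hdN : d < N)
    (hD : 0 ≤ D) (hφ : ∀ x, ‖φ x‖ ≤ D / (1 + |x|) ^ (N + 2)) (t : ℝ) :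
    ‖halfMellin s φ t‖ ≤ D * (∫ y in Ioi 0, mellinWeight c d N y) * (1 + |t|) ^ (N + 2) := by
  refine (norm_integral_le_of_norm_le ((integrableOn_mellinWeight hc (hcs.trans hsd) hdN).const_mul
    (D * (1 + |t|) ^ (N + 2))) (ae_restrict_of_forall_mem measurableSet_Ioi fun _ hy =>
      norm_mellin_integrand_le hcs hsd hD hφ t hy)).trans_eq ?_
  rw [integral_const_mul]; ring

theorem norm_halfMellin_le_of_nonneg (hc : 0 < c) (hcs : c ≤ s.re) (hsd : s.re ≤ d) (hdN : d < N)
    (hD : 0 ≤ D) (hφ : ∀ x, ‖φ x‖ ≤ D / (1 + |x|) ^ (N + 2)) {t : ℝ} (ht : 0 ≤ t) :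
    ‖halfMellin s φ t‖ ≤ D * (∫ y in Ioi 0, mellinWeight c d N y) / (1 + t) ^ 2 := by
  refine (norm_integral_le_of_norm_le ((integrableOn_mellinWeight hc (hcs.trans hsd) hdN).const_mul
    (D / (1 + t) ^ 2)) (ae_restrict_of_forall_mem measurableSet_Ioi fun _ hy =>
      norm_mellin_integrand_le_of_nonneg hcs hsd hD hφ ht hy)).trans_eq ?_
  rw [integral_const_mul]; ring

/-- Since t enters only through φ, the derivative falls on φ and the singular weight y^{s-1} is
untouched. -/
theorem hasDerivAt_halfMellin (hs : 0 < s.re) (hsN : s.re < N) (hD : 0 ≤ D)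
    (hφd : ∀ x, HasDerivAt φ (φ' x) x) (hφc' : Continuous φ')
    (hφ : ∀ x, ‖φ x‖ ≤ D / (1 + |x|) ^ (N + 2)) (hφ' : ∀ x, ‖φ' x‖ ≤ D / (1 + |x|) ^ (N + 2))
    (t : ℝ) : HasDerivAt (halfMellin s φ) (halfMellin s φ' t) t := by
  have hφc : Continuous φ := continuous_iff_continuousAt.2 fun x => (hφd x).continuousAt
  refine (hasDerivAt_integral_of_dominated_loc_of_deriv_le (Metric.ball_mem_nhds t one_pos)
    (F := fun t (y : ℝ) => (y : ℂ) ^ (s - 1) * φ (y + t))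
    (F' := fun t (y : ℝ) => (y : ℂ) ^ (s - 1) * φ' (y + t))
    (bound := fun y => D * (2 + |t|) ^ (N + 2) * mellinWeight s.re s.re N y)
    (Eventually.of_forall fun u => aestronglyMeasurable_cpow_mul hφc u)
    (integrableOn_mellin_integrand hs hsN hD hφc hφ t) (aestronglyMeasurable_cpow_mul hφc' t) ?_
    ((integrableOn_mellinWeight hs le_rfl hsN).const_mul _) ?_).2
  · refine ae_restrict_of_forall_mem measurableSet_Ioi fun y hy u hu => ?_
    refine (norm_mellin_integrand_le le_rfl le_rfl hD hφ' u hy).trans ?_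
    have hy0 : (0 : ℝ) < y := hy
    have hw : 0 ≤ mellinWeight s.re s.re N y := by unfold mellinWeight; positivity
    have hu' : 1 + |u| ≤ 2 + |t| := by
      rw [Metric.mem_ball, Real.dist_eq] at hu
      have := abs_sub_abs_le_abs_sub u t
      linarith
    gcongr
  · refine Eventually.of_forall fun y u _ => ?_
    have h := (hφd (y + u)).comp_const_add y u
    exact h.const_mul _

theorem differentiableOn_halfMellin (hN : 0 ≤ D) (hφc : Continuous φ)
    (hφ : ∀ x, ‖φ x‖ ≤ D / (1 + |x|) ^ (N + 2)) (t : ℝ) :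
    DifferentiableOn ℂ (fun s => halfMellin s φ t) {s | 0 < s.re ∧ s.re < N} := by
  have hU : IsOpen {s : ℂ | 0 < s.re ∧ s.re < N} :=
    (isOpen_lt continuous_const Complex.continuous_re).inter
      (isOpen_lt Complex.continuous_re continuous_const)
  refine differentiableOn_integral_of_dominated hU
    (fun s _ => aestronglyMeasurable_cpow_mul hφc t) ?_ ?_
  · refine ae_restrict_of_forall_mem measurableSet_Ioi fun y hy => ?_
    have hy0 : (y : ℂ) ≠ 0 := by exact_mod_cast (ne_of_gt hy : y ≠ 0)
    intro s _
    refine DifferentiableAt.differentiableWithinAt (DifferentiableAt.mul_const ?_ _)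
    exact (differentiableAt_id.sub_const 1).const_cpow (Or.inl hy0)
  · rintro s₀ ⟨h0, h1⟩
    obtain ⟨c, hc0, hc⟩ := exists_between h0
    obtain ⟨d, hd, hd1⟩ := exists_between h1
    refine ⟨{s | c < s.re ∧ s.re < d}, ?_, fun y => D * (1 + |t|) ^ (N + 2) * mellinWeight c d N y,
      (integrableOn_mellinWeight hc0 (hc.trans hd).le hd1).const_mul _,
      ae_restrict_of_forall_mem measurableSet_Ioi fun y hy s hs =>
      norm_mellin_integrand_le hs.1.le hs.2.le hN hφ t hy⟩
    exact ((isOpen_lt continuous_const Complex.continuous_re).inter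
      (isOpen_lt Complex.continuous_re continuous_const)).mem_nhds ⟨hc, hd⟩

end

/-! ### The principal value pairing with 1/(e^{-t} - 1) -/

/-- The Bose function `1 / (e^t - 1)`. -/
noncomputable def bose (t : ℝ) : ℝ := (Real.exp t - 1)⁻¹

theorem bose_nonneg {t : ℝ} (ht : 0 < t) : 0 ≤ bose t :=
  inv_nonneg.2 (sub_nonneg.2 (Real.one_le_exp ht.le))

/-- Here e^t - 1 = 2 e^{t/2} sinh(t/2) and sinh u ≥ u. The factor t pays for the pole at 0, and
exponential decay remains. -/
theorem mul_bose_le {t : ℝ} (ht : 0 < t) : t * bose t ≤ Real.exp (-(t / 2)) := by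
  have h1 : 0 < Real.exp t - 1 := sub_pos.2 (Real.one_lt_exp_iff.2 ht)
  have h2 := Real.self_le_sinh_iff.2 (show 0 ≤ t / 2 by positivity)
  rw [Real.sinh_eq] at h2
  rw [bose, ← div_eq_mul_inv, div_le_iff₀ h1]
  have h3 : Real.exp t = Real.exp (t / 2) * Real.exp (t / 2) := by rw [← Real.exp_add]; ring_nf
  have h4 : Real.exp (-(t / 2)) * Real.exp (t / 2) = 1 := by rw [← Real.exp_add]; simp
  have h5 : Real.exp (-(t / 2)) * (Real.exp t - 1) = Real.exp (t / 2) - Real.exp (-(t / 2)) := by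
    rw [h3]; linear_combination Real.exp (t / 2) * h4
  rw [h5]; linarith

/-- The dominating weight of the regularised integrals. -/
noncomputable def regWeight (n : ℕ) (t : ℝ) : ℝ :=
  2 * (1 + t) ^ n * Real.exp (-(t / 2)) + (1 + t) ^ (-2 : ℝ)

theorem integrableOn_one_add_pow_mul_exp (n : ℕ) {a : ℝ} (ha : 0 < a) :
    IntegrableOn (fun t : ℝ => (1 + t) ^ n * Real.exp (-(a * t))) (Ioi 0) := by
  have h1 := (integrableOn_exp_mul_Ioi (show -(a / 2) < 0 by linarith) 0).const_mul
    ((2 / a) ^ n * n.factorial * Real.exp (a / 2))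
  refine h1.mono' (by fun_prop) (ae_restrict_of_forall_mem measurableSet_Ioi fun t ht => ?_)
  have ht0 : 0 < t := ht
  rw [Real.norm_of_nonneg (by positivity)]
  have h2 := Real.pow_div_factorial_le_exp (a / 2 * (1 + t)) (by positivity) n
  rw [div_le_iff₀ (by positivity), mul_pow] at h2
  have h3 : (1 + t) ^ n ≤ (2 / a) ^ n * n.factorial * Real.exp (a / 2 * (1 + t)) := by
    have h4 : (2 / a) ^ n * (a / 2) ^ n = 1 := by
      rw [← mul_pow]; field_simp; simp
    calc (1 + t) ^ n = (2 / a) ^ n * ((a / 2) ^ n * (1 + t) ^ n) := by rw [← mul_assoc, h4, one_mul]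
      _ ≤ (2 / a) ^ n * (Real.exp (a / 2 * (1 + t)) * n.factorial) := by gcongr
      _ = _ := by ring
  calc (1 + t) ^ n * Real.exp (-(a * t))
      ≤ ((2 / a) ^ n * n.factorial * Real.exp (a / 2 * (1 + t))) * Real.exp (-(a * t)) := by gcongr
    _ = _ := by
      rw [mul_assoc, mul_assoc ((2 / a) ^ n * (n.factorial : ℝ)), ← Real.exp_add, ← Real.exp_add]
      ring_nf

theorem integrableOn_one_add_rpow_neg_two :
    IntegrableOn (fun t : ℝ => (1 + t) ^ (-2 : ℝ)) (Ioi 0) := by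
  have h : Integrable (fun x : ℝ => (1 + ‖x‖) ^ (-(2 : ℝ))) := integrable_one_add_norm (by simp)
  refine h.integrableOn.congr_fun (fun t ht => ?_) measurableSet_Ioi
  have ht0 : (0 : ℝ) < t := ht
  simp [abs_of_pos ht0]

theorem integrableOn_regWeight (n : ℕ) : IntegrableOn (regWeight n) (Ioi 0) := by
  refine IntegrableOn.congr_fun (((integrableOn_one_add_pow_mul_exp n
    (show (0 : ℝ) < 1 / 2 by norm_num)).const_mul 2).add integrableOn_one_add_rpow_neg_two)
    (fun t _ => ?_) measurableSet_Ioi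
  simp only [regWeight, Pi.add_apply]
  ring_nf

/-- Bounds on a function and its derivative under which its principal value pairing with
`1 / (e^{-t} - 1)` converges. -/
structure RegBound (n : ℕ) (B : ℝ) (G G' : ℝ → ℂ) : Prop where
  hasDerivAt : ∀ t, HasDerivAt G (G' t) t
  nonneg : 0 ≤ B
  norm_le : ∀ t, ‖G t‖ ≤ B * (1 + |t|) ^ n
  norm_deriv_le : ∀ t, ‖G' t‖ ≤ B * (1 + |t|) ^ n
  norm_le_of_nonneg : ∀ t, 0 ≤ t → ‖G t‖ ≤ B / (1 + t) ^ 2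

/-- The regularised value of `PV ∫ G(t) / (e^{-t} - 1) dt`. -/
noncomputable def regPairing (G : ℝ → ℂ) : ℂ :=
  ∫ t in Ioi (0 : ℝ), ((G (-t) - G t) * bose t - G t)

namespace RegBound
variable {n : ℕ} {B : ℝ} {G G' : ℝ → ℂ}

theorem continuous (h : RegBound n B G G') : Continuous G :=
  continuous_iff_continuousAt.2 fun t => (h.hasDerivAt t).continuousAt

theorem norm_neg_sub_le (h : RegBound n B G G') {t : ℝ} (ht : 0 < t) :
    ‖G (-t) - G t‖ ≤ B * (1 + t) ^ n * (2 * t) := by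
  have := (convex_Icc (-t) t).norm_image_sub_le_of_norm_hasDerivWithin_le
    (f := G) (f' := G') (C := B * (1 + t) ^ n) (x := t) (y := -t)
    (fun x _ => (h.hasDerivAt x).hasDerivWithinAt) (fun x hx => ?_)
    ⟨by linarith, le_rfl⟩ ⟨le_rfl, by linarith⟩
  · refine this.trans_eq ?_
    rw [Real.norm_eq_abs, show -t - t = -(2 * t) by ring, abs_neg, abs_of_pos (by linarith)]
  · refine (h.norm_deriv_le x).trans ?_
    have := h.nonneg
    have := abs_le.2 hx
    gcongr

/-- The difference G(-t) - G(t) is O(t) by the mean value inequality, which cancels the pole of the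
Bose function; the other term uses the decay of G on t ≥ 0. The factors β and χ are left free so
that the same bound dominates every approximating kernel. -/
theorem norm_integrand_le (h : RegBound n B G G') {t : ℝ} (ht : 0 < t) {β χ : ℂ}
    (hβ : ‖β‖ ≤ bose t) (hχ : ‖χ‖ ≤ 1) :
    ‖(G (-t) - G t) * β - G t * χ‖ ≤ B * regWeight n t := by
  have hB := h.nonneg
  have h1 : ‖(G (-t) - G t) * β‖ ≤ B * (2 * (1 + t) ^ n * Real.exp (-(t / 2))) := by
    rw [norm_mul]
    calc _ ≤ B * (1 + t) ^ n * (2 * t) * bose t := by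
          gcongr; exact h.norm_neg_sub_le ht
      _ = B * (2 * (1 + t) ^ n * (t * bose t)) := by ring
      _ ≤ _ := by gcongr; exact mul_bose_le ht
  have h2 : ‖G t * χ‖ ≤ B * (1 + t) ^ (-2 : ℝ) := by
    rw [norm_mul]
    calc _ ≤ B / (1 + t) ^ 2 * 1 := by gcongr; exact h.norm_le_of_nonneg t ht.le
      _ = _ := by
        rw [mul_one, Real.rpow_neg (by positivity), div_eq_mul_inv]; norm_cast
  refine (norm_sub_le _ _).trans ?_
  rw [regWeight, mul_add]
  exact add_le_add h1 h2

theorem norm_regPairing_le (h : RegBound n B G G') :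
    ‖regPairing G‖ ≤ B * ∫ t in Ioi 0, regWeight n t := by
  rw [← integral_const_mul]
  refine norm_integral_le_of_norm_le ((integrableOn_regWeight n).const_mul B)
    (ae_restrict_of_forall_mem measurableSet_Ioi fun t ht => ?_)
  simpa using h.norm_integrand_le ht (β := bose t) (χ := 1)
    (by rw [Complex.norm_real, Real.norm_of_nonneg (bose_nonneg ht)]) (by simp)

theorem measurable_bose : Measurable bose := by
  unfold bose; fun_prop

theorem aestronglyMeasurable_integrand (h : RegBound n B G G') :
    AEStronglyMeasurable (fun t : ℝ => (G (-t) - G t) * bose t - G t)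
      (volume.restrict (Ioi 0)) := by
  have := h.continuous
  have := measurable_bose
  exact (by fun_prop : Measurable fun t : ℝ => (G (-t) - G t) * bose t - G t).aestronglyMeasurable

theorem integrableOn_integrand (h : RegBound n B G G') :
    IntegrableOn (fun t : ℝ => (G (-t) - G t) * bose t - G t) (Ioi 0) := by
  refine ((integrableOn_regWeight n).const_mul B).mono' h.aestronglyMeasurable_integrand
    (ae_restrict_of_forall_mem measurableSet_Ioi fun t ht => ?_)
  simpa using h.norm_integrand_le ht (β := bose t) (χ := 1)
    (by rw [Complex.norm_real, Real.norm_of_nonneg (bose_nonneg ht)]) (by simp)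

theorem integrableOn_mul_of_le_exp (h : RegBound n B G G') {β : ℝ → ℂ} {C : ℝ}
    (hβm : Measurable β) (hβ' : ∀ t > 0, ‖β t‖ ≤ C * Real.exp (-t)) {σ : ℝ} (hσ : |σ| = 1) :
    IntegrableOn (fun t : ℝ => G (σ * t) * β t) (Ioi 0) := by
  have hB := h.nonneg
  have hm : Measurable fun t : ℝ => G (σ * t) * β t :=
    (h.continuous.comp (continuous_const_mul σ)).measurable.mul hβm
  refine ((integrableOn_one_add_pow_mul_exp n one_pos).const_mul (B * C)).mono'
    hm.aestronglyMeasurable (ae_restrict_of_forall_mem measurableSet_Ioi fun t ht => ?_)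
  have ht0 : (0 : ℝ) < t := ht
  rw [norm_mul]
  calc _ ≤ B * (1 + t) ^ n * (C * Real.exp (-t)) := by
        gcongr
        · have := h.norm_le (σ * t)
          rwa [abs_mul, hσ, one_mul, abs_of_pos ht0] at this
        · exact hβ' t ht
    _ = _ := by rw [one_mul]; ring

theorem integrableOn_mul_of_le_one (h : RegBound n B G G') {χ : ℝ → ℂ}
    (hχm : Measurable χ) (hχ : ∀ t > 0, ‖χ t‖ ≤ 1) :
    IntegrableOn (fun t : ℝ => G t * χ t) (Ioi 0) := by
  have hB := h.nonneg
  have hm : Measurable fun t : ℝ => G t * χ t := h.continuous.measurable.mul hχm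
  refine (integrableOn_one_add_rpow_neg_two.const_mul B).mono'
    hm.aestronglyMeasurable (ae_restrict_of_forall_mem measurableSet_Ioi fun t ht => ?_)
  have ht0 : (0 : ℝ) < t := ht
  rw [norm_mul]
  calc _ ≤ B / (1 + t) ^ 2 * 1 := by
        gcongr
        · exact h.norm_le_of_nonneg t ht0.le
        · exact hχ t ht
    _ = _ := by
      rw [mul_one, Real.rpow_neg (by positivity), div_eq_mul_inv]; norm_cast

/-- The exact kernel takes the values `bose` t at -t and -`bose` t - 1 at t > 0; approximations of
the shape β, -β - χ fold in the same way. The bound C e^{-t} makes each half-line converge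
separately, so that the integral may be split. It may degenerate along a family of kernels, since
only the recombined integrand has to be dominated uniformly. -/
theorem integral_mul_kernel (h : RegBound n B G G') {κ β χ : ℝ → ℂ} {C : ℝ}
    (hβm : Measurable β) (hχm : Measurable χ)
    (hneg : ∀ t > 0, κ (-t) = β t) (hpos : ∀ t > 0, κ t = -β t - χ t)
    (hβ' : ∀ t > 0, ‖β t‖ ≤ C * Real.exp (-t)) (hχ : ∀ t > 0, ‖χ t‖ ≤ 1) :
    ∫ t, G t * κ t = ∫ t in Ioi (0 : ℝ), ((G (-t) - G t) * β t - G t * χ t) := by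
  have i1 : IntegrableOn (fun t : ℝ => G (-t) * β t) (Ioi 0) := by
    simpa only [neg_one_mul] using h.integrableOn_mul_of_le_exp hβm hβ' (σ := -1) (by simp)
  have i2 : IntegrableOn (fun t : ℝ => G t * β t) (Ioi 0) := by
    simpa only [one_mul] using h.integrableOn_mul_of_le_exp hβm hβ' (σ := 1) (by simp)
  have i3 := h.integrableOn_mul_of_le_one hχm hχ
  have j1 : IntegrableOn (fun t : ℝ => G (-t) * κ (-t)) (Ioi 0) :=
    i1.congr_fun (fun t ht => by simp only [hneg t ht]) measurableSet_Ioi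
  have j2 : IntegrableOn (fun t : ℝ => G t * κ t) (Ioi 0) :=
    (i2.neg.sub i3).congr_fun (fun t ht => by
      simp only [hpos t ht, Pi.sub_apply, Pi.neg_apply]; ring) measurableSet_Ioi
  have j1' : IntegrableOn (fun t : ℝ => G t * κ t) (Iic 0) := by
    rw [integrableOn_Iic_iff_integrableOn_Iio]
    have j := IntegrableOn.comp_neg_Iio (c := (0 : ℝ)) (f := fun t => G (-t) * κ (-t))
      (by rwa [neg_zero])
    simpa only [neg_neg] using j
  rw [← intervalIntegral.integral_Iic_add_Ioi j1' j2]
  have := integral_comp_neg_Ioi (0 : ℝ) (fun t => G t * κ t)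
  rw [neg_zero] at this
  rw [← this, ← integral_add j1 j2]
  refine setIntegral_congr_fun measurableSet_Ioi fun t ht => ?_
  simp only [hneg t ht, hpos t ht]
  ring

/-- Pairing with a family of kernels that approximates `1 / (e^{-t} - 1)` symmetrically
converges to the regularised pairing. -/
theorem tendsto_integral_mul_kernel (h : RegBound n B G G') {κ β χ : ℝ → ℝ → ℂ} {C : ℝ → ℝ}
    (hβm : ∀ ε, Measurable (β ε)) (hχm : ∀ ε, Measurable (χ ε))
    (hneg : ∀ ε ∈ Ioo (0 : ℝ) 1, ∀ t > 0, κ ε (-t) = β ε t)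
    (hpos : ∀ ε ∈ Ioo (0 : ℝ) 1, ∀ t > 0, κ ε t = -β ε t - χ ε t)
    (hβ : ∀ ε ∈ Ioo (0 : ℝ) 1, ∀ t > 0, ‖β ε t‖ ≤ bose t)
    (hβ' : ∀ ε ∈ Ioo (0 : ℝ) 1, ∀ t > 0, ‖β ε t‖ ≤ C ε * Real.exp (-t))
    (hχ : ∀ ε ∈ Ioo (0 : ℝ) 1, ∀ t > 0, ‖χ ε t‖ ≤ 1)
    (hβlim : ∀ t > 0, Tendsto (fun ε => β ε t) (𝓝[>] 0) (𝓝 (bose t : ℂ)))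
    (hχlim : ∀ t > 0, Tendsto (fun ε => χ ε t) (𝓝[>] 0) (𝓝 1)) :
    Tendsto (fun ε => ∫ t, G t * κ ε t) (𝓝[>] 0) (𝓝 (regPairing G)) := by
  have hGm := h.continuous.measurable
  have hmem : ∀ᶠ ε : ℝ in 𝓝[>] 0, ε ∈ Ioo (0 : ℝ) 1 := Ioo_mem_nhdsGT one_pos
  refine Tendsto.congr' (hmem.mono fun ε hε => (h.integral_mul_kernel (hβm ε) (hχm ε)
    (hneg ε hε) (hpos ε hε) (hβ' ε hε) (hχ ε hε)).symm) ?_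
  refine tendsto_integral_filter_of_dominated_convergence (fun t => B * regWeight n t) ?_ ?_
    ((integrableOn_regWeight n).const_mul B) ?_
  · refine Eventually.of_forall fun ε => Measurable.aestronglyMeasurable ?_
    exact (((hGm.comp measurable_neg).sub hGm).mul (hβm ε)).sub (hGm.mul (hχm ε))
  · filter_upwards [hmem] with ε hε
    exact ae_restrict_of_forall_mem measurableSet_Ioi fun t ht =>
      h.norm_integrand_le ht (hβ ε hε t ht) (hχ ε hε t ht)
  · refine ae_restrict_of_forall_mem measurableSet_Ioi fun t ht => ?_
    have h1 := ((hβlim t ht).const_mul (G (-t) - G t)).sub ((hχlim t ht).const_mul (G t))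
    rwa [mul_one] at h1

theorem tendsto_cutoff (h : RegBound n B G G') :
    Tendsto (fun ε : ℝ => ∫ t in {t : ℝ | ε < |t|}, G t / (Complex.exp (-(t : ℂ)) - 1))
      (𝓝[>] 0) (𝓝 (regPairing G)) := by
  have hbose : ∀ t : ℝ, 1 / (Complex.exp (t : ℂ) - 1) = (bose t : ℂ) := fun t => by
    simp [bose]
  have hne : ∀ t : ℝ, 0 < t → Real.exp t - 1 ≠ 0 := fun t ht =>
    (sub_pos.2 (Real.one_lt_exp_iff.2 ht)).ne'
  have hbose' : ∀ t : ℝ, 0 < t → 1 / (Complex.exp (-(t : ℂ)) - 1) = -(bose t : ℂ) - 1 := by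
    intro t ht
    have h1 := hne t ht
    have : 1 / (Real.exp (-t) - 1) = -bose t - 1 := by
      have h2 := Real.exp_pos t
      have h3 : 1 - Real.exp t ≠ 0 := by intro h; apply h1; linarith
      rw [bose, Real.exp_neg]
      field_simp
      ring
    exact_mod_cast congrArg (fun x : ℝ => (x : ℂ)) this
  have key := h.tendsto_integral_mul_kernel
    (κ := fun ε t => {t : ℝ | ε < |t|}.indicator (fun t => 1 / (Complex.exp (-(t : ℂ)) - 1)) t)
    (β := fun ε t => (Ioi ε).indicator (fun t => (bose t : ℂ)) t)
    (χ := fun ε t => (Ioi ε).indicator (fun _ => (1 : ℂ)) t)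
    -- For t > ε one has e^t - 1 = e^t (1 - e^{-t}) ≥ e^t (1 - e^{-ε}).
    (C := fun ε => (1 - Real.exp (-ε))⁻¹) ?_ ?_ ?_ ?_ ?_ ?_ ?_ ?_ ?_
  · refine key.congr fun ε => ?_
    rw [← integral_indicator (measurableSet_lt measurable_const continuous_abs.measurable)]
    refine integral_congr_ae (Eventually.of_forall fun t => ?_)
    by_cases ht : ε < |t|
    · simp [indicator, ht, div_eq_mul_inv]
    · simp [indicator, ht]
  · intro ε
    have := measurable_bose
    exact Measurable.indicator (by fun_prop) measurableSet_Ioi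
  · intro ε
    exact measurable_const.indicator measurableSet_Ioi
  · intro ε hε t ht
    simp only [indicator, mem_ofPred_eq, abs_neg, abs_of_pos ht, mem_Ioi]
    simp only [Complex.ofReal_neg, neg_neg, hbose]
  · intro ε hε t ht
    simp only [indicator, mem_ofPred_eq, abs_of_pos ht, mem_Ioi]
    split_ifs
    · exact hbose' t ht
    · simp
  · intro ε hε t ht
    refine (norm_indicator_le_norm_self _ _).trans ?_
    rw [Complex.norm_real, Real.norm_of_nonneg (bose_nonneg ht)]
  · intro ε hε t ht
    have h1 : Real.exp (-ε) < 1 := Real.exp_lt_one_iff.2 (by linarith [hε.1])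
    have h1' : 0 < 1 - Real.exp (-ε) := by linarith
    simp only [indicator, mem_Ioi]
    split_ifs with h2
    · rw [Complex.norm_real, Real.norm_of_nonneg (bose_nonneg ht), bose, Real.exp_neg t, ← mul_inv]
      refine inv_anti₀ (by positivity) ?_
      have : Real.exp (-t) * Real.exp t = 1 := by rw [← Real.exp_add]; simp
      have h4 : Real.exp (-t) < Real.exp (-ε) := Real.exp_lt_exp.2 (by linarith)
      nlinarith [Real.exp_pos t]
    · rw [norm_zero]; positivity
  · intro ε hε t ht
    refine (norm_indicator_le_norm_self _ _).trans (by simp)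
  · intro t ht
    refine tendsto_const_nhds.congr' ?_
    filter_upwards [Ioo_mem_nhdsGT ht] with ε hε
    simp [indicator, hε.2]
  · intro t ht
    refine tendsto_const_nhds.congr' ?_
    filter_upwards [Ioo_mem_nhdsGT ht] with ε hε
    simp [indicator, hε.2]

end RegBound

/-! ### Convolution with γ₊^s and the family li_s -/

/-- The convolution `t ↦ ⟨γ₊^s, φ(· + t)⟩` for `Re s > 0`. -/
noncomputable def gammaConv (s : ℂ) (φ : ℝ → ℂ) (t : ℝ) : ℂ :=
  (Complex.Gamma s)⁻¹ * halfMellin s φ t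

noncomputable abbrev schwartzDeriv : 𝓢(ℝ, ℂ) →L[ℂ] 𝓢(ℝ, ℂ) := SchwartzMap.derivCLM ℂ ℂ

theorem hasDerivAt_schwartz (f : 𝓢(ℝ, ℂ)) (x : ℝ) : HasDerivAt f (schwartzDeriv f x) x :=
  SchwartzMap.hasDerivAt f x

theorem iterate_schwartzDeriv (k : ℕ) (f : 𝓢(ℝ, ℂ)) :
    ⇑(schwartzDeriv^[k] f) = iteratedDeriv k f := by
  induction k with
  | zero => simp
  | succ k ih =>
    rw [Function.iterate_succ_apply', iteratedDeriv_succ, ← ih]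
    rfl

/-- The constant is kept explicit because it plays two roles: it is a Schwartz seminorm of f, which
gives continuity in f, times a factor locally bounded in s, which gives domination in s. -/
theorem regBound_gammaConv {c d : ℝ} {N : ℕ} {s : ℂ} (hc : 0 < c) (hcs : c ≤ s.re)
    (hsd : s.re ≤ d) (hdN : d < N) (f : 𝓢(ℝ, ℂ)) :
    RegBound (N + 2) (‖(Complex.Gamma s)⁻¹‖ *
      (decayNorm (N + 2) f * ∫ y in Ioi 0, mellinWeight c d N y))
      (gammaConv s f) (gammaConv s (schwartzDeriv f)) where
  hasDerivAt t := (hasDerivAt_halfMellin (hc.trans_le hcs) (hsd.trans_lt hdN)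
    (decayNorm_nonneg _ f) (hasDerivAt_schwartz f) (schwartzDeriv f).continuous
    (norm_le_decayNorm_div le_rfl f) (norm_deriv_le_decayNorm_div le_rfl f) t).const_mul _
  nonneg := by
    have : 0 ≤ ∫ y in Ioi 0, mellinWeight c d N y :=
      setIntegral_nonneg measurableSet_Ioi fun y hy => by
        have hy0 : (0 : ℝ) < y := hy
        unfold mellinWeight; positivity
    have := decayNorm_nonneg (N + 2) f
    positivity
  norm_le t := by
    rw [gammaConv, norm_mul, mul_assoc]
    gcongr
    exact norm_halfMellin_le hc hcs hsd hdN (decayNorm_nonneg _ f)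
      (norm_le_decayNorm_div le_rfl f) t
  norm_deriv_le t := by
    rw [gammaConv, norm_mul, mul_assoc]
    gcongr
    exact norm_halfMellin_le hc hcs hsd hdN (decayNorm_nonneg _ f)
      (norm_deriv_le_decayNorm_div le_rfl f) t
  norm_le_of_nonneg t ht := by
    rw [gammaConv, norm_mul, mul_div_assoc]
    gcongr
    exact norm_halfMellin_le_of_nonneg hc hcs hsd hdN (decayNorm_nonneg _ f)
      (norm_le_decayNorm_div le_rfl f) ht

theorem exists_regBound_gammaConv {s : ℂ} (hs : 0 < s.re) (f : 𝓢(ℝ, ℂ)) :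
    ∃ n B, RegBound n B (gammaConv s f) (gammaConv s (schwartzDeriv f)) := by
  obtain ⟨N, hN⟩ := exists_nat_gt s.re
  exact ⟨_, _, regBound_gammaConv hs le_rfl le_rfl hN f⟩

theorem integrableOn_mellin_schwartz {s : ℂ} (hs : 0 < s.re) (f : 𝓢(ℝ, ℂ)) (t : ℝ) :
    IntegrableOn (fun y : ℝ => (y : ℂ) ^ (s - 1) * f (y + t)) (Ioi 0) := by
  obtain ⟨N, hN⟩ := exists_nat_gt s.re
  exact integrableOn_mellin_integrand hs hN (decayNorm_nonneg (N + 2) f) f.continuous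
    (norm_le_decayNorm_div le_rfl f) t

theorem gammaConv_add {s : ℂ} (hs : 0 < s.re) (f g : 𝓢(ℝ, ℂ)) (t : ℝ) :
    gammaConv s ⇑(f + g) t = gammaConv s f t + gammaConv s g t := by
  rw [gammaConv, gammaConv, gammaConv, halfMellin, halfMellin, halfMellin, ← mul_add,
    ← integral_add (integrableOn_mellin_schwartz hs f t) (integrableOn_mellin_schwartz hs g t)]
  simp [mul_add]

theorem gammaConv_smul (s c : ℂ) (f : 𝓢(ℝ, ℂ)) (t : ℝ) :
    gammaConv s ⇑(c • f) t = c * gammaConv s f t := by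
  rw [gammaConv, gammaConv, halfMellin, halfMellin, mul_left_comm, ← integral_const_mul c]
  simp [mul_left_comm]

theorem differentiableOn_gammaConv (f : 𝓢(ℝ, ℂ)) (t : ℝ) :
    DifferentiableOn ℂ (fun s => gammaConv s f t) {s | 0 < s.re} := by
  intro s hs
  obtain ⟨N, hN⟩ := exists_nat_gt s.re
  have h := differentiableOn_halfMellin (N := N) (decayNorm_nonneg (N + 2) f) f.continuous
    (norm_le_decayNorm_div le_rfl f) t
  have hU : IsOpen {s : ℂ | 0 < s.re ∧ s.re < N} :=
    (isOpen_lt continuous_const Complex.continuous_re).inter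
      (isOpen_lt Complex.continuous_re continuous_const)
  have h1 := h.differentiableAt (hU.mem_nhds ⟨hs, hN⟩)
  exact (Complex.differentiable_one_div_Gamma.differentiableAt.mul h1).differentiableWithinAt

/-- The distribution `γ₊^s * PV 1 / (e^{-x} - 1)` for `Re s > 0`. -/
noncomputable def liPos (s : ℂ) (f : 𝓢(ℝ, ℂ)) : ℂ := regPairing (gammaConv s f)

theorem exists_temperedDistribution_liPos {s : ℂ} (hs : 0 < s.re) :
    ∃ T : 𝓢'(ℝ, ℂ), ∀ f, T f = liPos s f := by
  obtain ⟨N, hN⟩ := exists_nat_gt s.re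
  have hR := regBound_gammaConv (N := N) hs le_rfl le_rfl hN
  have hW : 0 ≤ ∫ t in Ioi 0, regWeight (N + 2) t :=
    setIntegral_nonneg measurableSet_Ioi fun y hy => by
      have hy0 : (0 : ℝ) < y := hy
      unfold regWeight; positivity
  have hM : 0 ≤ ∫ y in Ioi 0, mellinWeight s.re s.re N y :=
    setIntegral_nonneg measurableSet_Ioi fun y hy => by
      have hy0 : (0 : ℝ) < y := hy
      unfold mellinWeight; positivity
  refine exists_temperedDistribution _ (fun f g => ?_) (fun c f => ?_) (N + 2)
    (‖(Complex.Gamma s)⁻¹‖ * (∫ y in Ioi 0, mellinWeight s.re s.re N y) *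
      ∫ t in Ioi 0, regWeight (N + 2) t) (by positivity) fun f => ?_
  · rw [liPos, liPos, liPos, regPairing, regPairing, regPairing,
      ← integral_add (hR f).integrableOn_integrand (hR g).integrableOn_integrand]
    refine integral_congr_ae (Eventually.of_forall fun t => ?_)
    simp only [gammaConv_add hs]
    ring
  · rw [liPos, liPos, regPairing, regPairing, ← integral_const_mul]
    refine integral_congr_ae (Eventually.of_forall fun t => ?_)
    simp only [gammaConv_smul]
    ring
  · refine (hR f).norm_regPairing_le.trans_eq ?_
    ring

theorem differentiableOn_liPos (f : 𝓢(ℝ, ℂ)) :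
    DifferentiableOn ℂ (fun s => liPos s f) {s | 0 < s.re} := by
  have hopen : IsOpen {s : ℂ | 0 < s.re} := isOpen_lt continuous_const Complex.continuous_re
  refine differentiableOn_integral_of_dominated hopen (fun s hs => ?_)
    (Eventually.of_forall fun t => ?_) fun s₀ hs₀ => ?_
  · obtain ⟨n, B, h⟩ := exists_regBound_gammaConv hs f
    exact h.aestronglyMeasurable_integrand
  · exact (((differentiableOn_gammaConv f _).sub (differentiableOn_gammaConv f _)).mul_const _).sub
      (differentiableOn_gammaConv f _)
  · obtain ⟨c, hc0, hc⟩ := exists_between (show 0 < s₀.re from hs₀)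
    obtain ⟨d, hd⟩ := exists_gt s₀.re
    obtain ⟨N, hN⟩ := exists_nat_gt d
    have hcont : ContinuousAt (fun s => ‖(Complex.Gamma s)⁻¹‖) s₀ :=
      Complex.differentiable_one_div_Gamma.continuous.norm.continuousAt
    have hV : {s : ℂ | c < s.re ∧ s.re < d} ∈ 𝓝 s₀ :=
      ((isOpen_lt continuous_const Complex.continuous_re).inter
        (isOpen_lt Complex.continuous_re continuous_const)).mem_nhds ⟨hc, hd⟩
    have hV2 := hcont.eventually_lt_const (lt_add_one ‖(Complex.Gamma s₀)⁻¹‖)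
    have hM : 0 ≤ ∫ y in Ioi 0, mellinWeight c d N y :=
      setIntegral_nonneg measurableSet_Ioi fun y hy => by
        have hy0 : (0 : ℝ) < y := hy
        unfold mellinWeight; positivity
    have hD := decayNorm_nonneg (N + 2) f
    refine ⟨_, Filter.inter_mem hV hV2, fun t => ((‖(Complex.Gamma s₀)⁻¹‖ + 1) *
      (decayNorm (N + 2) f * ∫ y in Ioi 0, mellinWeight c d N y)) * regWeight (N + 2) t,
      (integrableOn_regWeight _).const_mul _,
      ae_restrict_of_forall_mem measurableSet_Ioi fun t ht s hs => ?_⟩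
    have hR := regBound_gammaConv (N := N) hc0 hs.1.1.le hs.1.2.le hN f
    have h1 := hR.norm_integrand_le ht (β := bose t) (χ := 1)
      (by rw [Complex.norm_real, Real.norm_of_nonneg (bose_nonneg ht)]) (by simp)
    rw [mul_one] at h1
    refine h1.trans ?_
    have ht0 : (0 : ℝ) < t := ht
    have hW : 0 ≤ regWeight (N + 2) t := by unfold regWeight; positivity
    have h2 : ‖(Complex.Gamma s)⁻¹‖ ≤ ‖(Complex.Gamma s₀)⁻¹‖ + 1 := le_of_lt hs.2
    exact mul_le_mul_of_nonneg_right (mul_le_mul_of_nonneg_right h2 (by positivity)) hW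

/-- Integration by parts: y^{s-1}/Γ(s) is the derivative of y^s/Γ(s+1). The boundary term at 0
vanishes because Re s > 0, the one at ∞ because the product and its derivative are integrable. -/
theorem gammaConv_eq_neg_gammaConv_add_one {s : ℂ} (hs : 0 < s.re) (f : 𝓢(ℝ, ℂ)) (t : ℝ) :
    gammaConv s f t = -gammaConv (s + 1) (schwartzDeriv f) t := by
  have hs0 : s ≠ 0 := by rintro rfl; simp at hs
  have hs1 : 0 < (s + 1).re := by simp; linarith
  have i1 := integrableOn_mellin_schwartz hs f t
  have i2 := integrableOn_mellin_schwartz hs1 (schwartzDeriv f) t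
  have i3 := integrableOn_mellin_schwartz hs1 f t
  simp only [add_sub_cancel_right] at i2 i3
  have hu : ∀ y ∈ Ioi (0 : ℝ), HasDerivAt (fun y : ℝ => (y : ℂ) ^ s) (s * (y : ℂ) ^ (s - 1)) y := by
    intro y hy
    have h := (hasDerivAt_id (y : ℂ)).cpow_const (c := s)
      (Complex.ofReal_mem_slitPlane.2 hy)
    simpa using h.comp_ofReal
  have hv : ∀ y ∈ Ioi (0 : ℝ), HasDerivAt (fun y : ℝ => f (y + t)) (schwartzDeriv f (y + t)) y :=
    fun y _ => (hasDerivAt_schwartz f (y + t)).comp_add_const y t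
  have huv : IntegrableOn (fun y : ℝ =>
      s * (y : ℂ) ^ (s - 1) * f (y + t) + (y : ℂ) ^ s * schwartzDeriv f (y + t)) (Ioi 0) := by
    refine IntegrableOn.congr_fun ((i1.const_mul s).add i2) (fun y _ => ?_) measurableSet_Ioi
    simp only [Pi.add_apply]; ring
  have h0 : Tendsto (fun y : ℝ => (y : ℂ) ^ s * f (y + t)) (𝓝[>] 0) (𝓝 0) := by
    have hc : Continuous fun y : ℝ => (y : ℂ) ^ s * f (y + t) :=
      (Complex.continuous_ofReal_cpow_const hs).mul (f.continuous.comp (continuous_add_const t))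
    have := (hc.tendsto 0).mono_left (nhdsWithin_le_nhds (s := Ioi 0))
    simpa [hs0] using this
  have h1 : Tendsto (fun y : ℝ => (y : ℂ) ^ s * f (y + t)) atTop (𝓝 0) :=
    tendsto_zero_of_hasDerivAt_of_integrableOn_Ioi (fun y hy => (hu y hy).mul (hv y hy)) huv i3
  have key := integral_Ioi_deriv_mul_eq_sub hu hv huv h0 h1
  have i1' : IntegrableOn (fun y : ℝ => s * (y : ℂ) ^ (s - 1) * f (y + t)) (Ioi 0) := by
    simp only [mul_assoc]
    exact i1.const_mul s
  rw [integral_add i1' i2] at key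
  simp only [mul_assoc] at key
  rw [integral_const_mul, sub_zero] at key
  have hΓ : Complex.Gamma (s + 1) ≠ 0 := Complex.Gamma_ne_zero_of_re_pos hs1
  rw [gammaConv, gammaConv, Complex.Gamma_add_one s hs0] at *
  simp only [halfMellin, add_sub_cancel_right]
  have hΓ' : Complex.Gamma s ≠ 0 := fun h => hΓ (by rw [h, mul_zero])
  field_simp
  linear_combination key

theorem liPos_eq_neg_liPos_add_one {s : ℂ} (hs : 0 < s.re) (f : 𝓢(ℝ, ℂ)) :
    liPos s f = -liPos (s + 1) (schwartzDeriv f) := by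
  rw [liPos, liPos, regPairing, regPairing, ← integral_neg]
  refine integral_congr_ae (Eventually.of_forall fun t => ?_)
  simp only [gammaConv_eq_neg_gammaConv_add_one hs]
  ring

theorem liPos_eq_iterate {s : ℂ} (hs : 0 < s.re) (f : 𝓢(ℝ, ℂ)) (k : ℕ) :
    liPos s f = (-1) ^ k * liPos (s + k) (schwartzDeriv^[k] f) := by
  induction k with
  | zero => simp
  | succ k ih =>
    have h : 0 < (s + k).re := by simp; positivity
    rw [ih, liPos_eq_neg_liPos_add_one h, Function.iterate_succ_apply', pow_succ]
    push_cast
    rw [add_assoc]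
    ring

/-- The pairing of `li_s` with a Schwartz function, for all `s`. -/
noncomputable def liFun (s : ℂ) (f : 𝓢(ℝ, ℂ)) : ℂ :=
  (-1) ^ ⌊1 - s.re⌋₊ * liPos (s + ⌊1 - s.re⌋₊) (schwartzDeriv^[⌊1 - s.re⌋₊] f)

theorem re_add_floor_pos (s : ℂ) : 0 < (s + (⌊1 - s.re⌋₊ : ℕ)).re := by
  have := Nat.lt_floor_add_one (1 - s.re)
  simp only [Complex.add_re, Complex.natCast_re]
  linarith

/-- The floor in `liFun` is the least admissible number of derivatives, and it jumps with Re s.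
Independence of that number allows a k that is constant near a given point, which makes holomorphy
in s a local matter. -/
theorem liFun_eq {s : ℂ} {k : ℕ} (h : 0 < s.re + k) (f : 𝓢(ℝ, ℂ)) :
    liFun s f = (-1) ^ k * liPos (s + k) (schwartzDeriv^[k] f) := by
  have hle : ⌊1 - s.re⌋₊ ≤ k := by
    rw [← Nat.lt_add_one_iff]
    rcases le_or_gt 0 (1 - s.re) with h0 | h0
    · rw [Nat.floor_lt h0]; push_cast; linarith
    · rw [Nat.floor_of_nonpos h0.le]; omega
  obtain ⟨j, rfl⟩ := Nat.exists_eq_add_of_le hle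
  rw [liFun, liPos_eq_iterate (re_add_floor_pos s) _ j, ← Function.iterate_add_apply, add_comm j,
    ← mul_assoc, ← pow_add, add_assoc]
  push_cast
  rfl

theorem differentiable_liFun (f : 𝓢(ℝ, ℂ)) : Differentiable ℂ (fun s => liFun s f) := by
  intro s₀
  obtain ⟨k, hk⟩ := exists_nat_gt (-s₀.re)
  have hU : IsOpen {s : ℂ | 0 < s.re + k} :=
    isOpen_lt continuous_const (Complex.continuous_re.add continuous_const)
  have hs₀ : {s : ℂ | 0 < s.re + k} ∈ 𝓝 s₀ :=
    hU.mem_nhds (show 0 < s₀.re + k by linarith)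
  have heq : (fun s => liFun s f) =ᶠ[𝓝 s₀]
      fun s => (-1) ^ k * liPos (s + k) (schwartzDeriv^[k] f) := by
    filter_upwards [hs₀] with s hs using liFun_eq hs f
  refine DifferentiableAt.congr_of_eventuallyEq ?_ heq
  refine DifferentiableAt.const_mul ?_ _
  have hopen : IsOpen {s : ℂ | 0 < s.re} := isOpen_lt continuous_const Complex.continuous_re
  have h2 := (differentiableOn_liPos (schwartzDeriv^[k] f)).differentiableAt
    (hopen.mem_nhds (show 0 < (s₀ + k).re by simp; linarith))
  exact DifferentiableAt.comp (g := fun s => liPos s (schwartzDeriv^[k] f)) s₀ h2 (by fun_prop)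

theorem exists_temperedDistribution_liFun (s : ℂ) :
    ∃ T : 𝓢'(ℝ, ℂ), ∀ f, T f = liFun s f := by
  obtain ⟨T, hT⟩ := exists_temperedDistribution_liPos (re_add_floor_pos s)
  have h : ∀ k : ℕ, ∃ T' : 𝓢'(ℝ, ℂ), ∀ f, T' f = (-1) ^ k * T (schwartzDeriv^[k] f) := by
    intro k
    induction k with
    | zero => exact ⟨T, fun f => by simp⟩
    | succ k ih =>
      obtain ⟨T', hT'⟩ := ih
      refine ⟨TemperedDistribution.derivCLM ℂ T', fun f => ?_⟩
      rw [TemperedDistribution.derivCLM_apply_apply, map_neg, hT', Function.iterate_succ_apply,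
        pow_succ]
      ring
  obtain ⟨T', hT'⟩ := h ⌊1 - s.re⌋₊
  exact ⟨T', fun f => by rw [hT', hT, liFun]⟩

theorem gammaPlus_translate (s : ℂ) (f : 𝓢(ℝ, ℂ)) (t : ℝ) :
    gammaPlus s (fun x => f (x + t)) =
      (-1) ^ ⌊1 - s.re⌋₊ * gammaConv (s + ⌊1 - s.re⌋₊) (schwartzDeriv^[⌊1 - s.re⌋₊] f) t := by
  simp only [gammaPlus, gammaConv, halfMellin, iterate_schwartzDeriv,
    iteratedDeriv_comp_add_const]
  ring

/-- Translation commutes with derivatives, so up to the sign (-1)^k the truncated integrals are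
those of `gammaConv` at s + k applied to the k-th derivative of f. -/
theorem isGammaConvLiZero_of_eq_liFun {s : ℂ} {T : 𝓢'(ℝ, ℂ)} (hT : ∀ f, T f = liFun s f) :
    IsGammaConvLiZero s T := by
  intro f
  obtain ⟨n, B, h⟩ := exists_regBound_gammaConv (re_add_floor_pos s) (schwartzDeriv^[⌊1 - s.re⌋₊] f)
  rw [hT, liFun]
  refine (h.tendsto_cutoff.const_mul _).congr fun ε => ?_
  rw [← integral_const_mul]
  simp only [gammaPlus_translate, mul_div_assoc]

/-! ### Laplace integrals and the boundary powers (x ± i0)^a -/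

theorem integrableOn_rpow_mul_exp {α ρ : ℝ} (hα : 0 < α) (hρ : 0 < ρ) :
    IntegrableOn (fun t : ℝ => t ^ (α - 1) * Real.exp (-(ρ * t))) (Ioi 0) := by
  have h := integrableOn_rpow_mul_exp_neg_mul_rpow (p := 1) (s := α - 1) (b := ρ)
    (by linarith) one_pos hρ
  simpa using h

theorem norm_cpow_mul_exp {a r : ℂ} {t : ℝ} (ht : 0 < t) :
    ‖(t : ℂ) ^ (a - 1) * Complex.exp (-(r * t))‖ = t ^ (a.re - 1) * Real.exp (-(r.re * t)) := by
  rw [norm_mul, Complex.norm_cpow_eq_rpow_re_of_pos ht, Complex.norm_exp]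
  simp

theorem aestronglyMeasurable_cpow_mul_continuous (a : ℂ) {g : ℝ → ℂ} (hg : Continuous g) :
    AEStronglyMeasurable (fun t : ℝ => (t : ℂ) ^ (a - 1) * g t) (volume.restrict (Ioi 0)) := by
  simpa using aestronglyMeasurable_cpow_mul (s := a) hg 0

theorem integrableOn_cpow_mul_exp {a r : ℂ} (ha : 0 < a.re) (hr : 0 < r.re) :
    IntegrableOn (fun t : ℝ => (t : ℂ) ^ (a - 1) * Complex.exp (-(r * t))) (Ioi 0) :=
  (integrableOn_rpow_mul_exp ha hr).mono'
    (aestronglyMeasurable_cpow_mul_continuous a (by fun_prop))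
    (ae_restrict_of_forall_mem measurableSet_Ioi fun _ ht => (norm_cpow_mul_exp ht).le)

theorem isOpen_re_pos : IsOpen {r : ℂ | 0 < r.re} := isOpen_lt continuous_const Complex.continuous_re

/-- Both sides are holomorphic in r on the right half-plane and agree for real r > 0 by Euler's
integral. -/
theorem integral_cpow_mul_exp {a r : ℂ} (ha : 0 < a.re) (hr : 0 < r.re) :
    ∫ t in Ioi (0 : ℝ), (t : ℂ) ^ (a - 1) * Complex.exp (-(r * t)) =
      r ^ (-a) * Complex.Gamma a := by
  have hL : DifferentiableOn ℂ (fun r : ℂ =>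
      ∫ t in Ioi (0 : ℝ), (t : ℂ) ^ (a - 1) * Complex.exp (-(r * t))) {r | 0 < r.re} := by
    refine differentiableOn_integral_of_dominated isOpen_re_pos
      (fun r _ => aestronglyMeasurable_cpow_mul_continuous a (by fun_prop))
      (Eventually.of_forall fun t => by fun_prop) fun r₀ (hr₀ : 0 < r₀.re) => ?_
    refine ⟨{r | r₀.re / 2 < r.re}, (isOpen_lt continuous_const Complex.continuous_re).mem_nhds
      (show r₀.re / 2 < r₀.re by linarith), _, integrableOn_rpow_mul_exp ha (half_pos hr₀),
      ae_restrict_of_forall_mem measurableSet_Ioi fun t ht r hr => ?_⟩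
    have ht0 : (0 : ℝ) < t := ht
    have hr' : r₀.re / 2 < r.re := hr
    rw [norm_cpow_mul_exp ht]
    gcongr
  have hR : DifferentiableOn ℂ (fun r : ℂ => r ^ (-a) * Complex.Gamma a) {r | 0 < r.re} := by
    intro r hr
    exact ((differentiableAt_id.cpow_const (Or.inl hr)).mul_const _).differentiableWithinAt
  refine (hL.analyticOnNhd isOpen_re_pos).eqOn_of_preconnected_of_frequently_eq
    (hR.analyticOnNhd isOpen_re_pos) (convex_halfSpace_re_gt 0).isPreconnected
    (show (1 : ℂ) ∈ _ by simp) ?_ hr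
  -- The real points 1 + 1/(n+1) accumulate at 1 without reaching it, which suffices for the
  -- identity theorem.
  have htend : Tendsto (fun n : ℕ => ((1 + 1 / ((n : ℝ) + 1) : ℝ) : ℂ)) atTop (𝓝[≠] 1) := by
    refine tendsto_nhdsWithin_iff.2 ⟨?_, Eventually.of_forall fun n => ?_⟩
    · have := (tendsto_one_div_add_atTop_nhds_zero_nat (𝕜 := ℝ)).const_add 1
      rw [add_zero] at this
      exact_mod_cast (Complex.continuous_ofReal.tendsto (1 : ℝ)).comp this
    · have : (1 + 1 / ((n : ℝ) + 1) : ℝ) ≠ 1 := by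
        have : 0 < 1 / ((n : ℝ) + 1) := by positivity
        linarith
      exact fun h => this (Complex.ofReal_eq_one.1 h)
  refine htend.frequently (Frequently.of_forall fun n => ?_)
  have hpos : 0 < 1 + 1 / ((n : ℝ) + 1) := by positivity
  rw [Complex.integral_cpow_mul_exp_neg_mul_Ioi ha hpos, one_div, Complex.cpow_neg,
    Complex.inv_cpow]
  rw [Complex.arg_ofReal_of_nonneg hpos.le]
  exact Real.pi_pos.ne

/-- The base of the constant relating `(x ± iε)^a` to a Laplace integral. -/
noncomputable def rotBase (σ : ℝ) : ℂ := Complex.I * σ / (2 * Real.pi)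

/-- The principal power is multiplicative here: the first factor is purely imaginary and the second
has positive real part, so the arguments add up to less than π in absolute value. The second factor
is the Laplace variable. -/
theorem add_mul_I_cpow {σ : ℝ} (hσ : σ = 1 ∨ σ = -1) {ε : ℝ} (hε : 0 < ε) (x : ℝ) (a : ℂ) :
    ((x : ℂ) + σ * ε * Complex.I) ^ a =
      rotBase σ ^ a * (2 * Real.pi * (ε - Complex.I * σ * x)) ^ a := by
  have hπ := Real.pi_pos
  have hσ0 : σ ≠ 0 := by rcases hσ with rfl | rfl <;> norm_num
  have hσ2 : (σ : ℂ) * σ = 1 := by rcases hσ with rfl | rfl <;> norm_num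
  have hb : rotBase σ ≠ 0 := by
    have : (Real.pi : ℂ) ≠ 0 := by exact_mod_cast hπ.ne'
    simp [rotBase, this, hσ0]
  have hre : (2 * Real.pi * (ε - Complex.I * σ * x) : ℂ).re = 2 * Real.pi * ε := by
    simp
  have hr : (2 * Real.pi * (ε - Complex.I * σ * x) : ℂ) ≠ 0 := fun h => by
    rw [h] at hre
    have : 0 < 2 * Real.pi * ε := by positivity
    simp at hre
    rcases hre with h | h
    all_goals linarith
  have heq : ((x : ℂ) + σ * ε * Complex.I) =
      rotBase σ * (2 * Real.pi * (ε - Complex.I * σ * x)) := by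
    have : (Real.pi : ℂ) ≠ 0 := by exact_mod_cast hπ.ne'
    rw [rotBase]
    field_simp
    linear_combination (-(x : ℂ)) * hσ2 + (x : ℂ) * σ * σ * Complex.I_sq
  have harg2 : |Complex.arg (2 * Real.pi * (ε - Complex.I * σ * x))| < Real.pi / 2 :=
    Complex.abs_arg_lt_pi_div_two_iff.2 (Or.inl (by rw [hre]; positivity))
  have harg1 : |Complex.arg (rotBase σ)| ≤ Real.pi / 2 :=
    Complex.abs_arg_le_pi_div_two_iff.2 (by
      have : rotBase σ = ((σ / (2 * Real.pi) : ℝ) : ℂ) * Complex.I := by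
        rw [rotBase]; push_cast; ring
      rw [this, Complex.re_ofReal_mul, Complex.I_re, mul_zero])
  have hlog := (Complex.log_mul_eq_add_log_iff hb hr).2 (by
    rw [abs_lt] at harg2; rw [abs_le] at harg1
    constructor <;> linarith [harg1.1, harg1.2, harg2.1, harg2.2])
  rw [heq, Complex.cpow_def_of_ne_zero (mul_ne_zero hb hr), hlog, Complex.cpow_def_of_ne_zero hb,
    Complex.cpow_def_of_ne_zero hr, add_mul, Complex.exp_add]

/-- The sign decides between the inverse Fourier transform and the Fourier transform; both act
continuously on Schwartz space. -/
theorem exists_exp_transform {σ : ℝ} (hσ : σ = 1 ∨ σ = -1) :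
    ∃ L : 𝓢(ℝ, ℂ) →L[ℂ] 𝓢(ℝ, ℂ), ∀ (f : 𝓢(ℝ, ℂ)) (ξ : ℝ),
      L f ξ = ∫ x : ℝ, Complex.exp (2 * Real.pi * Complex.I * σ * x * ξ) * f x := by
  rcases hσ with rfl | rfl
  · refine ⟨FourierTransform.fourierInvCLM ℂ 𝓢(ℝ, ℂ), fun f ξ => ?_⟩
    rw [FourierTransform.fourierInvCLM_apply, SchwartzMap.fourierInv_coe, Real.fourierInv_eq']
    refine integral_congr_ae (Eventually.of_forall fun x => ?_)
    simp only [smul_eq_mul, RCLike.inner_apply, conj_trivial]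
    push_cast
    ring_nf
  · refine ⟨FourierTransform.fourierCLM ℂ 𝓢(ℝ, ℂ), fun f ξ => ?_⟩
    rw [FourierTransform.fourierCLM_apply, SchwartzMap.fourier_coe,
      Real.fourier_real_eq_integral_exp_smul]
    refine integral_congr_ae (Eventually.of_forall fun x => ?_)
    simp only [smul_eq_mul]
    push_cast
    ring_nf

section
variable {σ : ℝ} {a : ℂ} {ε : ℝ} {L : 𝓢(ℝ, ℂ) →L[ℂ] 𝓢(ℝ, ℂ)}

theorem integrable_laplace_kernel (ha : a.re < 0) (hε : 0 < ε) (f : 𝓢(ℝ, ℂ)) :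
    Integrable (Function.uncurry fun (x ξ : ℝ) => (ξ : ℂ) ^ (-a - 1) *
      Complex.exp (-(2 * Real.pi * (ε - Complex.I * σ * x) * ξ)) * f x)
      (volume.prod (volume.restrict (Ioi 0))) := by
  have hπ := Real.pi_pos
  have h1 : IntegrableOn (fun ξ : ℝ => (ξ : ℂ) ^ (-a - 1) *
      Complex.exp (-((2 * Real.pi * ε : ℝ) * ξ))) (Ioi 0) :=
    integrableOn_cpow_mul_exp (by simpa using ha) (by rw [Complex.ofReal_re]; positivity)
  have h2 := (f.integrable (μ := volume)).mul_prod h1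
  have h3 : Continuous fun z : ℝ × ℝ => Complex.exp (((2 * Real.pi * σ * z.1 * z.2 : ℝ) : ℂ) *
    Complex.I) := by fun_prop
  refine (h2.bdd_mul h3.aestronglyMeasurable (c := 1) (Eventually.of_forall fun z => ?_)).congr
    (Eventually.of_forall fun z => ?_)
  · rw [Complex.norm_exp_ofReal_mul_I]
  · simp only [Function.uncurry]
    rw [show (-(2 * Real.pi * (ε - Complex.I * σ * z.1) * z.2) : ℂ) =
      ((2 * Real.pi * σ * z.1 * z.2 : ℝ) : ℂ) * Complex.I + -((2 * Real.pi * ε : ℝ) * z.2) by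
      push_cast; ring, Complex.exp_add]
    ring

/-- This is the Laplace representation of (x + iσε)^a with density ξ^{-a-1}, integrable at 0 exactly
because Re a < 0. The variable x enters through a character only. -/
theorem inner_laplace_integral (hσ : σ = 1 ∨ σ = -1) (ha : a.re < 0) (hε : 0 < ε) (f : 𝓢(ℝ, ℂ))
    (x : ℝ) : ∫ ξ in Ioi (0 : ℝ), (ξ : ℂ) ^ (-a - 1) *
      Complex.exp (-(2 * Real.pi * (ε - Complex.I * σ * x) * ξ)) * f x =
      (rotBase σ ^ a)⁻¹ * Complex.Gamma (-a) * (((x : ℂ) + σ * ε * Complex.I) ^ a * f x) := by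
  have hπ := Real.pi_pos
  have hb : rotBase σ ≠ 0 := by
    have : (Real.pi : ℂ) ≠ 0 := by exact_mod_cast hπ.ne'
    have hσ0 : σ ≠ 0 := by rcases hσ with rfl | rfl <;> norm_num
    simp [rotBase, this, hσ0]
  have hb' : rotBase σ ^ a ≠ 0 := by simp [Complex.cpow_eq_zero_iff, hb]
  rw [integral_mul_const, integral_cpow_mul_exp (by simpa using ha)
    (by simp; positivity), neg_neg, add_mul_I_cpow hσ hε]
  field_simp

/-- Integrability comes from Fubini: up to a nonzero constant the function is a marginal of the
integrable Laplace kernel. -/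
theorem integrable_add_mul_I_cpow_mul_of_neg (hσ : σ = 1 ∨ σ = -1) (ha : a.re < 0) (hε : 0 < ε)
    (f : 𝓢(ℝ, ℂ)) : Integrable fun x : ℝ => ((x : ℂ) + σ * ε * Complex.I) ^ a * f x := by
  have h := (integrable_laplace_kernel (σ := σ) ha hε f).integral_prod_left
  simp only [Function.uncurry, inner_laplace_integral hσ ha hε f] at h
  have hb' : rotBase σ ^ a ≠ 0 := by
    have : (Real.pi : ℂ) ≠ 0 := by exact_mod_cast Real.pi_pos.ne'
    have hσ0 : σ ≠ 0 := by rcases hσ with rfl | rfl <;> norm_num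
    simp [Complex.cpow_eq_zero_iff, rotBase, this, hσ0]
  have hΓ : Complex.Gamma (-a) ≠ 0 := Complex.Gamma_ne_zero_of_re_pos (by simpa using ha)
  refine (h.const_mul ((rotBase σ ^ a)⁻¹ * Complex.Gamma (-a))⁻¹).congr
    (Eventually.of_forall fun x => ?_)
  field_simp

/-- After the exchange of integrals, ε appears only in the damping factor e^{-2πεξ} ≤ 1, so the
limit ε ↓ 0 becomes plain dominated convergence. -/
theorem integral_add_mul_I_cpow_mul (hσ : σ = 1 ∨ σ = -1)
    (hL : ∀ (f : 𝓢(ℝ, ℂ)) (ξ : ℝ),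
      L f ξ = ∫ x : ℝ, Complex.exp (2 * Real.pi * Complex.I * σ * x * ξ) * f x)
    (ha : a.re < 0) (hε : 0 < ε) (f : 𝓢(ℝ, ℂ)) :
    ∫ x : ℝ, ((x : ℂ) + σ * ε * Complex.I) ^ a * f x =
      rotBase σ ^ a * (Complex.Gamma (-a))⁻¹ *
        ∫ ξ in Ioi (0 : ℝ), (ξ : ℂ) ^ (-a - 1) * (Real.exp (-(2 * Real.pi * ε * ξ)) * L f ξ) := by
  have h := integral_integral_swap (integrable_laplace_kernel (σ := σ) ha hε f)
  simp only [inner_laplace_integral hσ ha hε f] at h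
  rw [integral_const_mul] at h
  have hb' : rotBase σ ^ a ≠ 0 := by
    have : (Real.pi : ℂ) ≠ 0 := by exact_mod_cast Real.pi_pos.ne'
    have hσ0 : σ ≠ 0 := by rcases hσ with rfl | rfl <;> norm_num
    simp [Complex.cpow_eq_zero_iff, rotBase, this, hσ0]
  have hΓ : Complex.Gamma (-a) ≠ 0 := Complex.Gamma_ne_zero_of_re_pos (by simpa using ha)
  have h2 : ∀ ξ : ℝ, ∫ x : ℝ, (ξ : ℂ) ^ (-a - 1) *
      Complex.exp (-(2 * Real.pi * (ε - Complex.I * σ * x) * ξ)) * f x =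
      (ξ : ℂ) ^ (-a - 1) * (Real.exp (-(2 * Real.pi * ε * ξ)) * L f ξ) := by
    intro ξ
    rw [hL, ← integral_const_mul, ← integral_const_mul]
    refine integral_congr_ae (Eventually.of_forall fun x => ?_)
    simp only
    rw [show (-(2 * Real.pi * (ε - Complex.I * σ * x) * ξ) : ℂ) =
      ((-(2 * Real.pi * ε * ξ) : ℝ) : ℂ) + 2 * Real.pi * Complex.I * σ * x * ξ by
      push_cast; ring, Complex.exp_add, Complex.ofReal_exp]
    ring
  simp only [h2] at h
  rw [← h]
  field_simp

theorem tendsto_integral_add_mul_I_cpow_mul (hσ : σ = 1 ∨ σ = -1)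
    (hL : ∀ (f : 𝓢(ℝ, ℂ)) (ξ : ℝ),
      L f ξ = ∫ x : ℝ, Complex.exp (2 * Real.pi * Complex.I * σ * x * ξ) * f x)
    (ha : a.re < 0) (f : 𝓢(ℝ, ℂ)) :
    Tendsto (fun ε : ℝ => ∫ x : ℝ, ((x : ℂ) + σ * ε * Complex.I) ^ a * f x) (𝓝[>] 0)
      (𝓝 (rotBase σ ^ a * gammaConv (-a) (L f) 0)) := by
  have hπ := Real.pi_pos
  have hlim : Tendsto (fun ε : ℝ => ∫ ξ in Ioi (0 : ℝ), (ξ : ℂ) ^ (-a - 1) *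
      (Real.exp (-(2 * Real.pi * ε * ξ)) * L f ξ)) (𝓝[>] 0) (𝓝 (halfMellin (-a) (L f) 0)) := by
    have hi := integrableOn_mellin_schwartz (s := -a) (by simpa using ha) (L f) 0
    refine tendsto_integral_filter_of_dominated_convergence _
      (Eventually.of_forall fun ε => aestronglyMeasurable_cpow_mul_continuous (-a)
        (by have := (L f).continuous; fun_prop)) ?_ hi.norm ?_
    · filter_upwards [self_mem_nhdsWithin] with ε hε
      have hε0 : (0 : ℝ) < ε := hε
      refine ae_restrict_of_forall_mem measurableSet_Ioi fun ξ hξ => ?_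
      have hξ0 : (0 : ℝ) < ξ := hξ
      rw [add_zero, norm_mul, norm_mul, norm_mul, Complex.norm_real,
        Real.norm_of_nonneg (Real.exp_pos _).le]
      have : Real.exp (-(2 * Real.pi * ε * ξ)) ≤ 1 := by
        rw [Real.exp_le_one_iff, neg_nonpos]; positivity
      gcongr
      exact mul_le_of_le_one_left (norm_nonneg _) this
    · refine ae_restrict_of_forall_mem measurableSet_Ioi fun ξ _ => ?_
      have hc : Continuous fun ε : ℝ => (ξ : ℂ) ^ (-a - 1) *
          (Real.exp (-(2 * Real.pi * ε * ξ)) * L f ξ) := by fun_prop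
      have := (hc.tendsto 0).mono_left (nhdsWithin_le_nhds (s := Ioi 0))
      simpa using this
  rw [gammaConv, ← mul_assoc]
  refine (hlim.const_mul (rotBase σ ^ a * (Complex.Gamma (-a))⁻¹)).congr' ?_
  filter_upwards [self_mem_nhdsWithin] with ε hε
  exact (integral_add_mul_I_cpow_mul hσ hL ha hε f).symm

end

theorem exists_temperedDistribution_gammaConv {s : ℂ} (hs : 0 < s.re) :
    ∃ T : 𝓢'(ℝ, ℂ), ∀ f : 𝓢(ℝ, ℂ), T f = gammaConv s f 0 := by
  obtain ⟨N, hN⟩ := exists_nat_gt s.re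
  have hM : 0 ≤ ∫ y in Ioi 0, mellinWeight s.re s.re N y :=
    setIntegral_nonneg measurableSet_Ioi fun y hy => by
      have hy0 : (0 : ℝ) < y := hy
      unfold mellinWeight; positivity
  refine exists_temperedDistribution _ (fun f g => gammaConv_add hs f g 0)
    (fun c f => gammaConv_smul s c f 0) (N + 2)
    (‖(Complex.Gamma s)⁻¹‖ * ∫ y in Ioi 0, mellinWeight s.re s.re N y) (by positivity) fun f => ?_
  refine ((regBound_gammaConv hs le_rfl le_rfl hN f).norm_le 0).trans_eq ?_
  simp only [abs_zero, add_zero, one_pow, mul_one]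
  ring

/-- Multiplication of Schwartz functions by `x`. -/
noncomputable def mulX : 𝓢(ℝ, ℂ) →L[ℂ] 𝓢(ℝ, ℂ) :=
  SchwartzMap.smulLeftCLM ℂ (Complex.ofReal : ℝ → ℂ)

theorem mulX_apply (f : 𝓢(ℝ, ℂ)) (x : ℝ) : mulX f x = x * f x := by
  rw [mulX, SchwartzMap.smulLeftCLM_apply_apply Function.Complex.hasTemperateGrowth_ofReal,
    smul_eq_mul]

/-- Induction over half-planes from (x + iσε)^a = (x + iσε)^{a-1} (x + iσε). The part with the
factor iσε vanishes in the limit, so the distribution at a is the one at a - 1 tested against x f.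
Integrability is carried along in order to split the integral. -/
theorem exists_boundaryPower_of_re_lt {σ : ℝ} (hσ : σ = 1 ∨ σ = -1) (n : ℕ) :
    (∀ a : ℂ, a.re < n → ∀ ε > 0, ∀ f : 𝓢(ℝ, ℂ),
      Integrable fun x : ℝ => ((x : ℂ) + σ * (ε : ℝ) * Complex.I) ^ a * f x) ∧
    ∃ T : ℂ → 𝓢'(ℝ, ℂ), (∀ a : ℂ, a.re < n → IsBoundaryPower σ a (T a)) ∧
      ∀ f, DifferentiableOn ℂ (fun a => T a f) {a | a.re < n} := by
  induction n with
  | zero =>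
    simp only [Nat.cast_zero]
    refine ⟨fun a ha ε hε f => integrable_add_mul_I_cpow_mul_of_neg hσ ha hε f, ?_⟩
    obtain ⟨L, hL⟩ := exists_exp_transform hσ
    have hT : ∀ a : ℂ, ∃ T : 𝓢'(ℝ, ℂ), a.re < 0 →
        ∀ f : 𝓢(ℝ, ℂ), T f = rotBase σ ^ a * gammaConv (-a) (L f) 0 := by
      intro a
      by_cases ha : a.re < 0
      · obtain ⟨T, hT⟩ := exists_temperedDistribution_gammaConv (s := -a) (by simpa using ha)
        refine ⟨rotBase σ ^ a • PointwiseConvergenceCLM.precomp ℂ L T, fun _ f => ?_⟩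
        rw [← hT]
        rfl
      · exact ⟨0, fun h => absurd h ha⟩
    choose T hT using hT
    refine ⟨T, fun a ha f => ?_, fun f => ?_⟩
    · rw [hT a ha]
      exact tendsto_integral_add_mul_I_cpow_mul hσ hL ha f
    · have hb : rotBase σ ≠ 0 := by
        have : (Real.pi : ℂ) ≠ 0 := by exact_mod_cast Real.pi_pos.ne'
        have hσ0 : σ ≠ 0 := by rcases hσ with rfl | rfl <;> norm_num
        simp [rotBase, this, hσ0]
      refine DifferentiableOn.congr (f := fun a => rotBase σ ^ a * gammaConv (-a) (L f) 0) ?_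
        fun a ha => hT a ha f
      refine DifferentiableOn.mul (fun a _ => (differentiableAt_id.const_cpow
        (Or.inl hb)).differentiableWithinAt) ?_
      exact (differentiableOn_gammaConv (L f) 0).comp differentiable_neg.differentiableOn
        fun a ha => by simpa using ha
  | succ n ih =>
    obtain ⟨hint, T, hT, hTd⟩ := ih
    have hne : ∀ ε : ℝ, 0 < ε → ∀ x : ℝ, (x : ℂ) + σ * ε * Complex.I ≠ 0 := by
      intro ε hε x h
      have := congrArg Complex.im h
      rcases hσ with rfl | rfl <;> simp at this <;> linarith
    have hsplit : ∀ a : ℂ, ∀ ε : ℝ, 0 < ε → ∀ (f : 𝓢(ℝ, ℂ)) (x : ℝ),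
        ((x : ℂ) + σ * ε * Complex.I) ^ a * f x =
          ((x : ℂ) + σ * ε * Complex.I) ^ (a - 1) * mulX f x +
            σ * ε * Complex.I * (((x : ℂ) + σ * ε * Complex.I) ^ (a - 1) * f x) := by
      intro a ε hε f x
      rw [mulX_apply]
      conv_lhs => rw [← sub_add_cancel a 1, Complex.cpow_add _ _ (hne ε hε x), Complex.cpow_one]
      ring
    have hlt : ∀ a : ℂ, a.re < (n + 1 : ℕ) → (a - 1).re < n := by
      intro a ha
      push_cast at ha
      simp only [Complex.sub_re, Complex.one_re]
      linarith
    refine ⟨fun a ha ε hε f => ?_, fun a => PointwiseConvergenceCLM.precomp ℂ mulX (T (a - 1)),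
      fun a ha f => ?_, fun f => ?_⟩
    · simp only [hsplit a ε hε]
      exact (hint _ (hlt a ha) ε hε _).add ((hint _ (hlt a ha) ε hε _).const_mul _)
    · have h1 := hT (a - 1) (hlt a ha) (mulX f)
      have h2 := hT (a - 1) (hlt a ha) f
      have h3 : Tendsto (fun ε : ℝ => (σ * ε * Complex.I : ℂ)) (𝓝[>] 0) (𝓝 0) := by
        have hc : Continuous fun ε : ℝ => (σ * ε * Complex.I : ℂ) := by fun_prop
        simpa using (hc.tendsto 0).mono_left (nhdsWithin_le_nhds (s := Ioi 0))
      have h4 := h1.add (h3.mul h2)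
      rw [zero_mul, add_zero] at h4
      refine h4.congr' ?_
      filter_upwards [self_mem_nhdsWithin] with ε hε
      simp only [hsplit a ε hε]
      rw [integral_add (hint _ (hlt a ha) ε hε _) ((hint _ (hlt a ha) ε hε _).const_mul _),
        integral_const_mul]
    · exact (hTd (mulX f)).comp (by fun_prop) fun a ha => hlt a ha

/-- The constructions on different half-planes agree by uniqueness of limits, so holomorphy on each
of them gives an entire family. -/
theorem exists_boundaryPower {σ : ℝ} (hσ : σ = 1 ∨ σ = -1) :
    ∃ T : ℂ → 𝓢'(ℝ, ℂ), (∀ a, IsBoundaryPower σ a (T a)) ∧ IsEntireFamily T := by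
  have hex : ∀ a : ℂ, ∃ T : 𝓢'(ℝ, ℂ), IsBoundaryPower σ a T := by
    intro a
    obtain ⟨n, hn⟩ := exists_nat_gt a.re
    obtain ⟨-, T, hT, -⟩ := exists_boundaryPower_of_re_lt hσ n
    exact ⟨T a, hT a hn⟩
  choose T hT using hex
  refine ⟨T, hT, fun f a => ?_⟩
  obtain ⟨n, hn⟩ := exists_nat_gt a.re
  obtain ⟨-, T', hT', hd⟩ := exists_boundaryPower_of_re_lt hσ n
  have hmem : {a : ℂ | a.re < n} ∈ 𝓝 a :=
    (isOpen_lt Complex.continuous_re continuous_const).mem_nhds hn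
  refine ((hd f).differentiableAt hmem).congr_of_eventuallyEq ?_
  filter_upwards [hmem] with b hb
  exact tendsto_nhds_unique (hT b f) (hT' b hb f)

/-! ### The beta integral on the slit plane -/

theorem mul_one_add_le_norm_add_of_mem_slitPlane {a₀ : ℂ} (ha₀ : a₀ ∈ Complex.slitPlane) :
    ∃ V ∈ 𝓝 a₀, ∃ c : ℝ, 0 < c ∧ ∀ a ∈ V, ∀ y : ℝ, 0 ≤ y → c * (1 + y) ≤ ‖(y : ℂ) + a‖ := by
  -- The points -y with y ≥ 0 lie outside the slit plane, so a ball about a₀ inside the slit plane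
  -- keeps y + a₀ away from 0 uniformly in y.
  obtain ⟨δ, hδ, hball⟩ := Metric.isOpen_iff.1 Complex.isOpen_slitPlane a₀ ha₀
  have hdist : ∀ y : ℝ, 0 ≤ y → δ ≤ ‖(y : ℂ) + a₀‖ := by
    intro y hy
    by_contra! h
    have h1 : (-(y : ℂ)) ∈ Metric.ball a₀ δ := by
      rw [Metric.mem_ball, dist_eq_norm, show -(y : ℂ) - a₀ = -(y + a₀) by ring, norm_neg]
      exact h
    have h2 := hball h1
    rw [← Complex.ofReal_neg, Complex.ofReal_mem_slitPlane] at h2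
    linarith
  set M := ‖a₀‖ + δ / 2 with hM
  have hM0 : 0 ≤ M := by positivity
  refine ⟨Metric.ball a₀ (δ / 2), Metric.ball_mem_nhds _ (half_pos hδ),
    -- Writing ρ = ‖y + a‖, both δ/2 ≤ ρ and y ≤ ρ + M hold; hence 1 + y ≤ ρ + (M + 1) ≤ ρ (1 + (M +
    -- 1)/(δ/2)).
    (1 + (M + 1) / (δ / 2))⁻¹, by positivity, fun a ha y hy => ?_⟩
  rw [Metric.mem_ball, dist_eq_norm] at ha
  have h1 : δ / 2 ≤ ‖(y : ℂ) + a‖ := by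
    have h3 : ‖(y : ℂ) + a₀‖ ≤ ‖(y : ℂ) + a‖ + ‖a - a₀‖ := by
      have := norm_sub_le ((y : ℂ) + a) (a - a₀)
      rwa [show (y : ℂ) + a - (a - a₀) = y + a₀ by ring] at this
    linarith [hdist y hy]
  have h2 : y ≤ ‖(y : ℂ) + a‖ + M := by
    have h3 := norm_sub_le ((y : ℂ) + a) a
    rw [add_sub_cancel_right, Complex.norm_real, Real.norm_of_nonneg hy] at h3
    have h4 : ‖a‖ ≤ ‖a₀‖ + ‖a - a₀‖ := by
      have := norm_add_le a₀ (a - a₀)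
      rwa [add_sub_cancel] at this
    linarith
  rw [inv_mul_le_iff₀ (by positivity), add_mul, one_mul]
  have h3 : M + 1 ≤ (M + 1) / (δ / 2) * ‖(y : ℂ) + a‖ := by
    rw [div_mul_eq_mul_div, le_div_iff₀ (by positivity)]
    gcongr
  linarith

section
variable {s : ℂ}

theorem norm_cpow_div_sq_le {c : ℝ} (hc : 0 < c) {a : ℂ} {y : ℝ} (hy : 0 < y)
    (h : c * (1 + y) ≤ ‖(y : ℂ) + a‖) :
    ‖(y : ℂ) ^ (s - 1) * (1 / ((y : ℂ) + a) ^ 2)‖ ≤ (c ^ 2)⁻¹ * (y ^ (s.re - 1) / (1 + y) ^ 2) := by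
  rw [norm_mul, Complex.norm_cpow_eq_rpow_re_of_pos hy, Complex.sub_re, Complex.one_re, norm_div,
    norm_one, norm_pow]
  calc _ ≤ y ^ (s.re - 1) * (1 / (c * (1 + y)) ^ 2) := by gcongr
    _ = _ := by rw [mul_pow]; field_simp

theorem aestronglyMeasurable_cpow_div_sq (a : ℂ) :
    AEStronglyMeasurable (fun y : ℝ => (y : ℂ) ^ (s - 1) * (1 / ((y : ℂ) + a) ^ 2))
      (volume.restrict (Ioi 0)) :=
  (by fun_prop : Measurable fun y : ℝ =>
    (y : ℂ) ^ (s - 1) * (1 / ((y : ℂ) + a) ^ 2)).aestronglyMeasurable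

theorem integrableOn_cpow_div_sq (hs : 0 < s.re) (hs2 : s.re < 2) {a : ℂ}
    (ha : a ∈ Complex.slitPlane) :
    IntegrableOn (fun y : ℝ => (y : ℂ) ^ (s - 1) * (1 / ((y : ℂ) + a) ^ 2)) (Ioi 0) := by
  obtain ⟨V, hV, c, hc, h⟩ := mul_one_add_le_norm_add_of_mem_slitPlane ha
  exact ((integrableOn_rpow_div_one_add_pow hs (N := 2) (by exact_mod_cast hs2)).const_mul
    (c ^ 2)⁻¹).mono' (aestronglyMeasurable_cpow_div_sq a)
    (ae_restrict_of_forall_mem measurableSet_Ioi fun y hy =>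
      norm_cpow_div_sq_le hc hy (h a (mem_of_mem_nhds hV) y (le_of_lt hy)))

theorem integrable_beta_kernel (hs : 0 < s.re) (hs2 : s.re < 2) {a : ℂ} (ha : 0 < a.re) :
    Integrable (Function.uncurry fun (y ξ : ℝ) => (y : ℂ) ^ (s - 1) *
      ((ξ : ℂ) ^ ((2 : ℂ) - 1) * Complex.exp (-((y + a) * ξ))))
      ((volume.restrict (Ioi 0)).prod (volume.restrict (Ioi 0))) := by
  have hm : Measurable (Function.uncurry fun (y ξ : ℝ) => (y : ℂ) ^ (s - 1) *
      ((ξ : ℂ) ^ ((2 : ℂ) - 1) * Complex.exp (-((y + a) * ξ)))) := by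
    unfold Function.uncurry
    fun_prop
  have hnorm : ∀ ξ ∈ Ioi (0 : ℝ), ∀ y ∈ Ioi (0 : ℝ), ‖(y : ℂ) ^ (s - 1) *
      ((ξ : ℂ) ^ ((2 : ℂ) - 1) * Complex.exp (-((y + a) * ξ)))‖ =
      ξ * Real.exp (-(a.re * ξ)) * (y ^ (s.re - 1) * Real.exp (-(ξ * y))) := by
    intro ξ hξ y hy
    rw [norm_mul, norm_cpow_mul_exp hξ, Complex.norm_cpow_eq_rpow_re_of_pos hy]
    have : (2 : ℂ).re - 1 = 1 := by norm_num
    rw [this, Real.rpow_one, Complex.sub_re, Complex.one_re, Complex.add_re, Complex.ofReal_re,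
      show -((y + a.re) * ξ) = -(a.re * ξ) + -(ξ * y) by ring, Real.exp_add]
    ring
  rw [integrable_prod_iff' hm.aestronglyMeasurable]
  constructor
  · refine ae_restrict_of_forall_mem measurableSet_Ioi fun ξ hξ => ?_
    refine ((integrableOn_rpow_mul_exp hs hξ).const_mul (ξ * Real.exp (-(a.re * ξ)))).mono'
      (hm.comp (measurable_id.prodMk measurable_const)).aestronglyMeasurable
      (ae_restrict_of_forall_mem measurableSet_Ioi fun y hy => (hnorm ξ hξ y hy).le)
  · refine IntegrableOn.congr_fun (f := fun ξ : ℝ => Real.Gamma s.re *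
      (ξ ^ ((2 - s.re) - 1) * Real.exp (-(a.re * ξ))))
      ((integrableOn_rpow_mul_exp (by linarith) ha).const_mul _) (fun ξ hξ => ?_) measurableSet_Ioi
    have hξ0 : (0 : ℝ) < ξ := hξ
    simp only [Function.uncurry]
    rw [setIntegral_congr_fun measurableSet_Ioi (hnorm ξ hξ), integral_const_mul,
      Real.integral_rpow_mul_exp_neg_mul_Ioi hs hξ0, one_div, Real.inv_rpow hξ0.le,
      show 2 - s.re - 1 = 1 - s.re by ring, Real.rpow_sub hξ0, Real.rpow_one]
    ring

/-- Insert 1/(y+a)² = ∫₀^∞ ξ e^{-(y+a)ξ} dξ and exchange the integrals: the y-integral gives Γ(s)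
ξ^{-s}, the remaining ξ-integral gives Γ(2-s) a^{s-2}. -/
theorem integral_cpow_div_sq_of_re_pos (hs : 0 < s.re) (hs2 : s.re < 2) {a : ℂ} (ha : 0 < a.re) :
    ∫ y in Ioi (0 : ℝ), (y : ℂ) ^ (s - 1) * (1 / ((y : ℂ) + a) ^ 2) =
      Complex.Gamma s * Complex.Gamma (2 - s) * a ^ (s - 2) := by
  have h := integral_integral_swap (integrable_beta_kernel hs hs2 ha)
  have h1 : ∀ y ∈ Ioi (0 : ℝ), ∫ ξ in Ioi (0 : ℝ), (y : ℂ) ^ (s - 1) *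
      ((ξ : ℂ) ^ ((2 : ℂ) - 1) * Complex.exp (-((y + a) * ξ))) =
      (y : ℂ) ^ (s - 1) * (1 / ((y : ℂ) + a) ^ 2) := by
    intro y hy
    have hy0 : (0 : ℝ) < y := hy
    rw [integral_const_mul, integral_cpow_mul_exp (by norm_num)
      (by simp only [Complex.add_re, Complex.ofReal_re]; linarith), Complex.cpow_neg]
    have : Complex.Gamma 2 = 1 := by simp
    rw [this, mul_one, one_div]
    norm_cast
  have h2 : ∀ ξ ∈ Ioi (0 : ℝ), ∫ y in Ioi (0 : ℝ), (y : ℂ) ^ (s - 1) *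
      ((ξ : ℂ) ^ ((2 : ℂ) - 1) * Complex.exp (-((y + a) * ξ))) =
      Complex.Gamma s * ((ξ : ℂ) ^ (2 - s - 1) * Complex.exp (-(a * ξ))) := by
    intro ξ hξ
    have hξ0 : (0 : ℝ) < ξ := hξ
    have hξ1 : (ξ : ℂ) ≠ 0 := by exact_mod_cast hξ0.ne'
    have h3 : ∀ y : ℝ, (y : ℂ) ^ (s - 1) *
        ((ξ : ℂ) ^ ((2 : ℂ) - 1) * Complex.exp (-((y + a) * ξ))) =
        (ξ : ℂ) * Complex.exp (-(a * ξ)) * ((y : ℂ) ^ (s - 1) * Complex.exp (-(ξ * y))) := by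
      intro y
      rw [show (2 : ℂ) - 1 = 1 by norm_num, Complex.cpow_one,
        show (-((y + a) * ξ) : ℂ) = -(a * ξ) + -(ξ * y) by ring, Complex.exp_add]
      ring
    simp only [h3]
    rw [integral_const_mul, integral_cpow_mul_exp hs (by simpa using hξ0),
      show (2 : ℂ) - s - 1 = 1 + -s by ring, Complex.cpow_add _ _ hξ1, Complex.cpow_one]
    ring
  rw [setIntegral_congr_fun measurableSet_Ioi h1, setIntegral_congr_fun measurableSet_Ioi h2,
    integral_const_mul, integral_cpow_mul_exp (by simp; linarith) ha, neg_sub] at h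
  rw [h]
  ring

/-- Analytic continuation in a from the right half-plane to the slit plane. The larger domain is
needed because the points -z - 2πim of the Lipschitz sum can lie in the left half-plane. -/
theorem integral_cpow_div_sq (hs : 0 < s.re) (hs2 : s.re < 2) {a : ℂ} (ha : a ∈ Complex.slitPlane) :
    ∫ y in Ioi (0 : ℝ), (y : ℂ) ^ (s - 1) * (1 / ((y : ℂ) + a) ^ 2) =
      Complex.Gamma s * Complex.Gamma (2 - s) * a ^ (s - 2) := by
  have hopen := Complex.isOpen_slitPlane
  have hL : DifferentiableOn ℂ (fun a : ℂ =>
      ∫ y in Ioi (0 : ℝ), (y : ℂ) ^ (s - 1) * (1 / ((y : ℂ) + a) ^ 2)) Complex.slitPlane := by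
    refine differentiableOn_integral_of_dominated hopen
      (fun a _ => aestronglyMeasurable_cpow_div_sq a)
      (ae_restrict_of_forall_mem measurableSet_Ioi fun y hy a ha => ?_) fun a₀ ha₀ => ?_
    · have hne : (y : ℂ) + a ≠ 0 := by
        obtain ⟨V, hV, c, hc, h⟩ := mul_one_add_le_norm_add_of_mem_slitPlane ha
        have hy0 : (0 : ℝ) < y := hy
        have := h a (mem_of_mem_nhds hV) y hy0.le
        exact norm_pos_iff.1 (lt_of_lt_of_le (by positivity) this)
      have : ((y : ℂ) + a) ^ 2 ≠ 0 := pow_ne_zero _ hne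
      refine DifferentiableAt.differentiableWithinAt ?_
      fun_prop (disch := assumption)
    · obtain ⟨V, hV, c, hc, h⟩ := mul_one_add_le_norm_add_of_mem_slitPlane ha₀
      exact ⟨V, hV, _, (integrableOn_rpow_div_one_add_pow hs (N := 2)
        (by exact_mod_cast hs2)).const_mul (c ^ 2)⁻¹,
        ae_restrict_of_forall_mem measurableSet_Ioi fun y hy a ha =>
          norm_cpow_div_sq_le hc hy (h a ha y (le_of_lt hy))⟩
  have hR : DifferentiableOn ℂ (fun a : ℂ =>
      Complex.Gamma s * Complex.Gamma (2 - s) * a ^ (s - 2)) Complex.slitPlane := fun a ha =>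
    ((differentiableAt_id.cpow_const ha).const_mul _).differentiableWithinAt
  refine (hL.analyticOnNhd hopen).eqOn_of_preconnected_of_eventuallyEq
    (hR.analyticOnNhd hopen) ?_ Complex.one_mem_slitPlane ?_ ha
  · exact (Complex.starConvex_one_slitPlane.isPathConnected
      Complex.one_mem_slitPlane).isConnected.isPreconnected
  · filter_upwards [isOpen_re_pos.mem_nhds (show 0 < (1 : ℂ).re by simp)] with a ha
    exact integral_cpow_div_sq_of_re_pos hs hs2 ha

end

/-! ### Partial fractions and the Lipschitz formula -/

/-- The derivative of `1 / (e^{-z} - 1)`. -/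
noncomputable def boseDeriv (z : ℂ) : ℂ := Complex.exp z / (1 - Complex.exp z) ^ 2

theorem boseDeriv_neg (z : ℂ) : boseDeriv (-z) = boseDeriv z := by
  have h := Complex.exp_ne_zero z
  rw [boseDeriv, boseDeriv, Complex.exp_neg]
  have h2 : 1 - (Complex.exp z)⁻¹ = -(1 - Complex.exp z) / Complex.exp z := by
    field_simp; ring
  rw [h2, div_pow, neg_sq]
  by_cases h3 : 1 - Complex.exp z = 0
  · simp [h3]
  · field_simp

theorem hasDerivAt_inv_exp_neg_sub_one {z : ℂ} (hz : Complex.exp z ≠ 1) :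
    HasDerivAt (fun z => 1 / (Complex.exp (-z) - 1)) (boseDeriv z) z := by
  have h0 := Complex.exp_ne_zero z
  have hz' : Complex.exp (-z) - 1 ≠ 0 := by
    rw [Complex.exp_neg]
    intro h
    apply hz
    have : (Complex.exp z)⁻¹ = 1 := by linear_combination h
    exact inv_eq_one.1 this
  have h1 : HasDerivAt (fun z : ℂ => Complex.exp (-z) - 1) (-Complex.exp (-z)) z := by
    simpa using ((hasDerivAt_neg z).cexp).sub_const 1
  refine ((hasDerivAt_const z (1 : ℂ)).fun_div h1 hz').congr_deriv ?_
  rw [← boseDeriv_neg, boseDeriv, ← neg_sub (Complex.exp (-z)), neg_sq]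
  ring

/-- Both sides equal ∑ n e^{nz}: the left by differentiating the geometric series, the right by the
q-expansion of ∑ (w+m)^{-2}. -/
theorem boseDeriv_eq_tsum_of_re_neg {z : ℂ} (hz : z.re < 0) :
    boseDeriv z = ∑' m : ℤ, 1 / (z + 2 * Real.pi * Complex.I * m) ^ 2 := by
  have hπ : (Real.pi : ℂ) ≠ 0 := by exact_mod_cast Real.pi_pos.ne'
  -- This is w = z/(2πi), which lies in the upper half-plane because Re z < 0.
  set w : ℂ := -Complex.I * z / (2 * Real.pi) with hw
  have hzw : 2 * Real.pi * Complex.I * w = z := by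
    rw [hw]; field_simp; rw [Complex.I_sq]; ring
  have him : 0 < w.im := by
    have h1 := congrArg Complex.re hzw
    have h2 : (2 * Real.pi * Complex.I * w).re = -(2 * Real.pi * w.im) := by
      simp
    rw [h2] at h1
    have := Real.pi_pos
    by_contra! h
    nlinarith
  have key := EisensteinSeries.qExpansion_identity (k := 1) le_rfl ⟨w, him⟩
  have hq : ‖Complex.exp z‖ < 1 := by
    rw [Complex.norm_exp]; exact Real.exp_lt_one_iff.2 hz
  have h2 : ∑' n : ℕ, (n : ℂ) ^ 1 * Complex.exp (2 * Real.pi * Complex.I * w) ^ n =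
      boseDeriv z := by
    rw [hzw]
    simp only [pow_one]
    rw [tsum_coe_mul_geometric_of_norm_lt_one hq, boseDeriv]
  simp only at key
  rw [h2] at key
  have h3 : ∀ m : ℤ, 1 / (z + 2 * Real.pi * Complex.I * m) ^ 2 =
      ((2 * Real.pi * Complex.I) ^ 2)⁻¹ * (1 / (w + m) ^ (1 + 1)) := by
    intro m
    rw [← hzw, ← mul_add, mul_pow]
    field_simp
  simp only [h3]
  rw [tsum_mul_left, key]
  simp only [Nat.factorial_one, Nat.cast_one, div_one]
  have : (2 * Real.pi * Complex.I : ℂ) ≠ 0 := by simp [hπ]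
  field_simp
  ring

theorem boseDeriv_eq_tsum {z : ℂ} (hz : z.re ≠ 0) :
    boseDeriv z = ∑' m : ℤ, 1 / (z + 2 * Real.pi * Complex.I * m) ^ 2 := by
  rcases lt_or_gt_of_ne hz with h | h
  · exact boseDeriv_eq_tsum_of_re_neg h
  · rw [← boseDeriv_neg, boseDeriv_eq_tsum_of_re_neg (by simpa using h),
      ← (Equiv.neg ℤ).tsum_eq]
    refine tsum_congr fun m => ?_
    simp only [Equiv.neg_apply]
    push_cast
    rw [show -z + 2 * Real.pi * Complex.I * -(m : ℂ) = -(z + 2 * Real.pi * Complex.I * m) by ring,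
      neg_sq]

/-- The base points `-z - 2πim` of the Lipschitz sum. -/
noncomputable def node (z : ℂ) (m : ℤ) : ℂ := -z - 2 * Real.pi * Complex.I * m

theorem node_re (z : ℂ) (m : ℤ) : (node z m).re = -z.re := by simp [node]

theorem node_im (z : ℂ) (m : ℤ) : (node z m).im = -z.im - 2 * Real.pi * m := by simp [node]

/-- For y ≥ 2|m| the real part is at least y - |m|; for y ≤ 2|m| the imaginary part is at least
2π|m| - |m| ≥ |m|. Both exceed (y + |m|)/3. -/
theorem add_abs_div_three_le_norm {z : ℂ} {m : ℤ} (hx : |z.re| ≤ |(m : ℝ)|)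
    (hy : |z.im| ≤ |(m : ℝ)|) (y : ℝ) :
    (y + |(m : ℝ)|) / 3 ≤ ‖(y : ℂ) + node z m‖ := by
  set M := |(m : ℝ)| with hM
  have hM0 : 0 ≤ M := abs_nonneg _
  rcases le_total (2 * M) y with h1 | h1
  · refine le_trans ?_ (Complex.abs_re_le_norm _)
    rw [Complex.add_re, node_re, Complex.ofReal_re]
    refine le_trans ?_ (le_abs_self _)
    linarith [le_abs_self z.re]
  · refine le_trans ?_ (Complex.abs_im_le_norm _)
    rw [Complex.add_im, node_im, Complex.ofReal_im, zero_add]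
    have h2 : |2 * Real.pi * (m : ℝ)| = 2 * Real.pi * M := by
      rw [abs_mul, abs_of_pos (by positivity)]
    have h3 : |2 * Real.pi * (m : ℝ)| ≤ |-z.im - 2 * Real.pi * m| + |z.im| := by
      have := abs_sub (-z.im - 2 * Real.pi * m) (-z.im)
      rwa [show -z.im - 2 * Real.pi * m - -z.im = -(2 * Real.pi * m) by ring, abs_neg,
        abs_neg] at this
    have h4 : 2 * M ≤ 2 * Real.pi * M := by nlinarith [Real.pi_gt_three]
    linarith

section
variable {s : ℂ}

theorem integral_rpow_div_sq {σ b : ℝ} (hs : 0 < σ) (hs2 : σ < 2) (hb : 0 < b) :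
    ∫ y in Ioi (0 : ℝ), y ^ (σ - 1) * (1 / (y + b) ^ 2) =
      Real.Gamma σ * Real.Gamma (2 - σ) * b ^ (σ - 2) := by
  have h := integral_cpow_div_sq (s := (σ : ℂ)) (by simpa) (by simpa) (a := (b : ℂ))
    (Complex.ofReal_mem_slitPlane.2 hb)
  have h1 : ∀ y ∈ Ioi (0 : ℝ), (y : ℂ) ^ ((σ : ℂ) - 1) * (1 / ((y : ℂ) + b) ^ 2) =
      ((y ^ (σ - 1) * (1 / (y + b) ^ 2) : ℝ) : ℂ) := by
    intro y hy
    push_cast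
    rw [Complex.ofReal_cpow (le_of_lt hy)]
    push_cast
    rfl
  rw [setIntegral_congr_fun measurableSet_Ioi h1, integral_complex_ofReal] at h
  have h2 : (2 - (σ : ℂ)) = ((2 - σ : ℝ) : ℂ) := by push_cast; ring
  have h3 : ((σ : ℂ) - 2) = ((σ - 2 : ℝ) : ℂ) := by push_cast; ring
  rw [h2, h3, Complex.Gamma_ofReal, Complex.Gamma_ofReal, ← Complex.ofReal_cpow hb.le] at h
  exact_mod_cast h

theorem integrableOn_rpow_div_sq {σ b : ℝ} (hs : 0 < σ) (hs2 : σ < 2) (hb : 0 < b) :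
    IntegrableOn (fun y : ℝ => y ^ (σ - 1) * (1 / (y + b) ^ 2)) (Ioi 0) := by
  have h := (integrableOn_cpow_div_sq (s := (σ : ℂ)) (by simpa) (by simpa) (a := (b : ℂ))
    (Complex.ofReal_mem_slitPlane.2 hb)).norm
  refine IntegrableOn.congr_fun h (fun y hy => ?_) measurableSet_Ioi
  have hy0 : (0 : ℝ) < y := hy
  rw [norm_mul, Complex.norm_cpow_eq_rpow_re_of_pos hy0, norm_div, norm_one, norm_pow,
    ← Complex.ofReal_add, Complex.norm_real, Real.norm_of_nonneg (by positivity)]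
  simp

theorem eventually_cofinite_le_abs (M : ℝ) : ∀ᶠ m : ℤ in cofinite, M ≤ |(m : ℝ)| := by
  obtain ⟨n, hn⟩ := exists_nat_ge M
  refine (Set.finite_Icc (-(n : ℤ)) n).subset fun m hm => ?_
  have hm' : ¬ M ≤ |(m : ℝ)| := hm
  have h1 : |(m : ℝ)| ≤ n := (not_le.1 hm').le.trans hn
  exact abs_le.1 (by exact_mod_cast h1)

/-- Comparison with the real beta integral ∫ y^{σ-1}/(y+|m|)² dy, with σ = Re s, which is a constant
times |m|^{σ-2}. The sum over m converges because σ < 1; this is where the bound Re s < 0 of the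
Lipschitz formula comes from, as it is applied at s + 1. -/
theorem summable_integral_norm_lipschitz (hs : 0 < s.re) (hs1 : s.re < 1) (z : ℂ) :
    Summable fun m : ℤ => ∫ y in Ioi (0 : ℝ),
      ‖(y : ℂ) ^ (s - 1) * (1 / ((y : ℂ) + node z m) ^ 2)‖ := by
  refine Summable.of_norm_bounded_eventually
    (g := fun m : ℤ => 9 * (Real.Gamma s.re * Real.Gamma (2 - s.re)) * |(m : ℝ)| ^ (-(2 - s.re)))
    ((Real.summable_abs_int_rpow (by linarith)).mul_left _) ?_
  filter_upwards [eventually_cofinite_le_abs |z.re|, eventually_cofinite_le_abs |z.im|,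
    eventually_cofinite_le_abs 1] with m h1 h2 h3
  have hm : 0 < |(m : ℝ)| := by linarith
  rw [Real.norm_of_nonneg (integral_nonneg fun _ => norm_nonneg _)]
  have hle : ∀ y ∈ Ioi (0 : ℝ), ‖(y : ℂ) ^ (s - 1) * (1 / ((y : ℂ) + node z m) ^ 2)‖ ≤
      9 * (y ^ (s.re - 1) * (1 / (y + |(m : ℝ)|) ^ 2)) := by
    intro y hy
    have hy0 : (0 : ℝ) < y := hy
    rw [norm_mul, Complex.norm_cpow_eq_rpow_re_of_pos hy, Complex.sub_re, Complex.one_re,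
      norm_div, norm_one, norm_pow]
    have := add_abs_div_three_le_norm h1 h2 y
    calc _ ≤ y ^ (s.re - 1) * (1 / ((y + |(m : ℝ)|) / 3) ^ 2) := by gcongr
      _ = _ := by field_simp; ring
  refine (integral_mono_of_nonneg (Eventually.of_forall fun _ => norm_nonneg _)
    ((integrableOn_rpow_div_sq hs (by linarith) hm).const_mul 9)
    (ae_restrict_of_forall_mem measurableSet_Ioi hle)).trans_eq ?_
  rw [integral_const_mul, integral_rpow_div_sq hs (by linarith) hm, neg_sub]
  ring

/-- The Lipschitz formula. -/
theorem integral_cpow_mul_boseDeriv (hs : -1 < s.re) (hs0 : s.re < 0) {z : ℂ}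
    (hz : ∀ m : ℤ, node z m ∈ Complex.slitPlane) :
    HasSum (fun m : ℤ => Complex.Gamma (1 - s) * node z m ^ (s - 1))
      ((Complex.Gamma (s + 1))⁻¹ * ∫ y in Ioi (0 : ℝ), (y : ℂ) ^ s * boseDeriv (z - y)) := by
  have h0 : 0 < (s + 1).re := by simp; linarith
  have h1 : (s + 1).re < 1 := by simp; linarith
  have hΓ := Complex.Gamma_ne_zero_of_re_pos h0
  have h := (hasSum_integral_of_summable_integral_norm
    (fun m => integrableOn_cpow_div_sq h0 (by linarith) (hz m))
    (summable_integral_norm_lipschitz h0 h1 z)).mul_left (Complex.Gamma (s + 1))⁻¹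
  convert! h using 1
  · funext m
    rw [integral_cpow_div_sq h0 (by linarith) (hz m), show 2 - (s + 1) = 1 - s by ring,
      show s + 1 - 2 = s - 1 by ring]
    field_simp
  · congr 1
    refine integral_congr_ae ?_
    -- The partial fraction expansion is available off the line Re = 0, which excludes the single
    -- value y = Re z.
    have hae : ∀ᵐ y : ℝ ∂volume.restrict (Ioi 0), y ≠ z.re :=
      ae_restrict_of_ae (Measure.ae_ne volume z.re)
    filter_upwards [hae] with y hy
    rw [tsum_mul_left, add_sub_cancel_right, boseDeriv_eq_tsum (by
      simp only [Complex.sub_re, Complex.ofReal_re]; exact sub_ne_zero.2 hy.symm)]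
    congr 1
    refine tsum_congr fun m => ?_
    rw [show z - y + 2 * Real.pi * Complex.I * m = -(y + node z m) by rw [node]; ring, neg_sq]

theorem node_mem_slitPlane_of_im {z : ℂ} (h0 : z.im ≠ 0) (h1 : |z.im| < 2 * Real.pi) (m : ℤ) :
    node z m ∈ Complex.slitPlane := by
  refine Or.inr ?_
  rw [node_im]
  intro h
  have h2 : |2 * Real.pi * (m : ℝ)| < 2 * Real.pi := by
    rwa [show 2 * Real.pi * (m : ℝ) = -z.im by linarith, abs_neg]
  have h3 : |(m : ℝ)| < 1 := by
    rw [abs_mul, abs_of_pos Real.two_pi_pos] at h2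
    by_contra! h3
    nlinarith [Real.two_pi_pos]
  have h4 : m = 0 := by
    have : |m| < 1 := by exact_mod_cast h3
    exact Int.abs_lt_one_iff.1 this
  subst h4
  apply h0
  simpa using h

theorem node_ofReal_mem_slitPlane {x : ℝ} {m : ℤ} (h : x < 0 ∨ m ≠ 0) :
    node x m ∈ Complex.slitPlane := by
  rcases h with h | h
  · left; rw [node_re]; simpa using h
  · right
    rw [node_im]
    simp [Real.pi_ne_zero, h]

/-- Expand boseDeriv(x - y) = ∑ n e^{n(x-y)}, valid since x - y < 0, and integrate term by term: n
e^{nx} · Γ(s+1) n^{-s-1}. The resulting integral is the one in the Lipschitz formula, which links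
the two expansions. -/
theorem hasSum_liTerm (hs : -1 < s.re) {x : ℝ} (hx : x < 0) :
    HasSum (liTerm s x)
      ((Complex.Gamma (s + 1))⁻¹ * ∫ y in Ioi (0 : ℝ), (y : ℂ) ^ s * boseDeriv (x - y)) := by
  have h0 : 0 < (s + 1).re := by simp; linarith
  have hΓ := Complex.Gamma_ne_zero_of_re_pos h0
  have hint : ∀ n : ℕ, IntegrableOn (fun y : ℝ => (n + 1 : ℂ) * Complex.exp ((n + 1) * x) *
      ((y : ℂ) ^ (s + 1 - 1) * Complex.exp (-((n + 1 : ℂ) * y)))) (Ioi 0) := fun n =>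
    (integrableOn_cpow_mul_exp h0 (by
      have : ((n : ℂ) + 1).re = n + 1 := by simp
      rw [this]; positivity)).const_mul _
  have hsum : Summable fun n : ℕ => ∫ y in Ioi (0 : ℝ), ‖(n + 1 : ℂ) * Complex.exp ((n + 1) * x) *
      ((y : ℂ) ^ (s + 1 - 1) * Complex.exp (-((n + 1 : ℂ) * y)))‖ := by
    have hval : ∀ n : ℕ, ∫ y in Ioi (0 : ℝ), ‖(n + 1 : ℂ) * Complex.exp ((n + 1) * x) *
        ((y : ℂ) ^ (s + 1 - 1) * Complex.exp (-((n + 1 : ℂ) * y)))‖ =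
        (n + 1) * Real.exp ((n + 1) * x) * ((1 / (n + 1)) ^ (s + 1).re * Real.Gamma (s + 1).re) := by
      intro n
      have hn : (0 : ℝ) < n + 1 := by positivity
      rw [← Real.integral_rpow_mul_exp_neg_mul_Ioi h0 hn, ← integral_const_mul]
      refine setIntegral_congr_fun measurableSet_Ioi fun y hy => ?_
      rw [norm_mul, norm_cpow_mul_exp hy, norm_mul, Complex.norm_exp]
      have e1 : ‖(n : ℂ) + 1‖ = n + 1 := by
        rw [show (n : ℂ) + 1 = ((n + 1 : ℝ) : ℂ) by push_cast; ring, Complex.norm_real,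
          Real.norm_of_nonneg hn.le]
      have e2 : (((n : ℂ) + 1) * x).re = (n + 1) * x := by simp
      have e3 : ((n : ℂ) + 1).re = n + 1 := by simp
      rw [e1, e2, e3]
    simp only [hval]
    have hg : Summable fun n : ℕ => ((n : ℝ) ^ 1 * Real.exp x ^ n) :=
      summable_pow_mul_geometric_of_norm_lt_one 1 (by
        rw [Real.norm_of_nonneg (Real.exp_pos _).le]; exact Real.exp_lt_one_iff.2 hx)
    have hg' := ((summable_nat_add_iff 1).2 hg).mul_right (Real.Gamma (s + 1).re)
    refine Summable.of_nonneg_of_le (fun n => ?_) (fun n => ?_) hg'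
    · have := (Real.Gamma_pos_of_pos h0).le
      positivity
    · have h3 : (1 / ((n : ℝ) + 1)) ^ (s + 1).re ≤ 1 :=
        Real.rpow_le_one (by positivity) (by
          rw [div_le_one (by positivity)]; linarith [n.cast_nonneg (α := ℝ)]) h0.le
      have h4 := (Real.Gamma_pos_of_pos h0).le
      rw [← Real.exp_nat_mul, pow_one]
      push_cast
      gcongr
      exact mul_le_of_le_one_left h4 h3
  have h := (hasSum_integral_of_summable_integral_norm hint hsum).mul_left
    (Complex.Gamma (s + 1))⁻¹
  convert! h using 1
  · funext n
    have hn : (0 : ℝ) < n + 1 := by positivity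
    have hn1 : (n : ℂ) + 1 ≠ 0 := by exact_mod_cast hn.ne'
    rw [integral_const_mul, integral_cpow_mul_exp h0 (by simpa using hn), liTerm, neg_add,
      Complex.cpow_add _ _ hn1, Complex.cpow_neg, Complex.cpow_neg_one]
    field_simp
  · congr 1
    refine setIntegral_congr_fun measurableSet_Ioi fun y hy => ?_
    have hy0 : (0 : ℝ) < y := hy
    have hq : ‖Complex.exp ((x : ℂ) - y)‖ < 1 := by
      rw [Complex.norm_exp]
      exact Real.exp_lt_one_iff.2 (by simp; linarith)
    have h5 := hasSum_coe_mul_geometric_of_norm_lt_one hq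
    have h6 := ((hasSum_nat_add_iff' 1).2 h5).tsum_eq
    simp only [Finset.range_one, Finset.sum_singleton, Nat.cast_zero, zero_mul, sub_zero] at h6
    rw [boseDeriv, ← h6, ← tsum_mul_left]
    refine tsum_congr fun n => ?_
    rw [← Complex.exp_nat_mul, add_sub_cancel_right]
    push_cast
    rw [show ((n : ℂ) + 1) * (x - y) = (n + 1) * x + -((n + 1) * y) by ring, Complex.exp_add]
    ring

end

/-! ### The Lipschitz sum without its singular term -/

/-- The terms of the Lipschitz sum, without the one at `m = 0`. -/
noncomputable def tailTerm (s z : ℂ) (m : ℤ) : ℂ := if m = 0 then 0 else node z m ^ (s - 1)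

/-- The sum of `(-z - 2πim)^{s-1}` over the nonzero integers `m`. -/
noncomputable def lipTail (s z : ℂ) : ℂ := ∑' m : ℤ, tailTerm s z m

/-- For |Im z| ≤ 1 the imaginary part is at least 2π|m| - 1 ≥ |m|. Hence the terms with m ≠ 0 stay
off the branch cut and are uniformly controlled in a strip around the real axis. -/
theorem abs_le_abs_node_im {z : ℂ} (hz : |z.im| ≤ 1) {m : ℤ} (hm : m ≠ 0) :
    |(m : ℝ)| ≤ |(node z m).im| := by
  have h1 : (1 : ℝ) ≤ |(m : ℝ)| := by exact_mod_cast Int.one_le_abs hm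
  rw [node_im]
  have h2 : |2 * Real.pi * (m : ℝ)| = 2 * Real.pi * |(m : ℝ)| := by
    rw [abs_mul, abs_of_pos Real.two_pi_pos]
  have h3 : |2 * Real.pi * (m : ℝ)| ≤ |-z.im - 2 * Real.pi * m| + |z.im| := by
    have := abs_sub (-z.im - 2 * Real.pi * m) (-z.im)
    rwa [show -z.im - 2 * Real.pi * m - -z.im = -(2 * Real.pi * m) by ring, abs_neg,
      abs_neg] at this
  nlinarith [Real.pi_gt_three]

theorem node_mem_slitPlane_of_ne {z : ℂ} (hz : |z.im| ≤ 1) {m : ℤ} (hm : m ≠ 0) :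
    node z m ∈ Complex.slitPlane := by
  have h1 : (1 : ℝ) ≤ |(m : ℝ)| := by exact_mod_cast Int.one_le_abs hm
  exact Or.inr (abs_pos.1 (by linarith [abs_le_abs_node_im hz hm]))

theorem norm_tailTerm_le {s z : ℂ} {σ T : ℝ} (hσ : s.re ≤ σ) (hσ1 : σ < 1) (hT : |s.im| ≤ T)
    (hz : |z.im| ≤ 1) (m : ℤ) :
    ‖tailTerm s z m‖ ≤ Real.exp (Real.pi * T) * |(m : ℝ)| ^ (-(1 - σ)) := by
  unfold tailTerm
  split_ifs with hm
  · rw [norm_zero]; positivity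
  have h1 : (1 : ℝ) ≤ |(m : ℝ)| := by exact_mod_cast Int.one_le_abs hm
  have h2 : |(m : ℝ)| ≤ ‖node z m‖ :=
    (abs_le_abs_node_im hz hm).trans (Complex.abs_im_le_norm _)
  refine (Complex.norm_cpow_le _ _).trans ?_
  rw [div_eq_mul_inv, ← Real.exp_neg, mul_comm]
  have h3 : -(Complex.arg (node z m) * (s - 1).im) ≤ Real.pi * T := by
    refine (neg_le_abs _).trans ?_
    rw [abs_mul, Complex.sub_im, Complex.one_im, sub_zero]
    exact mul_le_mul (Complex.abs_arg_le_pi _) hT (abs_nonneg _) Real.pi_pos.le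
  have h4 : ‖node z m‖ ^ (s - 1).re ≤ |(m : ℝ)| ^ (-(1 - σ)) := by
    rw [Complex.sub_re, Complex.one_re]
    calc _ ≤ |(m : ℝ)| ^ (s.re - 1) :=
          Real.rpow_le_rpow_of_nonpos (by linarith) h2 (by linarith)
      _ ≤ _ := Real.rpow_le_rpow_of_exponent_le h1 (by linarith)
  gcongr

theorem summable_tail_bound {σ : ℝ} (hσ : σ < 0) (T : ℝ) :
    Summable fun m : ℤ => Real.exp (Real.pi * T) * |(m : ℝ)| ^ (-(1 - σ)) :=
  (Real.summable_abs_int_rpow (by linarith)).mul_left _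

theorem norm_lipTail_le {s z : ℂ} {σ T : ℝ} (hs : s.re ≤ σ) (hσ : σ < 0) (hT : |s.im| ≤ T)
    (hz : |z.im| ≤ 1) :
    ‖lipTail s z‖ ≤ ∑' m : ℤ, Real.exp (Real.pi * T) * |(m : ℝ)| ^ (-(1 - σ)) :=
  tsum_of_norm_bounded (summable_tail_bound hσ T).hasSum
    (norm_tailTerm_le hs (by linarith) hT hz)

theorem summable_tailTerm {s z : ℂ} (hs : s.re < 0) (hz : |z.im| ≤ 1) :
    Summable (tailTerm s z) :=
  Summable.of_norm_bounded (summable_tail_bound hs |s.im|)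
    (norm_tailTerm_le le_rfl (by linarith) le_rfl hz)

/-- A neighbourhood on which the Lipschitz sum converges uniformly. -/
theorem exists_uniform_nhds {s₀ : ℂ} (hs₀ : s₀.re < 0) : ∃ σ T : ℝ, σ < 0 ∧
    IsOpen {s : ℂ | s.re < σ ∧ |s.im| < T} ∧ s₀ ∈ {s : ℂ | s.re < σ ∧ |s.im| < T} := by
  refine ⟨s₀.re / 2, |s₀.im| + 1, by linarith, ?_, ?_⟩
  · exact (isOpen_lt Complex.continuous_re continuous_const).inter
      (isOpen_lt Complex.continuous_im.abs continuous_const)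
  · exact ⟨by linarith, by linarith⟩

theorem differentiableOn_lipTail {z : ℂ} (hz : |z.im| ≤ 1) :
    DifferentiableOn ℂ (fun s => lipTail s z) {s | s.re < 0} := by
  intro s₀ hs₀
  obtain ⟨σ, T, hσ, hV, hmem⟩ := exists_uniform_nhds hs₀
  refine DifferentiableAt.differentiableWithinAt ?_
  refine DifferentiableOn.differentiableAt (s := {s : ℂ | s.re < σ ∧ |s.im| < T}) ?_
    (hV.mem_nhds hmem)
  refine Complex.differentiableOn_tsum_of_summable_norm (summable_tail_bound hσ T)
    (fun m => ?_) hV fun m s hs => norm_tailTerm_le hs.1.le (by linarith) hs.2.le hz m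
  by_cases hm : m = 0
  · simp [tailTerm, hm]
  · simp only [tailTerm, hm, if_false]
    intro s _
    have := Complex.slitPlane_ne_zero (node_mem_slitPlane_of_ne hz hm)
    exact ((differentiableAt_id.sub_const 1).const_cpow (Or.inl this)).differentiableWithinAt

theorem continuousOn_lipTail :
    ContinuousOn (fun p : ℂ × ℂ => lipTail p.1 p.2) ({s | s.re < 0} ×ˢ {z | |z.im| < 1}) := by
  rintro ⟨s₀, z₀⟩ ⟨hs₀, hz₀⟩
  obtain ⟨σ, T, hσ, hV, hmem⟩ := exists_uniform_nhds hs₀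
  have hW : IsOpen {z : ℂ | |z.im| < 1} := isOpen_lt Complex.continuous_im.abs continuous_const
  refine ContinuousAt.continuousWithinAt ?_
  refine ContinuousOn.continuousAt (s := {s : ℂ | s.re < σ ∧ |s.im| < T} ×ˢ {z | |z.im| < 1}) ?_
    ((hV.prod hW).mem_nhds ⟨hmem, hz₀⟩)
  refine continuousOn_tsum (fun m => ?_) (summable_tail_bound hσ T) fun m p hp =>
    norm_tailTerm_le hp.1.1.le (by linarith) hp.1.2.le (le_of_lt hp.2) m
  by_cases hm : m = 0
  · simp only [tailTerm, hm, if_true]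
    exact continuousOn_const
  · simp only [tailTerm, hm, if_false]
    rintro p ⟨-, hp⟩
    refine ContinuousAt.continuousWithinAt (ContinuousAt.cpow ?_ (by fun_prop)
      (node_mem_slitPlane_of_ne (le_of_lt hp) hm))
    unfold node
    fun_prop

/-- Termwise differentiation. The relation between s and s - 1 is what drives the continuation of
the tail to Re s ≥ 0. -/
theorem hasDerivAt_lipTail {s : ℂ} (hs : s.re < 0) (x : ℝ) :
    HasDerivAt (fun x : ℝ => lipTail s x) ((1 - s) * lipTail (s - 1) x) x := by
  have hs1 : (s - 1).re < 0 := by simp; linarith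
  have him : ∀ x : ℝ, |(x : ℂ).im| ≤ 1 := fun x => by simp
  have h := hasDerivAt_tsum (g := fun (m : ℤ) (x : ℝ) => tailTerm s x m)
    (g' := fun m x => (1 - s) * tailTerm (s - 1) x m)
    ((summable_tail_bound hs1 |(s - 1).im|).mul_left ‖1 - s‖) (fun m x => ?_) (fun m x => ?_)
    (summable_tailTerm hs (him 0)) x
  · rwa [tsum_mul_left] at h
  · by_cases hm : m = 0
    · simp only [tailTerm, hm, if_true, mul_zero]
      exact hasDerivAt_const x 0
    · simp only [tailTerm, hm, if_false]
      have h1 : HasDerivAt (fun z : ℂ => node z m) (-1) (x : ℂ) := by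
        unfold node
        exact (hasDerivAt_neg (x : ℂ)).sub_const _
      have h2 := (h1.cpow_const (c := s - 1)
        (node_mem_slitPlane_of_ne (him x) hm)).comp_ofReal
      refine h2.congr_deriv ?_
      ring
  · rw [norm_mul]
    gcongr
    exact norm_tailTerm_le le_rfl (by linarith) le_rfl (him x) m

/-! ### The polylogarithm series -/

theorem norm_liTerm_le {s : ℂ} {N : ℕ} (hs : -(N : ℝ) ≤ s.re) {δ x : ℝ} (hx : x ≤ -δ) (n : ℕ) :
    ‖liTerm s x n‖ ≤ ((n + 1 : ℕ) : ℝ) ^ N * Real.exp (-δ) ^ (n + 1) := by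
  have hn : (0 : ℝ) < n + 1 := by positivity
  have hn1 : (n : ℂ) + 1 = ((n + 1 : ℝ) : ℂ) := by push_cast; ring
  rw [liTerm, norm_div, Complex.norm_exp, hn1, Complex.norm_cpow_eq_rpow_re_of_pos hn,
    div_eq_mul_inv, ← Real.rpow_neg hn.le, ← Real.exp_nat_mul, mul_comm]
  have h1 : ((n : ℝ) + 1) ^ (-s.re) ≤ ((n + 1 : ℕ) : ℝ) ^ N := by
    rw [← Real.rpow_natCast]
    push_cast
    exact Real.rpow_le_rpow_of_exponent_le (by linarith [n.cast_nonneg (α := ℝ)]) (by linarith)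
  have h2 : ((((n + 1 : ℝ) : ℂ)) * (x : ℂ)).re ≤ ((n + 1 : ℕ) : ℝ) * -δ := by
    rw [← Complex.ofReal_mul, Complex.ofReal_re]
    push_cast
    gcongr
  gcongr

theorem summable_liTerm_bound (N : ℕ) {δ : ℝ} (hδ : 0 < δ) :
    Summable fun n : ℕ => ((n + 1 : ℕ) : ℝ) ^ N * Real.exp (-δ) ^ (n + 1) := by
  have h : Summable fun n : ℕ => ((n : ℝ) ^ N * Real.exp (-δ) ^ n) :=
    summable_pow_mul_geometric_of_norm_lt_one N (by
      rw [Real.norm_of_nonneg (Real.exp_pos _).le]; exact Real.exp_lt_one_iff.2 (by linarith))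
  exact (summable_nat_add_iff (f := fun n : ℕ => ((n : ℝ) ^ N * Real.exp (-δ) ^ n)) 1).2 h

theorem summable_liTerm (s : ℂ) {x : ℝ} (hx : x < 0) : Summable (liTerm s x) := by
  obtain ⟨N, hN⟩ := exists_nat_ge (-s.re)
  exact Summable.of_norm_bounded (summable_liTerm_bound N (δ := -x) (by linarith))
    (norm_liTerm_le (by linarith) (by simp))

theorem norm_liSeries_le {s : ℂ} {N : ℕ} (hs : -(N : ℝ) ≤ s.re) {δ x : ℝ} (hδ : 0 < δ)
    (hx : x ≤ -δ) :
    ‖liSeries s x‖ ≤ ∑' n : ℕ, ((n + 1 : ℕ) : ℝ) ^ N * Real.exp (-δ) ^ (n + 1) :=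
  tsum_of_norm_bounded (summable_liTerm_bound N hδ).hasSum (norm_liTerm_le hs hx)

theorem differentiable_liSeries {x : ℝ} (hx : x < 0) :
    Differentiable ℂ (fun s => liSeries s x) := by
  intro s₀
  obtain ⟨N, hN⟩ := exists_nat_gt (-s₀.re)
  have hV : IsOpen {s : ℂ | -(N : ℝ) < s.re} := isOpen_lt continuous_const Complex.continuous_re
  refine DifferentiableOn.differentiableAt (s := {s : ℂ | -(N : ℝ) < s.re}) ?_
    (hV.mem_nhds (show -(N : ℝ) < s₀.re by linarith))
  refine Complex.differentiableOn_tsum_of_summable_norm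
    (summable_liTerm_bound N (δ := -x) (by linarith)) (fun n s _ => ?_) hV
    fun n s hs => norm_liTerm_le (le_of_lt hs) (by simp) n
  have hn : ((n : ℂ) + 1) ≠ 0 := by exact_mod_cast n.succ_ne_zero
  have hd : DifferentiableAt ℂ (fun s : ℂ => ((n : ℂ) + 1) ^ s) s :=
    differentiableAt_id.const_cpow (Or.inl hn)
  unfold liTerm
  refine DifferentiableAt.differentiableWithinAt (DifferentiableAt.div (by fun_prop) hd ?_)
  simp [Complex.cpow_eq_zero_iff, hn]

/-- Near x < 0 the series converges uniformly for complex argument with Re z < x/2, so its sum is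
holomorphic there and smooth on the real axis. -/
theorem contDiffOn_liSeries (s : ℂ) : ContDiffOn ℝ ∞ (liSeries s) (Iio 0) := by
  have hd : ∀ x : ℝ, x < 0 → ContDiffAt ℝ ∞ (liSeries s) x := by
    intro x hx
    obtain ⟨N, hN⟩ := exists_nat_ge (-s.re)
    have hV : IsOpen {z : ℂ | z.re < x / 2} := isOpen_lt Complex.continuous_re continuous_const
    have hdiff : DifferentiableOn ℂ
        (fun z => ∑' n : ℕ, Complex.exp (((n : ℂ) + 1) * z) / ((n : ℂ) + 1) ^ s)
        {z | z.re < x / 2} := by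
      refine Complex.differentiableOn_tsum_of_summable_norm
        (summable_liTerm_bound N (δ := -(x / 2)) (by linarith)) (fun n => by fun_prop) hV
        fun n z hz => ?_
      have h1 := norm_liTerm_le (s := s) (N := N) (by linarith) (δ := -(x / 2)) (x := z.re)
        (by rw [neg_neg]; exact le_of_lt hz) n
      refine le_trans (le_of_eq ?_) h1
      rw [liTerm, norm_div, norm_div, Complex.norm_exp, Complex.norm_exp]
      simp
    have hc : ContDiffAt ℂ ∞
        (fun z => ∑' n : ℕ, Complex.exp (((n : ℂ) + 1) * z) / ((n : ℂ) + 1) ^ s) (x : ℂ) :=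
      (hdiff.analyticAt (hV.mem_nhds (by simp; linarith))).contDiffAt
    exact (hc.restrict_scalars ℝ).comp x Complex.ofRealCLM.contDiff.contDiffAt
  exact fun x hx => (hd x hx).contDiffWithinAt

/-- Both expansions represent the same Mellin integral at z = -1. There the singular term (-z)^{s-1}
is 1, which makes -1 a convenient base point. -/
theorem liSeries_neg_one_of_re_mem {s : ℂ} (hs : -1 < s.re) (hs0 : s.re < 0) :
    liSeries s (-1) = Complex.Gamma (1 - s) * (1 + lipTail s ((-1 : ℝ) : ℂ)) := by
  have h1 := (hasSum_liTerm hs (show (-1 : ℝ) < 0 by norm_num)).tsum_eq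
  have h2 := (integral_cpow_mul_boseDeriv hs hs0 (z := ((-1 : ℝ) : ℂ))
    (fun m => node_ofReal_mem_slitPlane (Or.inl (by norm_num)))).tsum_eq
  rw [liSeries, h1, ← h2, tsum_mul_left]
  congr 1
  have hsum : Summable fun m : ℤ => node ((-1 : ℝ) : ℂ) m ^ (s - 1) := by
    have h3 := (summable_tailTerm hs0 (z := ((-1 : ℝ) : ℂ)) (by simp))
    refine h3.congr_cofinite ?_
    filter_upwards [(Set.finite_singleton (0 : ℤ)).compl_mem_cofinite] with m hm
    simp [tailTerm, show m ≠ 0 from hm]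
  rw [hsum.tsum_eq_add_tsum_ite 0, lipTail]
  congr 1
  simp [node]

/-! ### Continuation in s of the nonsingular part -/

/-- The value at `-1` of the family `regPart`. -/
noncomputable def regBase (s : ℂ) : ℂ := liSeries s (-1) * (Complex.Gamma (1 - s))⁻¹ - 1

theorem differentiable_regBase : Differentiable ℂ regBase := by
  have h1 := differentiable_liSeries (show (-1 : ℝ) < 0 by norm_num)
  have h2 : Differentiable ℂ fun s : ℂ => (Complex.Gamma (1 - s))⁻¹ :=
    Complex.differentiable_one_div_Gamma.comp (differentiable_const (1 : ℂ) |>.sub differentiable_id)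
  exact (h1.mul h2).sub_const 1

theorem isOpen_re_neg : IsOpen {s : ℂ | s.re < 0} := isOpen_lt Complex.continuous_re continuous_const

/-- The two expansions give this on the strip, and the identity theorem on the half-plane Re s < 0.
The right side is entire in s, hence supplies the constant of integration for every s. -/
theorem lipTail_neg_one {s : ℂ} (hs : s.re < 0) : lipTail s ((-1 : ℝ) : ℂ) = regBase s := by
  refine ((differentiableOn_lipTail (z := ((-1 : ℝ) : ℂ)) (by simp)).analyticOnNhd
    isOpen_re_neg).eqOn_of_preconnected_of_eventuallyEq
    (differentiable_regBase.differentiableOn.analyticOnNhd isOpen_re_neg)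
    (convex_halfSpace_re_lt 0).isPreconnected (z₀ := (-1 / 2 : ℂ)) (by norm_num) ?_ hs
  have hV : IsOpen {s : ℂ | -1 < s.re ∧ s.re < 0} :=
    (isOpen_lt continuous_const Complex.continuous_re).inter isOpen_re_neg
  filter_upwards [hV.mem_nhds (show (-1 / 2 : ℂ) ∈ _ by constructor <;> norm_num)] with s hs
  have hΓ : Complex.Gamma (1 - s) ≠ 0 :=
    Complex.Gamma_ne_zero_of_re_pos (by simp; linarith [hs.2])
  rw [regBase, liSeries_neg_one_of_re_mem hs.1 hs.2]
  field_simp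
  ring

/-- Successive continuations in `s` of the Lipschitz sum without its singular term, each obtained
from the previous one by integration in `x`. -/
noncomputable def regPartAux : ℕ → ℂ → ℝ → ℂ
  | 0 => fun s x => lipTail s x
  | n + 1 => fun s x => regBase s + (1 - s) * ∫ y in (-1 : ℝ)..x, regPartAux n (s - 1) y

theorem regPartAux_succ (n : ℕ) (s : ℂ) (x : ℝ) : regPartAux (n + 1) s x =
    regBase s + (1 - s) * ∫ y in (-1 : ℝ)..x, regPartAux n (s - 1) y := rfl

/-- Locally uniform polynomial growth in `x` of a family depending on `s`. -/
def PolyBoundedNear (Q : ℂ → ℝ → ℂ) (s₀ : ℂ) : Prop :=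
  ∃ V ∈ 𝓝 s₀, ∃ (C : ℝ) (m : ℕ), 0 ≤ C ∧ ∀ s ∈ V, ∀ x : ℝ, ‖Q s x‖ ≤ C * (1 + |x|) ^ m

theorem polyBoundedNear_lipTail {s₀ : ℂ} (hs₀ : s₀.re < 0) :
    PolyBoundedNear (fun s x => lipTail s x) s₀ := by
  obtain ⟨σ, T, hσ, hV, hmem⟩ := exists_uniform_nhds hs₀
  refine ⟨_, hV.mem_nhds hmem, ∑' m : ℤ, Real.exp (Real.pi * T) * |(m : ℝ)| ^ (-(1 - σ)), 0,
    tsum_nonneg fun m => by positivity, fun s hs x => ?_⟩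
  rw [pow_zero, mul_one]
  exact norm_lipTail_le hs.1.le hσ hs.2.le (by simp)

/-- Each integration in x raises the degree of growth by one. The bound dominates the integral when
differentiating in s, and later makes the pairing with Schwartz functions converge. -/
theorem polyBoundedNear_succ {n : ℕ} {s₀ : ℂ} (h : PolyBoundedNear (regPartAux n) (s₀ - 1)) :
    PolyBoundedNear (regPartAux (n + 1)) s₀ := by
  obtain ⟨V, hV, C, m, hC, hb⟩ := h
  have hV' : (fun s : ℂ => s - 1) ⁻¹' V ∈ 𝓝 s₀ :=
    (continuous_id.sub continuous_const).continuousAt.preimage_mem_nhds hV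
  have h1 := differentiable_regBase.continuous.norm.continuousAt.eventually_lt_const
    (lt_add_one ‖regBase s₀‖)
  have h2 : ∀ᶠ s in 𝓝 s₀, ‖1 - s‖ < ‖1 - s₀‖ + 1 :=
    ((continuous_const.sub continuous_id).norm.continuousAt).eventually_lt_const
      (lt_add_one ‖1 - s₀‖)
  refine ⟨_, Filter.inter_mem hV' (h1.and h2),
    (‖regBase s₀‖ + 1) + (‖1 - s₀‖ + 1) * (C * 2 ^ m), m + 1, by positivity, ?_⟩
  rintro s ⟨hs, hs1, hs2⟩ x
  have hx1 : 1 ≤ 1 + |x| := by linarith [abs_nonneg x]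
  have h3 : ‖∫ y in (-1 : ℝ)..x, regPartAux n (s - 1) y‖ ≤ C * 2 ^ m * (1 + |x|) ^ m * |x - -1| := by
    refine intervalIntegral.norm_integral_le_of_norm_le_const fun y hy => ?_
    refine (hb (s - 1) hs y).trans ?_
    rw [mul_assoc, ← mul_pow]
    have hy1 : |y| ≤ 1 + |x| := by
      rcases le_total (-1 : ℝ) x with h | h
      · rw [uIoc_of_le h] at hy
        exact abs_le.2 ⟨by linarith [hy.1, abs_nonneg x], by linarith [hy.2, le_abs_self x]⟩
      · rw [uIoc_of_ge h] at hy
        exact abs_le.2 ⟨by linarith [hy.1, neg_abs_le x], by linarith [hy.2, abs_nonneg x]⟩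
    gcongr
    linarith
  have h4 : |x - -1| ≤ 1 + |x| := by
    rw [sub_neg_eq_add, add_comm]
    exact (abs_add_le 1 x).trans (by simp)
  have h5 : (1 : ℝ) ≤ (1 + |x|) ^ (m + 1) := one_le_pow₀ hx1
  calc ‖regPartAux (n + 1) s x‖
      ≤ ‖regBase s‖ + ‖1 - s‖ * ‖∫ y in (-1 : ℝ)..x, regPartAux n (s - 1) y‖ := by
        rw [← norm_mul]; exact norm_add_le _ _
    _ ≤ (‖regBase s₀‖ + 1) * (1 + |x|) ^ (m + 1) +
        (‖1 - s₀‖ + 1) * (C * 2 ^ m * (1 + |x|) ^ m * (1 + |x|)) := by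
        refine add_le_add ?_ ?_
        · exact hs1.le.trans (le_mul_of_one_le_right (by positivity) h5)
        · refine mul_le_mul hs2.le (h3.trans ?_) (norm_nonneg _) (by positivity)
          gcongr
    _ = _ := by ring

theorem polyBoundedNear_regPartAux (n : ℕ) : ∀ {s₀ : ℂ}, s₀.re < n →
    PolyBoundedNear (regPartAux n) s₀ := by
  induction n with
  | zero => exact fun h => polyBoundedNear_lipTail (by simpa using h)
  | succ n ih =>
    exact fun h => polyBoundedNear_succ (ih (by simp only [Complex.sub_re, Complex.one_re]; push_cast at h; linarith))

theorem sub_one_re_lt {n : ℕ} {s : ℂ} (h : s.re < (n + 1 : ℕ)) : (s - 1).re < n := by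
  simp only [Complex.sub_re, Complex.one_re]
  push_cast at h
  linarith

theorem continuousOn_regPartAux (n : ℕ) :
    ContinuousOn (fun p : ℂ × ℝ => regPartAux n p.1 p.2) ({s : ℂ | s.re < (n : ℝ)} ×ˢ univ) := by
  induction n with
  | zero =>
    refine continuousOn_lipTail.comp (f := fun p : ℂ × ℝ => (p.1, (p.2 : ℂ))) (by fun_prop) ?_
    rintro ⟨s, x⟩ ⟨hs, -⟩
    exact ⟨by simpa using hs, by simp⟩
  | succ n ih =>
    have h1 : Continuous fun q : ({s : ℂ | s.re < ((n + 1 : ℕ) : ℝ)} ×ˢ (univ : Set ℝ) : Set (ℂ × ℝ)) =>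
        ∫ y in (-1 : ℝ)..q.1.2, regPartAux n (q.1.1 - 1) y := by
      refine intervalIntegral.continuous_parametric_intervalIntegral_of_continuous
        (f := fun (q : ({s : ℂ | s.re < ((n + 1 : ℕ) : ℝ)} ×ˢ (univ : Set ℝ) : Set (ℂ × ℝ))) y =>
          regPartAux n (q.1.1 - 1) y) ?_ (by fun_prop)
      refine ih.comp_continuous (f := fun q : ({s : ℂ | s.re < ((n + 1 : ℕ) : ℝ)} ×ˢ
        (univ : Set ℝ) : Set (ℂ × ℝ)) × ℝ => (q.1.1.1 - 1, q.2)) (by fun_prop) ?_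
      rintro ⟨⟨q, hq⟩, y⟩
      exact ⟨sub_one_re_lt hq.1, mem_univ _⟩
    have h2 : ContinuousOn (fun p : ℂ × ℝ => ∫ y in (-1 : ℝ)..p.2, regPartAux n (p.1 - 1) y)
        ({s : ℂ | s.re < ((n + 1 : ℕ) : ℝ)} ×ˢ univ) := by
      exact continuousOn_iff_continuous_domRestrict.2 h1
    have h3 := differentiable_regBase.continuous
    exact ((h3.comp continuous_fst).continuousOn).add
      (ContinuousOn.mul (by fun_prop) h2)

theorem continuous_regPartAux {n : ℕ} {s : ℂ} (hs : s.re < n) : Continuous (regPartAux n s) :=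
  (continuousOn_regPartAux n).comp_continuous (f := fun x : ℝ => (s, x)) (by fun_prop)
    fun _ => ⟨hs, mem_univ _⟩

theorem isOpen_re_lt (c : ℝ) : IsOpen {s : ℂ | s.re < c} :=
  isOpen_lt Complex.continuous_re continuous_const

theorem differentiableOn_regPartAux (n : ℕ) : ∀ x : ℝ,
    DifferentiableOn ℂ (fun s => regPartAux n s x) {s | s.re < n} := by
  induction n with
  | zero =>
    intro x
    have h := differentiableOn_lipTail (z := (x : ℂ)) (by simp)
    simpa [regPartAux] using h
  | succ n ih =>
    intro x
    refine differentiable_regBase.differentiableOn.add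
      (DifferentiableOn.mul (by fun_prop) ?_)
    simp only [intervalIntegral.intervalIntegral_eq_integral_uIoc]
    refine DifferentiableOn.const_smul ?_ _
    refine differentiableOn_integral_of_dominated (isOpen_re_lt _) (fun s hs => ?_)
      (ae_of_all _ fun y => ?_) fun s₀ hs₀ => ?_
    · exact (continuous_regPartAux (sub_one_re_lt hs)).aestronglyMeasurable
    · exact (ih y).comp (f := fun s : ℂ => s - 1) (by fun_prop) fun s hs => sub_one_re_lt hs
    · obtain ⟨V, hV, C, m, hC, hb⟩ := polyBoundedNear_regPartAux n (sub_one_re_lt hs₀)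
      refine ⟨(fun s : ℂ => s - 1) ⁻¹' V,
        (continuous_id.sub continuous_const).continuousAt.preimage_mem_nhds hV,
        fun y => C * (1 + |y|) ^ m, ?_, ae_of_all _ fun y s hs => hb _ hs y⟩
      rw [← IntegrableOn, ← intervalIntegrable_iff]
      exact Continuous.intervalIntegrable (by fun_prop) _ _

theorem hasDerivAt_regPartAux_succ {n : ℕ} {s : ℂ} (hs : s.re < (n + 1 : ℕ)) (x : ℝ) :
    HasDerivAt (regPartAux (n + 1) s) ((1 - s) * regPartAux n (s - 1) x) x := by
  have h := (continuous_regPartAux (sub_one_re_lt hs)).integral_hasStrictDerivAt (-1) x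
  exact (h.hasDerivAt.const_mul (1 - s)).const_add (regBase s)

/-- At the first stage, `hasDerivAt_lipTail` and the fundamental theorem of calculus recover the
tail from its derivative, the constant being right by `lipTail_neg_one`. Later stages inherit the
agreement under the integral. -/
theorem regPartAux_succ_eq (n : ℕ) : ∀ {s : ℂ}, s.re < n → ∀ x : ℝ,
    regPartAux (n + 1) s x = regPartAux n s x := by
  induction n with
  | zero =>
    intro s hs x
    have hs' : s.re < 0 := by simpa using hs
    have hs1 : (s - 1).re < 0 := by simp; linarith
    have h := intervalIntegral.integral_eq_sub_of_hasDerivAt (a := (-1 : ℝ)) (b := x)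
      (fun y _ => hasDerivAt_lipTail hs' y)
      ((continuous_regPartAux (n := 0) (s := s - 1) (by simpa using hs1)).const_smul (1 - s)
        |>.intervalIntegrable _ _)
    rw [intervalIntegral.integral_const_mul] at h
    simp only [regPartAux]
    rw [h, lipTail_neg_one hs']
    ring
  | succ n ih =>
    intro s hs x
    simp only [regPartAux_succ (n + 1), regPartAux_succ n s x]
    rw [intervalIntegral.integral_congr fun y _ => ih (sub_one_re_lt hs) y]

theorem regPartAux_eq_of_le {n m : ℕ} (h : n ≤ m) {s : ℂ} (hs : s.re < n) (x : ℝ) :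
    regPartAux m s x = regPartAux n s x := by
  induction m, h using Nat.le_induction with
  | base => rfl
  | succ m hm ih =>
    rw [regPartAux_succ_eq m (hs.trans_le (by exact_mod_cast hm)), ih]

/-- The continuation to all `s` of the Lipschitz sum without its singular term. -/
noncomputable def regPart (s : ℂ) (x : ℝ) : ℂ := regPartAux (⌊s.re⌋₊ + 1) s x

theorem regPart_eq {n : ℕ} {s : ℂ} (hs : s.re < n) (x : ℝ) : regPart s x = regPartAux n s x := by
  have h := Nat.lt_floor_add_one s.re
  rcases le_total n (⌊s.re⌋₊ + 1) with hn | hn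
  · exact regPartAux_eq_of_le hn hs x
  · exact (regPartAux_eq_of_le hn (by exact_mod_cast h) x).symm

theorem regPart_eq_lipTail {s : ℂ} (hs : s.re < 0) (x : ℝ) : regPart s x = lipTail s x :=
  regPart_eq (n := 0) (by simpa using hs) x

theorem differentiable_regPart (x : ℝ) : Differentiable ℂ fun s => regPart s x := by
  intro s₀
  obtain ⟨n, hn⟩ := exists_nat_gt s₀.re
  exact ((differentiableOn_regPartAux n x).congr fun s hs => regPart_eq hs x).differentiableAt
    ((isOpen_re_lt n).mem_nhds hn)

theorem continuous_regPart : Continuous fun p : ℂ × ℝ => regPart p.1 p.2 := by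
  refine continuous_iff_continuousAt.2 fun p => ?_
  obtain ⟨n, hn⟩ := exists_nat_gt p.1.re
  exact ((continuousOn_regPartAux n).congr fun q hq => regPart_eq hq.1 q.2).continuousAt
    (((isOpen_re_lt n).prod isOpen_univ).mem_nhds ⟨hn, mem_univ _⟩)

theorem hasDerivAt_regPart (s : ℂ) (x : ℝ) :
    HasDerivAt (regPart s) ((1 - s) * regPart (s - 1) x) x := by
  obtain ⟨n, hn⟩ := exists_nat_gt s.re
  have h1 : s.re < (n + 1 : ℕ) := by push_cast; linarith
  rw [regPart_eq (sub_one_re_lt h1), show regPart s = regPartAux (n + 1) s from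
    funext (regPart_eq h1)]
  exact hasDerivAt_regPartAux_succ h1 x

theorem polyBoundedNear_regPart (s₀ : ℂ) : PolyBoundedNear regPart s₀ := by
  obtain ⟨n, hn⟩ := exists_nat_gt s₀.re
  obtain ⟨V, hV, C, m, hC, hb⟩ := polyBoundedNear_regPartAux n hn
  refine ⟨_, inter_mem hV ((isOpen_re_lt n).mem_nhds hn), C, m, hC, fun s hs x => ?_⟩
  rw [regPart_eq hs.2]
  exact hb s hs.1 x

/-! ### The smoothed kernels -/

/-- The left side is the absolute value of the imaginary part of e^z - 1. It keeps the shifted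
kernels away from their poles and supplies their exponential decay. -/
theorem exp_mul_abs_sin_le (z : ℂ) : Real.exp z.re * |Real.sin z.im| ≤ ‖Complex.exp z - 1‖ := by
  have h := Complex.abs_im_le_norm (Complex.exp z - 1)
  rwa [Complex.sub_im, Complex.one_im, sub_zero, Complex.exp_im, abs_mul,
    abs_of_pos (Real.exp_pos _)] at h

theorem exp_ne_one_of_sin_im_ne_zero {z : ℂ} (hz : Real.sin z.im ≠ 0) : Complex.exp z ≠ 1 := by
  intro h
  have h1 := exp_mul_abs_sin_le z
  rw [h, sub_self, norm_zero] at h1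
  have := mul_pos (Real.exp_pos z.re) (abs_pos.2 hz)
  linarith

theorem norm_inv_exp_sub_one_le {z : ℂ} (hz : Real.sin z.im ≠ 0) :
    ‖1 / (Complex.exp z - 1)‖ ≤ |Real.sin z.im|⁻¹ * Real.exp (-z.re) := by
  have h1 := abs_pos.2 hz
  rw [norm_div, norm_one, one_div, Real.exp_neg, ← mul_inv, mul_comm]
  exact inv_anti₀ (by positivity) (exp_mul_abs_sin_le z)

theorem norm_inv_exp_sub_one_le_bose {z : ℂ} (hz : 0 < z.re) :
    ‖1 / (Complex.exp z - 1)‖ ≤ bose z.re := by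
  have h1 : 0 < Real.exp z.re - 1 := sub_pos.2 (Real.one_lt_exp_iff.2 hz)
  rw [norm_div, norm_one, one_div, bose]
  refine inv_anti₀ h1 ?_
  have := norm_sub_norm_le (Complex.exp z) 1
  rwa [Complex.norm_exp, norm_one] at this

theorem inv_exp_neg_sub_one {z : ℂ} (hz : Complex.exp z ≠ 1) :
    1 / (Complex.exp (-z) - 1) = -(1 / (Complex.exp z - 1)) - 1 := by
  have h0 := Complex.exp_ne_zero z
  have h1 : Complex.exp z - 1 ≠ 0 := sub_ne_zero.2 hz
  have h2 : 1 - Complex.exp z ≠ 0 := sub_ne_zero.2 hz.symm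
  rw [Complex.exp_neg]
  field_simp
  ring

theorem norm_boseDeriv_le {z : ℂ} (hz : Real.sin z.im ≠ 0) :
    ‖boseDeriv z‖ ≤ (Real.sin z.im ^ 2)⁻¹ * Real.exp (-|z.re|) := by
  wlog h : 0 ≤ z.re generalizing z
  · have := this (z := -z) (by simpa using hz) (by simp; linarith)
    rw [boseDeriv_neg] at this
    simpa using this
  have h1 := abs_pos.2 hz
  have h2 := exp_mul_abs_sin_le z
  rw [boseDeriv, norm_div, norm_pow, Complex.norm_exp, norm_sub_rev, abs_of_nonneg h,
    div_le_iff₀ (pow_pos (lt_of_lt_of_le (by positivity) h2) 2)]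
  have h3 : Real.exp (-z.re) * Real.exp z.re = 1 := by rw [← Real.exp_add]; simp
  calc Real.exp z.re = (Real.sin z.im ^ 2)⁻¹ * Real.exp (-z.re) *
        (Real.exp z.re * |Real.sin z.im|) ^ 2 := by
        rw [mul_pow, sq_abs]
        field_simp
        linear_combination -h3
    _ ≤ _ := by gcongr

/-- The mean of the two translates of `1 / (e^{-z} - 1)` into the complex domain. -/
noncomputable def smoothKernel (ε t : ℝ) : ℂ :=
  (1 / (Complex.exp (-(t + ε * Complex.I)) - 1) + 1 / (Complex.exp (-(t - ε * Complex.I)) - 1)) / 2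

/-- The mean of the two translates of `1 / (e^z - 1)` into the complex domain. -/
noncomputable def smoothBose (ε t : ℝ) : ℂ :=
  (1 / (Complex.exp (t + ε * Complex.I) - 1) + 1 / (Complex.exp (t - ε * Complex.I) - 1)) / 2

theorem sin_pos_of_mem {ε : ℝ} (hε : ε ∈ Ioo (0 : ℝ) 1) : 0 < Real.sin ε :=
  Real.sin_pos_of_pos_of_lt_pi hε.1 (by linarith [hε.2, Real.pi_gt_three])

theorem smoothKernel_neg (ε t : ℝ) : smoothKernel ε (-t) = smoothBose ε t := by
  rw [smoothKernel, smoothBose, add_comm (1 / (Complex.exp (t + ε * Complex.I) - 1))]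
  congr 6 <;> push_cast <;> ring

theorem smoothKernel_eq {ε : ℝ} (hε : ε ∈ Ioo (0 : ℝ) 1) (t : ℝ) :
    smoothKernel ε t = -smoothBose ε t - 1 := by
  have := sin_pos_of_mem hε
  rw [smoothKernel, smoothBose, inv_exp_neg_sub_one, inv_exp_neg_sub_one]
  · ring
  · exact exp_ne_one_of_sin_im_ne_zero (by simpa using this.ne')
  · exact exp_ne_one_of_sin_im_ne_zero (by simpa using this.ne')

theorem norm_smoothBose_le {ε : ℝ} (hε : ε ∈ Ioo (0 : ℝ) 1) (t : ℝ) :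
    ‖smoothBose ε t‖ ≤ (Real.sin ε)⁻¹ * Real.exp (-t) := by
  have hs := sin_pos_of_mem hε
  have h1 := norm_inv_exp_sub_one_le (z := t + ε * Complex.I) (by simpa using hs.ne')
  have h2 := norm_inv_exp_sub_one_le (z := t - ε * Complex.I) (by simpa using hs.ne')
  simp only [Complex.add_im, Complex.sub_im, Complex.add_re, Complex.sub_re, Complex.ofReal_im,
    Complex.ofReal_re, Complex.mul_re, Complex.mul_im, Complex.I_re, Complex.I_im, mul_zero,
    mul_one, zero_add, add_zero, sub_zero, zero_sub, Real.sin_neg, abs_neg, abs_of_pos hs] at h1 h2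
  rw [smoothBose, norm_div, Complex.norm_ofNat]
  linarith [norm_add_le (1 / (Complex.exp (t + ε * Complex.I) - 1))
    (1 / (Complex.exp (t - ε * Complex.I) - 1))]

theorem norm_smoothBose_le_bose (ε : ℝ) {t : ℝ} (ht : 0 < t) : ‖smoothBose ε t‖ ≤ bose t := by
  have h1 := norm_inv_exp_sub_one_le_bose (z := t + ε * Complex.I) (by simpa using ht)
  have h2 := norm_inv_exp_sub_one_le_bose (z := t - ε * Complex.I) (by simpa using ht)
  simp only [Complex.add_re, Complex.sub_re, Complex.ofReal_im,
    Complex.ofReal_re, Complex.mul_re, Complex.I_re, Complex.I_im, mul_zero,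
    zero_mul, add_zero, sub_zero] at h1 h2
  rw [smoothBose, norm_div, Complex.norm_ofNat]
  linarith [norm_add_le (1 / (Complex.exp (t + ε * Complex.I) - 1))
    (1 / (Complex.exp (t - ε * Complex.I) - 1))]

theorem measurable_smoothBose (ε : ℝ) : Measurable (smoothBose ε) := by
  unfold smoothBose
  fun_prop

theorem tendsto_smoothBose {t : ℝ} (ht : 0 < t) :
    Tendsto (fun ε => smoothBose ε t) (𝓝[>] 0) (𝓝 (bose t : ℂ)) := by
  have h1 : Complex.exp t - 1 ≠ 0 := by
    have := (sub_pos.2 (Real.one_lt_exp_iff.2 ht)).ne'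
    exact_mod_cast this
  have hc : ContinuousAt (fun ε : ℝ => smoothBose ε t) 0 := by
    unfold smoothBose
    refine ContinuousAt.div_const (ContinuousAt.add ?_ ?_) 2
    · exact ContinuousAt.div (by fun_prop) (by fun_prop) (by simpa using h1)
    · exact ContinuousAt.div (by fun_prop) (by fun_prop) (by simpa using h1)
  have h2 : smoothBose 0 t = (bose t : ℂ) := by
    simp [smoothBose, bose]
  rw [← h2]
  exact hc.tendsto.mono_left nhdsWithin_le_nhds

theorem hasDerivAt_smoothKernel {ε : ℝ} (hε : ε ∈ Ioo (0 : ℝ) 1) (t : ℝ) :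
    HasDerivAt (smoothKernel ε)
      ((boseDeriv (t + ε * Complex.I) + boseDeriv (t - ε * Complex.I)) / 2) t := by
  have hs := sin_pos_of_mem hε
  have h1 := (hasDerivAt_inv_exp_neg_sub_one (z := t + ε * Complex.I)
    (exp_ne_one_of_sin_im_ne_zero (by simpa using hs.ne'))).comp_add_const (t : ℂ) (ε * Complex.I)
  have h2 := (hasDerivAt_inv_exp_neg_sub_one (z := t - ε * Complex.I)
    (exp_ne_one_of_sin_im_ne_zero (by simpa using hs.ne'))).comp_sub_const (t : ℂ) (ε * Complex.I)
  exact ((h1.comp_ofReal.add h2.comp_ofReal).div_const 2)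

namespace RegBound
variable {n : ℕ} {B : ℝ} {G G' : ℝ → ℂ}

theorem integrable_mul_of_norm_le (h : RegBound n B G G') {κ : ℝ → ℂ} (hm : Measurable κ) {C : ℝ}
    (hκ : ∀ t, ‖κ t‖ ≤ C * Real.exp (-|t|)) : Integrable (fun t => G t * κ t) := by
  have j1 := h.integrableOn_mul_of_le_exp (hm.comp measurable_neg) (C := C)
    (fun t ht => by simpa [abs_of_pos ht] using hκ (-t)) (σ := -1) (by simp)
  have j2 := h.integrableOn_mul_of_le_exp hm (C := C)
    (fun t ht => by simpa [abs_of_pos ht] using hκ t) (σ := 1) (by simp)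
  simp only [one_mul] at j2
  rw [← integrableOn_univ, ← Iic_union_Ioi (a := (0 : ℝ))]
  refine IntegrableOn.union ?_ j2
  rw [integrableOn_Iic_iff_integrableOn_Iio]
  have j := IntegrableOn.comp_neg_Iio (c := (0 : ℝ)) (f := fun t => G (-1 * t) * (κ ∘ Neg.neg) t)
    (by rwa [neg_zero])
  simpa using j

theorem integrable_mul_smoothKernel (h : RegBound n B G G') {ε : ℝ} (hε : ε ∈ Ioo (0 : ℝ) 1) :
    Integrable (fun t => G t * smoothKernel ε t) := by
  have j1 := h.integrableOn_mul_of_le_exp (measurable_smoothBose ε)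
    (fun t _ => norm_smoothBose_le hε t) (σ := -1) (by simp)
  have j2 := h.integrableOn_mul_of_le_exp (measurable_smoothBose ε)
    (fun t _ => norm_smoothBose_le hε t) (σ := 1) (by simp)
  have j3 := h.integrableOn_mul_of_le_one (χ := fun _ => 1) measurable_const (by simp)
  rw [← integrableOn_univ, ← Iic_union_Ioi (a := (0 : ℝ))]
  refine IntegrableOn.union ?_ ((j2.neg.sub j3).congr_fun (fun t _ => ?_) measurableSet_Ioi)
  · rw [integrableOn_Iic_iff_integrableOn_Iio]
    have j := IntegrableOn.comp_neg_Iio (c := (0 : ℝ)) (f := fun t => G (-1 * t) * smoothBose ε t)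
      (by rwa [neg_zero])
    refine j.congr_fun (fun t _ => ?_) measurableSet_Iio
    simp only [← smoothKernel_neg]
    ring_nf
  · simp only [smoothKernel_eq hε, Pi.sub_apply, Pi.neg_apply, one_mul]
    ring

/-- The mean of the two shifts satisfies the same reflection relations as 1/(e^{-t} - 1) itself,
with χ = 1 exactly. A single shift would leave an additional multiple of the delta distribution at 0
in the limit. -/
theorem tendsto_smoothKernel (h : RegBound n B G G') :
    Tendsto (fun ε => ∫ t, G t * smoothKernel ε t) (𝓝[>] 0) (𝓝 (regPairing G)) :=
  h.tendsto_integral_mul_kernel (β := smoothBose) (χ := fun _ _ => 1)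
    (C := fun ε => (Real.sin ε)⁻¹) measurable_smoothBose (fun _ => measurable_const)
    (fun ε _ t _ => smoothKernel_neg ε t) (fun _ hε t _ => smoothKernel_eq hε t)
    (fun ε _ _ ht => norm_smoothBose_le_bose ε ht) (fun _ hε t _ => norm_smoothBose_le hε t)
    (by simp) (fun _ ht => tendsto_smoothBose ht) (fun _ _ => tendsto_const_nhds)

end RegBound

theorem measurable_boseDeriv : Measurable boseDeriv := by
  unfold boseDeriv
  fun_prop

theorem norm_boseDeriv_shift_le {η : ℝ} (hη : Real.sin η ≠ 0) (t : ℝ) :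
    ‖boseDeriv (t + η * Complex.I)‖ ≤ (Real.sin η ^ 2)⁻¹ * Real.exp (-|t|) := by
  simpa using norm_boseDeriv_le (z := t + η * Complex.I) (by simpa using hη)

/-- Passing to the derivative of the kernel gains exponential decay at both ends, whereas the kernel
itself tends to -1 at +∞, and produces the function to which the Lipschitz formula applies. -/
theorem RegBound.integral_deriv_mul_smoothKernel {n n' : ℕ} {B B' : ℝ} {G G' G'' : ℝ → ℂ}
    (h : RegBound n B G G') (h' : RegBound n' B' G' G'') {ε : ℝ} (hε : ε ∈ Ioo (0 : ℝ) 1) :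
    ∫ t, G' t * smoothKernel ε t =
      -(((∫ t, G t * boseDeriv (t + ε * Complex.I)) +
        ∫ t, G t * boseDeriv (t + (-ε : ℝ) * Complex.I)) / 2) := by
  have hs := sin_pos_of_mem hε
  have i1 : Integrable fun t => G t * boseDeriv (t + ε * Complex.I) :=
    h.integrable_mul_of_norm_le (measurable_boseDeriv.comp (by fun_prop))
      (norm_boseDeriv_shift_le hs.ne')
  have i2 : Integrable fun t => G t * boseDeriv (t + (-ε : ℝ) * Complex.I) :=
    h.integrable_mul_of_norm_le (measurable_boseDeriv.comp (by fun_prop))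
      (norm_boseDeriv_shift_le (by simpa using hs.ne'))
  have hd : ∀ t : ℝ, HasDerivAt (smoothKernel ε)
      ((boseDeriv (t + ε * Complex.I) + boseDeriv (t + (-ε : ℝ) * Complex.I)) / 2) t := fun t => by
    have := hasDerivAt_smoothKernel hε t
    rwa [show (t : ℂ) - ε * Complex.I = t + (-ε : ℝ) * Complex.I by push_cast; ring] at this
  have key := integral_mul_deriv_eq_deriv_mul_of_integrable (fun t _ => h.hasDerivAt t) (fun t _ => hd t) ?_
    (h'.integrable_mul_smoothKernel hε) (h.integrable_mul_smoothKernel hε)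
  · rw [← neg_eq_iff_eq_neg, ← key, ← integral_add i1 i2, ← integral_div]
    exact integral_congr_ae (Eventually.of_forall fun t => by simp only; ring)
  · refine ((i1.add i2).div_const 2).congr (Eventually.of_forall fun t => ?_)
    simp only [Pi.add_apply, Pi.mul_apply]
    ring

/-! ### The distribution li_s on the strip -1 < Re s < 0 -/

theorem integrable_exp_neg_abs : Integrable fun y : ℝ => Real.exp (-|y|) := by
  rw [← integrableOn_univ, ← Iic_union_Ioi (a := (0 : ℝ))]
  refine IntegrableOn.union ?_ ?_
  · refine (integrableOn_exp_Iic 0).congr_fun (fun y hy => ?_) measurableSet_Iic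
    rw [abs_of_nonpos hy, neg_neg]
  · refine (integrableOn_exp_neg_Ioi 0).congr_fun (fun y hy => ?_) measurableSet_Ioi
    rw [abs_of_pos hy]

/-- On y ≤ 1 drop the exponential, on y > 1 drop the power, which is at most 1 as a < 0. The bound
does not depend on x, so it remains integrable against any Schwartz function of x. -/
theorem integrableOn_rpow_mul_exp_abs {a : ℝ} (ha : -1 < a) (ha0 : a < 0) (x : ℝ) :
    IntegrableOn (fun y : ℝ => y ^ a * Real.exp (-|x - y|)) (Ioi 0) ∧
      ∫ y in Ioi (0 : ℝ), y ^ a * Real.exp (-|x - y|) ≤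
        (∫ y in Ioc (0 : ℝ) 1, y ^ a) + ∫ y : ℝ, Real.exp (-|y|) := by
  have i1 : IntegrableOn (fun y : ℝ => y ^ a) (Ioc 0 1) := by
    rw [← intervalIntegrable_iff_integrableOn_Ioc_of_le zero_le_one]
    exact intervalIntegral.intervalIntegrable_rpow' ha
  have i0 := integrable_exp_neg_abs
  have i2 : Integrable fun y : ℝ => Real.exp (-|x - y|) := i0.comp_sub_left x
  have i3 : Integrable ((Ioc (0 : ℝ) 1).indicator fun y => y ^ a) :=
    i1.integrable_indicator measurableSet_Ioc
  have hle : ∀ y ∈ Ioi (0 : ℝ), y ^ a * Real.exp (-|x - y|) ≤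
      (Ioc (0 : ℝ) 1).indicator (fun y => y ^ a) y + Real.exp (-|x - y|) := by
    intro y hy
    have hy0 : (0 : ℝ) < y := hy
    have he : Real.exp (-|x - y|) ≤ 1 := Real.exp_le_one_iff.2 (by simp)
    have hp := Real.rpow_nonneg hy0.le a
    by_cases h1 : y ≤ 1
    · rw [indicator_of_mem (show y ∈ Ioc (0 : ℝ) 1 from ⟨hy0, h1⟩)]
      nlinarith [Real.exp_pos (-|x - y|)]
    · rw [indicator_of_notMem (fun h => h1 h.2), zero_add]
      exact mul_le_of_le_one_left (Real.exp_pos _).le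
        (Real.rpow_le_one_of_one_le_of_nonpos (not_le.1 h1).le ha0.le)
  have hint : IntegrableOn (fun y : ℝ => y ^ a * Real.exp (-|x - y|)) (Ioi 0) := by
    refine (i3.add i2).integrableOn.mono' (by fun_prop)
      (ae_restrict_of_forall_mem measurableSet_Ioi fun y hy => ?_)
    have hy0 : (0 : ℝ) < y := hy
    rw [Real.norm_of_nonneg (by positivity)]
    exact hle y hy
  refine ⟨hint, (setIntegral_mono_on hint (i3.add i2).integrableOn measurableSet_Ioi hle).trans ?_⟩
  have h4 : ∫ y in Ioi (0 : ℝ), ((Ioc (0 : ℝ) 1).indicator (fun y => y ^ a) y +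
      Real.exp (-|x - y|)) ≤ ∫ y, ((Ioc (0 : ℝ) 1).indicator (fun y => y ^ a) y +
      Real.exp (-|x - y|)) := by
    refine setIntegral_le_integral (i3.add i2) (Eventually.of_forall fun y => ?_)
    refine add_nonneg (indicator_nonneg (fun y hy => Real.rpow_nonneg hy.1.le a) y)
      (Real.exp_pos _).le
  refine h4.trans_eq ?_
  rw [integral_add i3 i2, integral_indicator measurableSet_Ioc]
  congr 1
  exact integral_sub_left_eq_self (fun y => Real.exp (-|y|)) volume x

theorem integrable_prod_mellin_kernel {s : ℂ} (hs : -1 < s.re) (hs0 : s.re < 0) (f : 𝓢(ℝ, ℂ))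
    {D : ℝ → ℂ} (hD : Measurable D) {C : ℝ} (hDC : ∀ t, ‖D t‖ ≤ C * Real.exp (-|t|)) :
    Integrable (fun p : ℝ × ℝ => f p.2 * ((p.1 : ℂ) ^ s * D (p.2 - p.1)))
      ((volume.restrict (Ioi 0)).prod volume) := by
  have hC : 0 ≤ C := by simpa using (norm_nonneg _).trans (hDC 0)
  have hm : AEStronglyMeasurable (fun p : ℝ × ℝ => f p.2 * ((p.1 : ℂ) ^ s * D (p.2 - p.1)))
      ((volume.restrict (Ioi 0)).prod volume) := by
    have := f.continuous.measurable
    exact (by fun_prop : Measurable fun p : ℝ × ℝ =>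
      f p.2 * ((p.1 : ℂ) ^ s * D (p.2 - p.1))).aestronglyMeasurable
  have hle : ∀ x y : ℝ, y ∈ Ioi (0 : ℝ) → ‖f x * ((y : ℂ) ^ s * D (x - y))‖ ≤
      ‖f x‖ * C * (y ^ s.re * Real.exp (-|x - y|)) := by
    intro x y hy
    have hy0 : (0 : ℝ) < y := hy
    rw [norm_mul, norm_mul, Complex.norm_cpow_eq_rpow_re_of_pos hy0]
    calc _ ≤ ‖f x‖ * (y ^ s.re * (C * Real.exp (-|x - y|))) := by
          gcongr
          exact hDC _
      _ = _ := by ring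
  have hint : ∀ x : ℝ, IntegrableOn (fun y : ℝ => f x * ((y : ℂ) ^ s * D (x - y))) (Ioi 0) := by
    intro x
    refine ((integrableOn_rpow_mul_exp_abs hs hs0 x).1.const_mul (‖f x‖ * C)).mono'
      (by fun_prop) (ae_restrict_of_forall_mem measurableSet_Ioi (hle x))
  rw [integrable_prod_iff' hm]
  refine ⟨Eventually.of_forall hint, ?_⟩
  refine (f.integrable.norm.mul_const
    (C * ((∫ y in Ioc (0 : ℝ) 1, y ^ s.re) + ∫ y : ℝ, Real.exp (-|y|)))).mono'
    hm.norm.prod_swap.integral_prod_right' (Eventually.of_forall fun x => ?_)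
  rw [Real.norm_of_nonneg (integral_nonneg fun _ => norm_nonneg _)]
  calc _ ≤ ∫ y in Ioi (0 : ℝ), ‖f x‖ * C * (y ^ s.re * Real.exp (-|x - y|)) :=
        setIntegral_mono_on (hint x).norm
          ((integrableOn_rpow_mul_exp_abs hs hs0 x).1.const_mul (‖f x‖ * C))
          measurableSet_Ioi (hle x)
    _ = ‖f x‖ * (C * ∫ y in Ioi (0 : ℝ), y ^ s.re * Real.exp (-|x - y|)) := by
        rw [integral_const_mul, mul_assoc]
    _ ≤ _ := by
        gcongr
        exact (integrableOn_rpow_mul_exp_abs hs hs0 x).2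

/-- Fubini moves the convolution with γ₊^{s+1} from the test function to the kernel D. -/
theorem integral_gammaConv_mul {s : ℂ} (hs : -1 < s.re) (hs0 : s.re < 0) (f : 𝓢(ℝ, ℂ))
    {D : ℝ → ℂ} (hD : Measurable D) {C : ℝ} (hDC : ∀ t, ‖D t‖ ≤ C * Real.exp (-|t|)) :
    ∫ t, gammaConv (s + 1) f t * D t =
      ∫ x, f x * ((Complex.Gamma (s + 1))⁻¹ *
        ∫ y in Ioi (0 : ℝ), (y : ℂ) ^ s * D (x - y)) := by
  have hF := integrable_prod_mellin_kernel hs hs0 f hD hDC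
  -- The shear (y, t) ↦ (y, y + t) preserves the measure and turns f(y + t) D(t) into f(x) D(x - y).
  have hmp := measurePreserving_prod_add (volume.restrict (Ioi (0 : ℝ))) (volume : Measure ℝ)
  have hF' := hmp.integrable_comp_of_integrable hF
  simp only [Function.comp_def, add_sub_cancel_left] at hF'
  have e1 : ∫ t, ∫ y in Ioi (0 : ℝ), f (y + t) * ((y : ℂ) ^ s * D t) =
      ∫ y in Ioi (0 : ℝ), ∫ t, f (y + t) * ((y : ℂ) ^ s * D t) :=
    (integral_integral_swap hF').symm
  have e2 : ∫ y in Ioi (0 : ℝ), ∫ x, f x * ((y : ℂ) ^ s * D (x - y)) =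
      ∫ x, ∫ y in Ioi (0 : ℝ), f x * ((y : ℂ) ^ s * D (x - y)) := integral_integral_swap hF
  have e3 : ∀ y : ℝ, ∫ t, f (y + t) * ((y : ℂ) ^ s * D t) =
      ∫ x, f x * ((y : ℂ) ^ s * D (x - y)) := fun y => by
    rw [← integral_add_left_eq_self (μ := volume) (fun x => f x * ((y : ℂ) ^ s * D (x - y))) y]
    simp
  simp only [e3] at e1
  rw [e2] at e1
  simp only [gammaConv, halfMellin, add_sub_cancel_right, mul_assoc]
  rw [integral_const_mul]
  simp only [mul_left_comm _ (Complex.Gamma (s + 1))⁻¹]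
  rw [integral_const_mul]
  congr 1
  simp only [← integral_const_mul, ← integral_mul_const]
  rw [← e1]
  exact integral_congr_ae (Eventually.of_forall fun t => by
    simp only
    congr 1 with y
    ring)

/-- The continuation of `li_s` to a neighbourhood of the real axis without the origin. -/
noncomputable def lipKernel (s z : ℂ) : ℂ := Complex.Gamma (1 - s) * ((-z) ^ (s - 1) + lipTail s z)

theorem lipKernel_eq_tsum {s z : ℂ} (hs0 : s.re < 0) (hz : |z.im| ≤ 1) :
    ∑' m : ℤ, Complex.Gamma (1 - s) * node z m ^ (s - 1) = lipKernel s z := by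
  have hsum : Summable fun m : ℤ => node z m ^ (s - 1) := by
    refine (summable_tailTerm hs0 hz).congr_cofinite ?_
    filter_upwards [(Set.finite_singleton (0 : ℤ)).compl_mem_cofinite] with m hm
    simp [tailTerm, show m ≠ 0 from hm]
  rw [tsum_mul_left, hsum.tsum_eq_add_tsum_ite 0, lipKernel, lipTail]
  congr 2
  simp [node]

theorem mellin_boseDeriv_eq_lipKernel {s z : ℂ} (hs : -1 < s.re) (hs0 : s.re < 0)
    (hz : |z.im| ≤ 1) (hn : ∀ m : ℤ, node z m ∈ Complex.slitPlane) :
    (Complex.Gamma (s + 1))⁻¹ * ∫ y in Ioi (0 : ℝ), (y : ℂ) ^ s * boseDeriv (z - y) =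
      lipKernel s z :=
  (integral_cpow_mul_boseDeriv hs hs0 hn).tsum_eq.symm.trans (lipKernel_eq_tsum hs0 hz)

theorem liSeries_eq_lipKernel {s : ℂ} (hs : -1 < s.re) (hs0 : s.re < 0) {x : ℝ} (hx : x < 0) :
    liSeries s x = lipKernel s x := by
  rw [liSeries, (hasSum_liTerm hs hx).tsum_eq]
  exact mellin_boseDeriv_eq_lipKernel hs hs0 (by simp)
    (fun m => node_ofReal_mem_slitPlane (Or.inl hx))

theorem integral_gammaConv_mul_boseDeriv {s : ℂ} (hs : -1 < s.re) (hs0 : s.re < 0)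
    (f : 𝓢(ℝ, ℂ)) {η : ℝ} (hη : η ≠ 0) (hη1 : |η| < 1) :
    ∫ t, gammaConv (s + 1) f t * boseDeriv (t + η * Complex.I) =
      ∫ x : ℝ, f x * lipKernel s (x + η * Complex.I) := by
  have hsin : Real.sin η ≠ 0 := by
    rw [abs_lt] at hη1
    rwa [Ne, Real.sin_eq_zero_iff_of_lt_of_lt (by linarith [Real.pi_gt_three])
      (by linarith [Real.pi_gt_three])]
  have h := integral_gammaConv_mul hs hs0 f
    (measurable_boseDeriv.comp (by fun_prop : Measurable fun t : ℝ => (t : ℂ) + η * Complex.I))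
    (norm_boseDeriv_shift_le hsin)
  simp only [Function.comp_def] at h
  rw [h]
  refine integral_congr_ae (Eventually.of_forall fun x => ?_)
  simp only
  rw [← mellin_boseDeriv_eq_lipKernel hs hs0 (by simpa using hη1.le)
    (fun m => node_mem_slitPlane_of_im (by simpa using hη)
      (by simpa using hη1.trans (by linarith [Real.pi_gt_three])) m)]
  congr 3 with y
  congr 2
  push_cast
  ring

/-- On the strip `-1 < Re s < 0`, `li_s` is the mean of the two boundary values of `lipKernel`. -/
theorem tendsto_lipKernel {s : ℂ} (hs : -1 < s.re) (hs0 : s.re < 0) (f : 𝓢(ℝ, ℂ)) :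
    Tendsto (fun ε : ℝ => ((∫ x : ℝ, f x * lipKernel s (x + ε * Complex.I)) +
      ∫ x : ℝ, f x * lipKernel s (x + (-ε : ℝ) * Complex.I)) / 2) (𝓝[>] 0)
      (𝓝 (liFun s f)) := by
  have h1 : 0 < (s + 1).re := by simp; linarith
  obtain ⟨n, B, h⟩ := exists_regBound_gammaConv h1 f
  obtain ⟨n', B', h'⟩ := exists_regBound_gammaConv h1 (schwartzDeriv f)
  have hli : liFun s f = -regPairing (gammaConv (s + 1) (schwartzDeriv f)) := by
    -- One derivative moves s from the strip to Re(s+1) > 0; its sign cancels against the sign from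
    -- the integration by parts below.
    rw [liFun_eq (k := 1) (by push_cast; linarith)]
    simp [liPos]
  rw [hli]
  refine h'.tendsto_smoothKernel.neg.congr' ?_
  filter_upwards [Ioo_mem_nhdsGT one_pos] with ε hε
  have h2 : |ε| < 1 := by rw [abs_of_pos hε.1]; exact hε.2
  rw [h.integral_deriv_mul_smoothKernel h' hε, neg_neg,
    integral_gammaConv_mul_boseDeriv hs hs0 f hε.1.ne' h2,
    integral_gammaConv_mul_boseDeriv hs hs0 f (neg_ne_zero.2 hε.1.ne') (by rwa [abs_neg])]

theorem norm_cpow_le_of_le_norm {z a : ℂ} {δ : ℝ} (hδ : 0 < δ) (hz : δ ≤ ‖z‖) (ha : a.re ≤ 0) :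
    ‖z ^ a‖ ≤ δ ^ a.re * Real.exp (Real.pi * |a.im|) := by
  refine (Complex.norm_cpow_le _ _).trans ?_
  rw [div_eq_mul_inv, ← Real.exp_neg]
  have h3 : -(Complex.arg z * a.im) ≤ Real.pi * |a.im| := by
    refine (neg_le_abs _).trans ?_
    rw [abs_mul]
    exact mul_le_mul_of_nonneg_right (Complex.abs_arg_le_pi _) (abs_nonneg _)
  exact mul_le_mul (Real.rpow_le_rpow_of_nonpos hδ hz ha) (Real.exp_le_exp.2 h3)
    (Real.exp_pos _).le (by positivity)

/-- In the upper half-plane arg(-z) = arg z - π, in the lower one arg(-z) = arg z + π. These shifts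
are the source of the phases e^{∓iπs}. -/
theorem neg_cpow_of_im_pos {z : ℂ} (hz : 0 < z.im) (a : ℂ) :
    (-z) ^ a = Complex.exp (-(Complex.I * Real.pi * a)) * z ^ a := by
  have h0 : z ≠ 0 := by rintro rfl; simp at hz
  rw [Complex.cpow_def_of_ne_zero (neg_ne_zero.2 h0), Complex.cpow_def_of_ne_zero h0, Complex.log,
    Complex.log, norm_neg, Complex.arg_neg_eq_arg_sub_pi_of_im_pos hz, ← Complex.exp_add]
  push_cast
  ring_nf

theorem neg_cpow_of_im_neg {z : ℂ} (hz : z.im < 0) (a : ℂ) :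
    (-z) ^ a = Complex.exp (Complex.I * Real.pi * a) * z ^ a := by
  have h0 : z ≠ 0 := by rintro rfl; simp at hz
  rw [Complex.cpow_def_of_ne_zero (neg_ne_zero.2 h0), Complex.cpow_def_of_ne_zero h0, Complex.log,
    Complex.log, norm_neg, Complex.arg_neg_eq_arg_add_pi_of_im_neg hz, ← Complex.exp_add]
  push_cast
  ring_nf

theorem continuous_lipTail_shift {s : ℂ} (hs : s.re < 0) {η : ℝ} (hη : |η| < 1) :
    Continuous fun x : ℝ => lipTail s (x + η * Complex.I) :=
  continuousOn_lipTail.comp_continuous (f := fun x : ℝ => (s, (x : ℂ) + η * Complex.I))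
    (by fun_prop) fun x => ⟨hs, by simpa using hη⟩

theorem integrable_mul_lipTail {s : ℂ} (hs : s.re < 0) {η : ℝ} (hη : |η| < 1) (f : 𝓢(ℝ, ℂ)) :
    Integrable fun x : ℝ => f x * lipTail s (x + η * Complex.I) :=
  f.integrable.mul_bdd (continuous_lipTail_shift hs hη).aestronglyMeasurable
    (Eventually.of_forall fun x => norm_lipTail_le le_rfl hs le_rfl (by simpa using hη.le))

theorem integrable_mul_neg_cpow {a : ℂ} (ha : a.re ≤ 0) {η : ℝ} (hη : η ≠ 0) (f : 𝓢(ℝ, ℂ)) :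
    Integrable fun x : ℝ => f x * (-(x + η * Complex.I)) ^ a := by
  refine f.integrable.mul_bdd (c := |η| ^ a.re * Real.exp (Real.pi * |a.im|)) ?_
    (Eventually.of_forall fun x =>
    norm_cpow_le_of_le_norm (abs_pos.2 hη) ?_ ha)
  · exact (by fun_prop : Measurable fun x : ℝ =>
      (-((x : ℂ) + η * Complex.I)) ^ a).aestronglyMeasurable
  · simpa using Complex.abs_im_le_norm (-((x : ℂ) + η * Complex.I))

theorem integral_mul_lipKernel {s : ℂ} (hs : s.re < 0) {η : ℝ} (hη : η ≠ 0) (hη1 : |η| < 1)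
    (f : 𝓢(ℝ, ℂ)) : ∫ x : ℝ, f x * lipKernel s (x + η * Complex.I) =
      Complex.Gamma (1 - s) * ((∫ x : ℝ, f x * (-(x + η * Complex.I)) ^ (s - 1)) +
        ∫ x : ℝ, f x * lipTail s (x + η * Complex.I)) := by
  rw [← integral_add (integrable_mul_neg_cpow (by simp; linarith) hη f)
    (integrable_mul_lipTail hs hη1 f), ← integral_const_mul]
  exact integral_congr_ae (Eventually.of_forall fun x => by simp only [lipKernel]; ring)

theorem continuousAt_lipTail {s : ℂ} (hs : s.re < 0) (x : ℝ) :
    ContinuousAt (fun z : ℂ => lipTail s z) x := by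
  have hW : IsOpen {z : ℂ | |z.im| < 1} := isOpen_lt Complex.continuous_im.abs continuous_const
  have hc : ContinuousOn (fun z : ℂ => lipTail s z) {z | |z.im| < 1} :=
    continuousOn_lipTail.comp (f := fun z : ℂ => (s, z)) (by fun_prop) fun z hz => ⟨hs, hz⟩
  exact hc.continuousAt (hW.mem_nhds (by simp))

theorem tendsto_lipTail_shift {s : ℂ} (hs : s.re < 0) {η : ℝ → ℝ} (hη : Tendsto η (𝓝[>] 0) (𝓝 0))
    (f : 𝓢(ℝ, ℂ)) : Tendsto (fun ε => ∫ x : ℝ, f x * lipTail s (x + η ε * Complex.I)) (𝓝[>] 0)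
      (𝓝 (∫ x : ℝ, f x * lipTail s x)) := by
  have h1 : ∀ᶠ ε in 𝓝[>] (0 : ℝ), |η ε| < 1 := by
    have := hη.abs
    rw [abs_zero] at this
    exact this.eventually_lt_const one_pos
  refine tendsto_integral_filter_of_dominated_convergence
    (fun x => ‖f x‖ * ∑' m : ℤ, Real.exp (Real.pi * |s.im|) * |(m : ℝ)| ^ (-(1 - s.re)))
    (h1.mono fun ε hε => (integrable_mul_lipTail hs hε f).aestronglyMeasurable)
    (h1.mono fun ε hε => Eventually.of_forall fun x => ?_) (f.integrable.norm.mul_const _)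
    (Eventually.of_forall fun x => ?_)
  · rw [norm_mul]
    gcongr
    exact norm_lipTail_le le_rfl hs le_rfl (by simpa using hε.le)
  · refine Tendsto.const_mul _ ?_
    have h2 : Tendsto (fun ε => (x : ℂ) + η ε * Complex.I) (𝓝[>] 0) (𝓝 (x : ℂ)) := by
      have := ((Complex.continuous_ofReal.tendsto 0).comp hη).mul_const Complex.I
      simpa using this.const_add (x : ℂ)
    exact (continuousAt_lipTail hs x).tendsto.comp h2

/-- The term m = 0 has different boundary values from the two sides and yields the two powers. The
tail is continuous across the real axis, so both sides contribute the same integral. -/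
theorem liFun_eq_boundaryPower {s : ℂ} (hs : -1 < s.re) (hs0 : s.re < 0) {Tp Tm : 𝓢'(ℝ, ℂ)}
    (hp : IsBoundaryPower 1 (s - 1) Tp) (hm : IsBoundaryPower (-1) (s - 1) Tm) (f : 𝓢(ℝ, ℂ)) :
    liFun s f = -(Complex.Gamma (1 - s) / 2) *
        (Complex.exp (-(Complex.I * Real.pi * s)) * Tp f +
          Complex.exp (Complex.I * Real.pi * s) * Tm f) +
      Complex.Gamma (1 - s) * ∫ x : ℝ, f x * lipTail s x := by
  have hid : Tendsto (fun ε : ℝ => ε) (𝓝[>] 0) (𝓝 0) := nhdsWithin_le_nhds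
  have hneg : Tendsto (fun ε : ℝ => -ε) (𝓝[>] 0) (𝓝 0) := by simpa using hid.neg
  -- The exponent is s - 1, not s; the extra e^{±iπ} = -1 is the overall minus sign of the formula.
  have e1 : Complex.exp (-(Complex.I * Real.pi * (s - 1))) =
      -Complex.exp (-(Complex.I * Real.pi * s)) := by
    rw [show -(Complex.I * Real.pi * (s - 1)) = -(Complex.I * Real.pi * s) + Real.pi * Complex.I by
      ring, Complex.exp_add, Complex.exp_pi_mul_I]
    ring
  have e2 : Complex.exp (Complex.I * Real.pi * (s - 1)) =
      -Complex.exp (Complex.I * Real.pi * s) := by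
    rw [show Complex.I * Real.pi * (s - 1) = Complex.I * Real.pi * s - Real.pi * Complex.I by
      ring, Complex.exp_sub, Complex.exp_pi_mul_I]
    ring
  refine tendsto_nhds_unique (tendsto_lipKernel hs hs0 f) ?_
  have lim := ((((hp f).const_mul (-Complex.exp (-(Complex.I * Real.pi * s)))).add
    (tendsto_lipTail_shift hs0 hid f)).const_mul (Complex.Gamma (1 - s))).add
    ((((hm f).const_mul (-Complex.exp (Complex.I * Real.pi * s))).add
    (tendsto_lipTail_shift hs0 hneg f)).const_mul (Complex.Gamma (1 - s))) |>.div_const 2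
  refine Tendsto.congr' ?_ (lim.trans_eq ?_)
  · filter_upwards [Ioo_mem_nhdsGT one_pos] with ε hε
    have h2 : |ε| < 1 := by rw [abs_of_pos hε.1]; exact hε.2
    rw [integral_mul_lipKernel hs0 hε.1.ne' h2,
      integral_mul_lipKernel hs0 (neg_ne_zero.2 hε.1.ne') (by rwa [abs_neg])]
    congr 4
    · rw [← integral_const_mul]
      refine integral_congr_ae (Eventually.of_forall fun x => ?_)
      simp only
      rw [neg_cpow_of_im_pos (by simpa using hε.1), e1]
      push_cast
      ring_nf
    · rw [← integral_const_mul]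
      refine integral_congr_ae (Eventually.of_forall fun x => ?_)
      simp only
      rw [neg_cpow_of_im_neg (by simpa using hε.1), e2]
      push_cast
      ring_nf
  · congr 1
    ring

/-- The cut of (-z)^{s-1} is the positive real axis, so both boundary values agree on x < 0 with the
series. Support at distance δ from 0 keeps (-z)^{s-1} bounded and allows dominated convergence. -/
theorem liFun_eq_integral_liSeries {s : ℂ} (hs : -1 < s.re) (hs0 : s.re < 0) {δ : ℝ} (hδ : 0 < δ)
    {f : 𝓢(ℝ, ℂ)} (hf : ∀ x, -δ < x → f x = 0) :
    liFun s f = ∫ x : ℝ, liSeries s x * f x := by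
  have hid : Tendsto (fun ε : ℝ => ε) (𝓝[>] 0) (𝓝 0) := nhdsWithin_le_nhds
  have hneg : Tendsto (fun ε : ℝ => -ε) (𝓝[>] 0) (𝓝 0) := by simpa using hid.neg
  have key : ∀ η : ℝ → ℝ, Tendsto η (𝓝[>] 0) (𝓝 0) → (∀ ε ∈ Ioo (0 : ℝ) 1, η ε ≠ 0 ∧ |η ε| < 1) →
      Tendsto (fun ε => ∫ x : ℝ, f x * lipKernel s (x + η ε * Complex.I)) (𝓝[>] 0)
        (𝓝 (∫ x : ℝ, liSeries s x * f x)) := by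
    intro η hη hη1
    have hmem : ∀ᶠ ε : ℝ in 𝓝[>] 0, ε ∈ Ioo (0 : ℝ) 1 := Ioo_mem_nhdsGT one_pos
    refine tendsto_integral_filter_of_dominated_convergence
      (fun x => ‖f x‖ * (‖Complex.Gamma (1 - s)‖ *
        (δ ^ (s - 1).re * Real.exp (Real.pi * |(s - 1).im|) +
        ∑' m : ℤ, Real.exp (Real.pi * |s.im|) * |(m : ℝ)| ^ (-(1 - s.re)))))
      (hmem.mono fun ε hε => ?_)
      (hmem.mono fun ε hε => Eventually.of_forall fun x => ?_) (f.integrable.norm.mul_const _)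
      (Eventually.of_forall fun x => ?_)
    · obtain ⟨h1, h2⟩ := hη1 ε hε
      have h3 := ((integrable_mul_neg_cpow (a := s - 1) (by simp; linarith) h1 f).add
        (integrable_mul_lipTail hs0 h2 f)).const_mul (Complex.Gamma (1 - s))
      refine h3.aestronglyMeasurable.congr (Eventually.of_forall fun x => ?_)
      simp only [lipKernel, Pi.add_apply]
      ring
    · by_cases hx : -δ < x
      · rw [hf x hx]; simp
      rw [norm_mul, lipKernel, norm_mul]
      gcongr
      refine (norm_add_le _ _).trans (add_le_add ?_ ?_)
      · refine norm_cpow_le_of_le_norm hδ ?_ (by simp; linarith)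
        have h4 := Complex.abs_re_le_norm (-((x : ℂ) + η ε * Complex.I))
        simp only [Complex.neg_re, Complex.add_re, Complex.ofReal_re, Complex.mul_re,
          Complex.I_re, Complex.I_im, Complex.ofReal_im, mul_zero, zero_mul, sub_zero,
          add_zero] at h4
        linarith [le_abs_self (-x)]
      · exact norm_lipTail_le le_rfl hs0 le_rfl (by simpa using (hη1 ε hε).2.le)
    · by_cases hx : -δ < x
      · simp [hf x hx]
      have hx0 : x < 0 := by linarith
      rw [mul_comm (liSeries s x), liSeries_eq_lipKernel hs hs0 hx0]
      refine Tendsto.const_mul _ (Tendsto.const_mul _ (Tendsto.add ?_ ?_))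
      all_goals
        have h2 : Tendsto (fun ε => (x : ℂ) + η ε * Complex.I) (𝓝[>] 0) (𝓝 (x : ℂ)) := by
          have := ((Complex.continuous_ofReal.tendsto 0).comp hη).mul_const Complex.I
          simpa using this.const_add (x : ℂ)
      · exact h2.neg.cpow tendsto_const_nhds (Or.inl (by simpa using hx0))
      · exact (continuousAt_lipTail hs0 x).tendsto.comp h2
  have lim := ((key _ hid fun ε hε => ⟨hε.1.ne', by rw [abs_of_pos hε.1]; exact hε.2⟩).add
    (key _ hneg fun ε hε => ⟨neg_ne_zero.2 hε.1.ne', by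
      rw [abs_neg, abs_of_pos hε.1]; exact hε.2⟩)).div_const 2
  rw [add_self_div_two] at lim
  exact tendsto_nhds_unique (tendsto_lipKernel hs hs0 f) lim

/-! ### The poles of `Γ(1 - s)` -/

theorem notMem_posInts_iff {s : ℂ} : s ∉ posInts ↔ ∀ m : ℕ, 1 - s ≠ -m := by
  simp only [posInts, mem_ofPred_eq, not_exists]
  refine forall_congr' fun m => not_congr ⟨fun h => by rw [h]; ring, fun h => ?_⟩
  linear_combination -h

theorem isOpen_compl_posInts : IsOpen posIntsᶜ := by
  have h : posIntsᶜ = {s : ℂ | (Complex.Gamma (1 - s))⁻¹ ≠ 0} := by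
    ext s
    rw [mem_compl_iff, notMem_posInts_iff, mem_ofPred_eq, ne_eq, inv_eq_zero,
      Complex.Gamma_eq_zero_iff, not_exists]
  rw [h]
  exact isOpen_ne_fun (Complex.differentiable_one_div_Gamma.continuous.comp
    (continuous_const.sub continuous_id)) continuous_const

theorem isPreconnected_compl_posInts : IsPreconnected posIntsᶜ := by
  have h : posInts.Countable := by
    refine (countable_range fun n : ℕ => (n : ℂ) + 1).mono ?_
    rintro _ ⟨n, rfl⟩
    exact mem_range_self n
  exact (h.isPathConnected_compl_of_one_lt_rank
    (by rw [Complex.rank_real_complex]; exact Cardinal.one_lt_two)).isConnected.isPreconnected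

theorem differentiableAt_Gamma_one_sub {s : ℂ} (hs : s ∉ posInts) :
    DifferentiableAt ℂ (fun s => Complex.Gamma (1 - s)) s :=
  DifferentiableAt.comp (g := Complex.Gamma) s
    (Complex.differentiableAt_Gamma _ (notMem_posInts_iff.1 hs)) (by fun_prop)

theorem differentiableOn_Gamma_one_sub :
    DifferentiableOn ℂ (fun s => Complex.Gamma (1 - s)) posIntsᶜ :=
  fun _ hs => (differentiableAt_Gamma_one_sub hs).differentiableWithinAt

/-- The poles of `Γ(1 - s)` are simple. -/
theorem exists_sub_mul_Gamma_eq (n : ℕ) : ∃ g : ℂ → ℂ,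
    DifferentiableOn ℂ g {s | n < s.re ∧ s.re < n + 2} ∧
    ∀ s : ℂ, n < s.re ∧ s.re < n + 2 → s ≠ n + 1 →
      (s - (n + 1)) * Complex.Gamma (1 - s) = g s := by
  induction n with
  | zero =>
    -- The base case is (s-1) Γ(1-s) = -Γ(2-s), with Re(2-s) > 0 on the strip. The inductive step
    -- divides by 1 - s via Γ(1-s) = Γ(2-s)/(1-s), and 1 - s has no zero on the later strips.
    refine ⟨fun s => -Complex.Gamma (2 - s), fun s hs => ?_, fun s _ hs => ?_⟩
    · refine DifferentiableAt.differentiableWithinAt (DifferentiableAt.neg ?_)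
      refine DifferentiableAt.comp (g := Complex.Gamma) s
        (Complex.differentiableAt_Gamma _ fun m h => ?_) (by fun_prop)
      have h1 := congrArg Complex.re h
      have h2 := hs.2
      simp at h1 h2
      linarith [m.cast_nonneg (α := ℝ)]
    · have h0 : 1 - s ≠ 0 := fun h => hs (by push_cast; linear_combination -h)
      simp only
      rw [show (2 : ℂ) - s = 1 - s + 1 by ring, Complex.Gamma_add_one _ h0]
      push_cast
      ring
  | succ n ih =>
    obtain ⟨g, hg, hgs⟩ := ih
    have hne : ∀ s : ℂ, (n + 1 : ℕ) < s.re → 1 - s ≠ 0 := fun s hs h => by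
      have h1 := congrArg Complex.re h
      push_cast at hs
      simp at h1
      linarith [n.cast_nonneg (α := ℝ)]
    have hmem : ∀ s : ℂ, (n + 1 : ℕ) < s.re ∧ s.re < (n + 1 : ℕ) + 2 →
        n < (s - 1).re ∧ (s - 1).re < n + 2 := fun s hs => by
      push_cast at hs
      simp only [Complex.sub_re, Complex.one_re]
      constructor <;> linarith [hs.1, hs.2]
    refine ⟨fun s => g (s - 1) / (1 - s), ?_, fun s hs hs1 => ?_⟩
    · exact (hg.comp (f := fun s : ℂ => s - 1) (by fun_prop) hmem).div (by fun_prop)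
        fun s hs => hne s hs.1
    · have h0 := hne s hs.1
      rw [eq_div_iff h0, ← hgs (s - 1) (hmem s hs)
        (fun h => hs1 (by push_cast; linear_combination h)),
        show 1 - (s - 1) = 1 - s + 1 by ring, Complex.Gamma_add_one _ h0]
      push_cast
      ring

/-! ### The family of smooth functions -/

/-- Derivatives in x are values of the same family at shifted s, so smoothness, holomorphy in s and
joint continuity of all derivatives follow from the order-zero statements. -/
theorem iteratedDeriv_const_mul_regPart (c s : ℂ) (j : ℕ) :
    iteratedDeriv j (fun x => c * regPart s x) =
      fun x => c * (∏ i ∈ Finset.range j, (1 - s + i)) * regPart (s - j) x := by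
  induction j with
  | zero => simp
  | succ j ih =>
    rw [iteratedDeriv_succ, ih]
    ext x
    rw [((hasDerivAt_regPart (s - j) x).const_mul _).deriv, Finset.prod_range_succ]
    push_cast
    rw [show s - (j + 1 : ℂ) = s - j - 1 by ring]
    ring

theorem isHolomorphicSmoothFamilyOn_mul_regPart {U : Set ℂ} {g : ℂ → ℂ}
    (hg : DifferentiableOn ℂ g U) :
    IsHolomorphicSmoothFamilyOn U (fun s x => g s * regPart s x) := by
  refine ⟨fun s _ => contDiff_of_differentiable_iteratedDeriv fun j _ => ?_, fun j => ?_⟩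
  · rw [iteratedDeriv_const_mul_regPart]
    exact fun x => ((hasDerivAt_regPart (s - j) x).const_mul _).differentiableAt
  · simp only [iteratedDeriv_const_mul_regPart]
    refine ⟨fun x => ?_, ?_⟩
    · refine (hg.mul (by fun_prop)).mul ?_
      exact ((differentiable_regPart x).comp (f := fun s : ℂ => s - j)
        (by fun_prop)).differentiableOn
    · refine ContinuousOn.mul (ContinuousOn.mul ?_ (by fun_prop)) ?_
      · exact hg.continuousOn.comp (f := fun p : ℂ × ℝ => p.1) (by fun_prop) fun p hp => hp.1
      · exact (continuous_regPart.comp (f := fun p : ℂ × ℝ => (p.1 - j, p.2))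
          (by fun_prop)).continuousOn

theorem isMeromorphicSmoothFamily_regPart :
    IsMeromorphicSmoothFamily posInts fun s x => Complex.Gamma (1 - s) * regPart s x := by
  refine ⟨isHolomorphicSmoothFamilyOn_mul_regPart differentiableOn_Gamma_one_sub, ?_⟩
  rintro _ ⟨n, rfl⟩
  obtain ⟨g, hg, hgs⟩ := exists_sub_mul_Gamma_eq n
  refine ⟨1, {s | n < s.re ∧ s.re < n + 2}, fun s x => g s * regPart s x,
    (isOpen_lt continuous_const Complex.continuous_re).inter
      (isOpen_lt Complex.continuous_re continuous_const), by constructor <;> simp,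
    isHolomorphicSmoothFamilyOn_mul_regPart hg, fun s hs hs1 x => ?_⟩
  rw [pow_one, ← mul_assoc, hgs s hs hs1]

theorem continuous_regPart_right (s : ℂ) : Continuous (regPart s) :=
  continuous_regPart.comp (f := fun x : ℝ => (s, x)) (by fun_prop)

theorem integrable_mul_regPart (s : ℂ) (f : 𝓢(ℝ, ℂ)) :
    Integrable fun x : ℝ => f x * regPart s x := by
  obtain ⟨V, hV, C, m, hC, hb⟩ := polyBoundedNear_regPart s
  refine ((integrable_one_add_abs_pow_mul m f).const_mul C).mono'
    (f.continuous.mul (continuous_regPart_right s)).aestronglyMeasurable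
    (Eventually.of_forall fun x => ?_)
  rw [norm_mul, mul_comm, ← mul_assoc]
  gcongr
  exact hb s (mem_of_mem_nhds hV) x

theorem differentiable_integral_mul_regPart (f : 𝓢(ℝ, ℂ)) :
    Differentiable ℂ fun s => ∫ x : ℝ, f x * regPart s x := by
  rw [← differentiableOn_univ]
  refine differentiableOn_integral_of_dominated isOpen_univ
    (fun s _ => (integrable_mul_regPart s f).aestronglyMeasurable)
    (Eventually.of_forall fun x =>
      ((differentiable_regPart x).const_mul (f x)).differentiableOn) fun s₀ _ => ?_
  obtain ⟨V, hV, C, m, hC, hb⟩ := polyBoundedNear_regPart s₀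
  refine ⟨V, hV, _, (integrable_one_add_abs_pow_mul m f).const_mul C,
    Eventually.of_forall fun x s hs => ?_⟩
  rw [norm_mul, mul_comm, ← mul_assoc]
  gcongr
  exact hb s hs x

/-! ### Continuation in `s` -/

theorem eventually_mem_strip : ∀ᶠ s : ℂ in 𝓝 (-1 / 2), -1 < s.re ∧ s.re < 0 :=
  ((isOpen_lt continuous_const Complex.continuous_re).inter
    (isOpen_lt Complex.continuous_re continuous_const)).mem_nhds
    (show (-1 / 2 : ℂ) ∈ _ by constructor <;> norm_num)

/-- Both sides are holomorphic off the poles of Γ(1-s), a connected open set, and agree on the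
strip, where `regPart` is the tail itself. -/
theorem liFun_eq_boundaryPower_add_regPart {Tp Tm : ℂ → 𝓢'(ℝ, ℂ)}
    (hp : ∀ a, IsBoundaryPower 1 a (Tp a)) (hm : ∀ a, IsBoundaryPower (-1) a (Tm a))
    (hp' : IsEntireFamily Tp) (hm' : IsEntireFamily Tm) {s : ℂ} (hs : s ∉ posInts) (f : 𝓢(ℝ, ℂ)) :
    liFun s f = -(Complex.Gamma (1 - s) / 2) *
        (Complex.exp (-(Complex.I * Real.pi * s)) * Tp (s - 1) f +
          Complex.exp (Complex.I * Real.pi * s) * Tm (s - 1) f) +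
      Complex.Gamma (1 - s) * ∫ x : ℝ, f x * regPart s x := by
  have hTp : Differentiable ℂ fun s : ℂ => Tp (s - 1) f :=
    (hp' f).comp (f := fun s : ℂ => s - 1) (by fun_prop)
  have hTm : Differentiable ℂ fun s : ℂ => Tm (s - 1) f :=
    (hm' f).comp (f := fun s : ℂ => s - 1) (by fun_prop)
  have hI := differentiable_integral_mul_regPart f
  have hΓ := differentiableOn_Gamma_one_sub
  have hR : DifferentiableOn ℂ (fun s => -(Complex.Gamma (1 - s) / 2) *
        (Complex.exp (-(Complex.I * Real.pi * s)) * Tp (s - 1) f +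
          Complex.exp (Complex.I * Real.pi * s) * Tm (s - 1) f) +
      Complex.Gamma (1 - s) * ∫ x : ℝ, f x * regPart s x) posIntsᶜ := by
    refine ((hΓ.div_const 2).neg.mul (Differentiable.differentiableOn ?_)).add
      (hΓ.mul hI.differentiableOn)
    exact (Differentiable.mul (by fun_prop) hTp).add (Differentiable.mul (by fun_prop) hTm)
  have hmem : (-1 / 2 : ℂ) ∈ posIntsᶜ := by
    rw [mem_compl_iff, notMem_posInts_iff]
    intro m h
    have h1 := congrArg Complex.re h
    norm_num at h1
    linarith [m.cast_nonneg (α := ℝ)]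
  refine ((differentiable_liFun f).differentiableOn.analyticOnNhd
    isOpen_compl_posInts).eqOn_of_preconnected_of_eventuallyEq
    (hR.analyticOnNhd isOpen_compl_posInts) isPreconnected_compl_posInts hmem ?_ hs
  filter_upwards [eventually_mem_strip] with s hs
  rw [liFun_eq_boundaryPower hs.1 hs.2 (hp _) (hm _) f]
  simp only [regPart_eq_lipTail hs.2]

/-- The support is closed and misses 0, hence misses a neighbourhood of 0. It may still be unbounded
to the left. -/
theorem exists_forall_eq_zero {f : 𝓢(ℝ, ℂ)} (hf : tsupport f ⊆ Iio 0) :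
    ∃ δ > 0, ∀ x, -δ < x → f x = 0 := by
  have h0 : (tsupport f)ᶜ ∈ 𝓝 (0 : ℝ) :=
    (isClosed_tsupport f).isOpen_compl.mem_nhds fun h => lt_irrefl (0 : ℝ) (hf h)
  obtain ⟨δ, hδ, hb⟩ := Metric.mem_nhds_iff.1 h0
  refine ⟨δ, hδ, fun x hx => image_eq_zero_of_notMem_tsupport fun h => ?_⟩
  have hx0 : x < 0 := hf h
  exact hb (by rw [Metric.mem_ball, Real.dist_eq, sub_zero, abs_of_neg hx0]; linarith) h

theorem aestronglyMeasurable_liSeries_mul (s : ℂ) {f : 𝓢(ℝ, ℂ)} {δ : ℝ} (hδ : 0 < δ)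
    (hf : ∀ x, -δ < x → f x = 0) :
    AEStronglyMeasurable (fun x : ℝ => liSeries s x * f x) volume := by
  have h1 : ContinuousOn (fun x : ℝ => liSeries s x * f x) (Iio 0) :=
    (contDiffOn_liSeries s).continuousOn.mul f.continuous.continuousOn
  have h2 := (aestronglyMeasurable_indicator_iff measurableSet_Iio).2
    (h1.aestronglyMeasurable (μ := volume) measurableSet_Iio)
  refine h2.congr (Eventually.of_forall fun x => ?_)
  by_cases hx : x < 0
  · exact indicator_of_mem (show x ∈ Iio 0 from hx) _
  · simp [hx, hf x (by linarith)]

theorem norm_liSeries_mul_le {s : ℂ} {N : ℕ} (hs : -(N : ℝ) ≤ s.re) {f : 𝓢(ℝ, ℂ)} {δ : ℝ}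
    (hδ : 0 < δ) (hf : ∀ x, -δ < x → f x = 0) (x : ℝ) : ‖liSeries s x * f x‖ ≤
      (∑' n : ℕ, ((n + 1 : ℕ) : ℝ) ^ N * Real.exp (-δ) ^ (n + 1)) * ‖f x‖ := by
  by_cases hx : -δ < x
  · simp [hf x hx]
  · rw [norm_mul]
    gcongr
    exact norm_liSeries_le hs hδ (not_lt.1 hx)

theorem integrable_liSeries_mul (s : ℂ) {f : 𝓢(ℝ, ℂ)} {δ : ℝ} (hδ : 0 < δ)
    (hf : ∀ x, -δ < x → f x = 0) : Integrable fun x : ℝ => liSeries s x * f x := by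
  obtain ⟨N, hN⟩ := exists_nat_ge (-s.re)
  exact (f.integrable.norm.const_mul _).mono' (aestronglyMeasurable_liSeries_mul s hδ hf)
    (Eventually.of_forall (norm_liSeries_mul_le (by linarith) hδ hf))

theorem differentiable_integral_liSeries_mul {f : 𝓢(ℝ, ℂ)} {δ : ℝ} (hδ : 0 < δ)
    (hf : ∀ x, -δ < x → f x = 0) :
    Differentiable ℂ fun s => ∫ x : ℝ, liSeries s x * f x := by
  rw [← differentiableOn_univ]
  refine differentiableOn_integral_of_dominated isOpen_univ
    (fun s _ => aestronglyMeasurable_liSeries_mul s hδ hf)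
    (Eventually.of_forall fun x => ?_) fun s₀ _ => ?_
  · by_cases hx : -δ < x
    · simp only [hf x hx, mul_zero]
      exact differentiableOn_const 0
    · exact ((differentiable_liSeries (show x < 0 by linarith)).mul_const _).differentiableOn
  · obtain ⟨N, hN⟩ := exists_nat_gt (-s₀.re)
    refine ⟨{s | -(N : ℝ) < s.re}, (isOpen_lt continuous_const Complex.continuous_re).mem_nhds
      (show -(N : ℝ) < s₀.re by linarith), _, f.integrable.norm.const_mul _,
      Eventually.of_forall fun x s hs => norm_liSeries_mul_le (le_of_lt hs) hδ hf x⟩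

/-- Both sides are entire in s, the right one because the series converges uniformly for x ≤ -δ,
locally uniformly in s. They agree near s = -1/2. -/
theorem liFun_eq_integral_liSeries_mul (s : ℂ) {f : 𝓢(ℝ, ℂ)} {δ : ℝ} (hδ : 0 < δ)
    (hf : ∀ x, -δ < x → f x = 0) : liFun s f = ∫ x : ℝ, liSeries s x * f x := by
  refine ((differentiable_liFun f).differentiableOn.analyticOnNhd
    isOpen_univ).eqOn_of_preconnected_of_eventuallyEq
    ((differentiable_integral_liSeries_mul hδ hf).differentiableOn.analyticOnNhd isOpen_univ)
    isPreconnected_univ (mem_univ (-1 / 2)) ?_ (mem_univ s)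
  filter_upwards [eventually_mem_strip] with s hs using liFun_eq_integral_liSeries hs.1 hs.2 hδ hf

end Polylog

/-! ### Assembly of the proposition -/

theorem mainTheorem2 :
    ∃ li etaPlus etaMinus : ℂ → 𝓢'(ℝ, ℂ),
      -- `li s` is the convolution of `γ₊^s` and `PV 1 / (e^{-x} - 1)`
      (∀ s : ℂ, Polylog.IsGammaConvLiZero s (li s)) ∧
      -- it is entire in `s`
      Polylog.IsEntireFamily li ∧
      -- for `Re s ≥ 0` it extends the smooth function `∑ e^{nx} / n^s` on `x < 0`
      (∀ s : ℂ, 0 ≤ s.re →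
        (∀ x : ℝ, x < 0 → Summable (Polylog.liTerm s x)) ∧
        ContDiffOn ℝ ∞ (Polylog.liSeries s) (Iio 0) ∧
        ∀ f : 𝓢(ℝ, ℂ), tsupport f ⊆ Iio 0 →
          Integrable (fun x : ℝ => Polylog.liSeries s x * f x) ∧
          li s f = ∫ x : ℝ, Polylog.liSeries s x * f x) ∧
      -- `etaPlus a = (x + i0)^a` and `etaMinus a = (x - i0)^a`
      (∀ a : ℂ, Polylog.IsBoundaryPower 1 a (etaPlus a)) ∧
      (∀ a : ℂ, Polylog.IsBoundaryPower (-1) a (etaMinus a)) ∧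
      -- the congruence modulo meromorphic families of smooth functions
      ∃ R : ℂ → ℝ → ℂ,
        Polylog.IsMeromorphicSmoothFamily Polylog.posInts R ∧
        ∀ s : ℂ, s ∉ Polylog.posInts → ∀ f : 𝓢(ℝ, ℂ),
          Integrable (fun x : ℝ => R s x * f x) ∧
          li s f =
            -(Complex.Gamma (1 - s) / 2) *
              (Complex.exp (-(Complex.I * Real.pi * s)) * etaPlus (s - 1) f +
                Complex.exp (Complex.I * Real.pi * s) * etaMinus (s - 1) f) +
            ∫ x : ℝ, R s x * f x := by
  choose li hli using Polylog.exists_temperedDistribution_liFun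
  obtain ⟨Tp, hp, hp'⟩ := Polylog.exists_boundaryPower (Or.inl rfl : (1 : ℝ) = 1 ∨ (1 : ℝ) = -1)
  obtain ⟨Tm, hm, hm'⟩ := Polylog.exists_boundaryPower (Or.inr rfl : (-1 : ℝ) = 1 ∨ (-1 : ℝ) = -1)
  refine ⟨li, Tp, Tm, fun s => Polylog.isGammaConvLiZero_of_eq_liFun (hli s), fun f => ?_,
    fun s _ => ⟨fun x hx => Polylog.summable_liTerm s hx, Polylog.contDiffOn_liSeries s,
      fun f hf => ?_⟩, hp, hm, fun s x => Complex.Gamma (1 - s) * Polylog.regPart s x,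
    Polylog.isMeromorphicSmoothFamily_regPart, fun s hs f => ?_⟩
  · simp only [hli]
    exact Polylog.differentiable_liFun f
  · obtain ⟨δ, hδ, h0⟩ := Polylog.exists_forall_eq_zero hf
    exact ⟨Polylog.integrable_liSeries_mul s hδ h0, by
      rw [hli, Polylog.liFun_eq_integral_liSeries_mul s hδ h0]⟩
  · have hR : (fun x => Complex.Gamma (1 - s) * Polylog.regPart s x * f x) =
        fun x => Complex.Gamma (1 - s) * (f x * Polylog.regPart s x) := by
      ext x
      ring
    rw [hR, integral_const_mul]
    refine ⟨(Polylog.integrable_mul_regPart s f).const_mul _, ?_⟩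
    rw [hli, Polylog.liFun_eq_boundaryPower_add_regPart hp hm hp' hm' hs f]
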